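/- Let $R$ be a commutative ring in which $2$ is invertible, and let $(V,q)$ be a finitely generated projective $R$-module of constant even rank $n=2m$ with a nondegenerate quadratic form. Let $f$ be the symmetric bilinear form with $f(v,v)=q(v)$, and suppose that $(V,q)$ is oriented: an isometry is given between $(R,\,x\mapsto x^2)$ and $\lambda^n(V)$ with the form $\langle v_1\wedge\dots\wedge v_n,\,w_1\wedge\dots\wedge w_n\rangle=(-1)^m\det\big(f(v_i,w_j)\big)$. For a multiple $Q$ of $q$ by a positive integer invertible in $R$, let $K(C(V,Q))$ be the graded Grothendieck group of the Clifford algebra, i.e. the cokernel of the restriction map $K(C(V,Q)\,\widehat\otimes\,C^{0,2})\to K(C(V,Q)\,\widehat\otimes\,C^{0,1})$, where $C^{0,r}$ is the Clifford algebra of $R^r$ with the form $\sum x_i^2$. Its elements are classes of finitely generated projective $\mathbf Z/2$-graded $C(V,Q)$-modules. Put $\Lambda_j=C(V,jq)$. The cup-product $K(C(V,Q_1))\times K(C(V,Q_2))\to K(C(V,Q_1+Q_2))$ is given by the graded tensor product, $[M]\cdot[N]=[M\,\widehat\otimes\,N]$, on which $v\in V$ acts by $m\otimes n\mapsto vm\otimes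 n+(-1)^{\deg m}m\otimes vn$. The operation $\lambda^i:K(C(V,Q))\to K(C(V,iQ))$ is given by $\lambda^i[M]=[\lambda^i(M)]$, where $\lambda^i(M)$ is the graded exterior power, i.e. the quotient of $M^{\widehat\otimes i}$ by the relations $t=\varepsilon(\sigma)\,t^{\sigma}$ for $\sigma\in S_i$, with $\varepsilon(\sigma)$ the signature and $S_i$ permuting the factors with the usual signs for graded objects. Finally $\Psi^k(x)=Q_k(\lambda^1(x),\dots,\lambda^k(x))$, where $Q_k$ is the Newton polynomial, which expresses the $k$-th power sum through the elementary symmetric functions. Let $k\ge 1$ and assume that $k!$ is invertible in $R$. Then these operations are well defined: (a) if $i,j\ge1$ and $i$, $j$, $i+j$ are invertible in $R$, then for finitely generated projective graded modules $M$ over $\Lambda_i$ and $N$ over $\Lambda_j$ the module $M\,\widehat\otimes\,N$ is finitely generated projective and its class in $K(\Lambda_{i+j})$ depends only on $[M]$ and $[N]$; (b) if $1\le i\le k$, $j\ge1$ and $j$ is invertible in $R$, then for a finitely generated projective graded module $M$ over $\Lambda_j$ the module $\lambda^i(M)$ is finitely generated projective and its class in $K(\Lambda_{ij})$ depends only on $[M]$.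 Moreover, for all $x,y\in K(\Lambda_1)$, $$\Psi^k(x\cdot y)=\Psi^k(x)\cdot\Psi^k(y)\qquad\text{in } K(\Lambda_{2k}).$$ -/

import Mathlib

universe u

open scoped TensorProduct

noncomputable section

/-! ### Modules over an algebra and the Grothendieck group of a ring -/

/-- A (left) module over the `R`-algebra `A`, bundled, with its underlying `R`-module. -/
structure AlgMod (R A : Type u) [CommRing R] [Ring A] [Algebra R A] : Type (u + 1) where
  carrier : Type u
  [addCommGroup : AddCommGroup carrier]
  [moduleBase : Module R carrier]
  [module : Module A carrier]
  [tower : IsScalarTower R A carrier]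

namespace AlgMod

attribute [instance] AlgMod.addCommGroup AlgMod.moduleBase AlgMod.module AlgMod.tower

variable {R A : Type u} [CommRing R] [Ring A] [Algebra R A]

/-- Finitely generated and projective over `A`. -/
def IsFGP (M : AlgMod R A) : Prop :=
  Module.Finite A M.carrier ∧ Module.Projective A M.carrier

/-- Direct sum of two modules. -/
def prod (M N : AlgMod R A) : AlgMod R A where
  carrier := M.carrier × N.carrier

/-- The zero module. -/
def zero : AlgMod R A where
  carrier := PUnit.{u + 1}

/-- The module on an `R`-module `M` given by a representation `A → End_R M`. -/
def ofRep (M : Type u) [AddCommGroup M] [Module R M] (ρ : A →ₐ[R] Module.End R M) :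
    AlgMod R A :=
  letI : Module A M := Module.compHom M ρ.toRingHom
  haveI : IsScalarTower R A M := ⟨fun r a m => by
    change ρ (r • a) m = r • ρ a m
    rw [map_smul, LinearMap.smul_apply]⟩
  { carrier := M }

/-- Quotient of a module by an `A`-submodule. -/
def quotient (M : AlgMod R A) (p : Submodule A M.carrier) : AlgMod R A where
  carrier := M.carrier ⧸ p

/-- The operator of an element of `A` on a module. -/
def op (M : AlgMod R A) : A →ₐ[R] Module.End R M.carrier := Algebra.lsmul R R M.carrier

end AlgMod

/-- Finitely generated projective `A`-modules. -/
def FGPMod (R A : Type u) [CommRing R] [Ring A] [Algebra R A] : Type (u + 1) :=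
  {M : AlgMod R A // M.IsFGP}

namespace FGPMod

variable {R A : Type u} [CommRing R] [Ring A] [Algebra R A]

/-- Isomorphism of finitely generated projective modules. -/
instance setoid (R A : Type u) [CommRing R] [Ring A] [Algebra R A] : Setoid (FGPMod R A) where
  r M N := Nonempty (M.1.carrier ≃ₗ[A] N.1.carrier)
  iseqv := ⟨fun _ => ⟨LinearEquiv.refl _ _⟩, fun ⟨e⟩ => ⟨e.symm⟩, fun ⟨e⟩ ⟨f⟩ => ⟨e.trans f⟩⟩

/-- Direct sum. -/
def prod (M N : FGPMod R A) : FGPMod R A :=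
  ⟨M.1.prod N.1, by
    obtain ⟨hM, hM'⟩ := M.2
    obtain ⟨hN, hN'⟩ := N.2
    exact ⟨inferInstanceAs (Module.Finite A (M.1.carrier × N.1.carrier)),
      inferInstanceAs (Module.Projective A (M.1.carrier × N.1.carrier))⟩⟩

/-- The zero module. -/
def zero : FGPMod R A :=
  ⟨AlgMod.zero, inferInstanceAs (Module.Finite A PUnit.{u + 1}),
    inferInstanceAs (Module.Projective A PUnit.{u + 1})⟩

/-- Isomorphism classes of finitely generated projective modules. -/
def IsoClass (R A : Type u) [CommRing R] [Ring A] [Algebra R A] : Type (u + 1) :=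
  Quotient (FGPMod.setoid R A)

/-- The isomorphism class of a finitely generated projective module. -/
def isoClass (M : FGPMod R A) : IsoClass R A := Quotient.mk _ M

instance : Add (IsoClass R A) :=
  ⟨Quotient.map₂ prod fun _ _ ⟨e⟩ _ _ ⟨f⟩ => ⟨LinearEquiv.prodCongr e f⟩⟩

instance : Zero (IsoClass R A) := ⟨isoClass zero⟩

instance : AddCommMonoid (IsoClass R A) where
  add_assoc := by
    rintro ⟨a⟩ ⟨b⟩ ⟨c⟩
    exact Quotient.sound ⟨LinearEquiv.prodAssoc A a.1.carrier b.1.carrier c.1.carrier⟩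
  zero_add := by
    rintro ⟨a⟩
    exact Quotient.sound ⟨LinearEquiv.uniqueProd (R := A) (M := a.1.carrier) (M₂ := PUnit.{u + 1})⟩
  add_zero := by
    rintro ⟨a⟩
    exact Quotient.sound ⟨LinearEquiv.prodUnique (R := A) (M := a.1.carrier) (M₂ := PUnit.{u + 1})⟩
  add_comm := by
    rintro ⟨a⟩ ⟨b⟩
    exact Quotient.sound ⟨LinearEquiv.prodComm A a.1.carrier b.1.carrier⟩
  nsmul := nsmulRec

end FGPMod

/-- The Grothendieck group `K(A)` of finitely generated projective `A`-modules. -/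
abbrev KGroup (R A : Type u) [CommRing R] [Ring A] [Algebra R A] : Type (u + 1) :=
  Algebra.GrothendieckAddGroup (FGPMod.IsoClass R A)

/-- The class of a finitely generated projective module in `K(A)`. -/
def KGroup.mk {R A : Type u} [CommRing R] [Ring A] [Algebra R A] (M : FGPMod R A) :
    KGroup R A :=
  Algebra.GrothendieckAddGroup.of M.isoClass

/-! ### Clifford algebras and graded Clifford modules -/

section Clifford

variable {R V : Type u} [CommRing R] [AddCommGroup V] [Module R V]

/-- The standard form `∑ xᵢ²` on `R^r`. -/
def stdForm (R : Type u) [CommRing R] (r : ℕ) : QuadraticForm R (Fin r → R) :=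
  QuadraticMap.pi fun _ => QuadraticMap.sq

/-- The graded tensor product `C(V, Q) ⊗̂ C^{0,r}` where `C^{0,r}` is the Clifford algebra of
`R^r` with the form `∑ xᵢ²`, realised as the Clifford algebra of the orthogonal sum
`(V, Q) ⊕ (R^r, ∑ xᵢ²)`; the identification is Mathlib's `CliffordAlgebra.prodEquiv`. -/
abbrev ClTensor (Q : QuadraticForm R V) (r : ℕ) : Type u :=
  CliffordAlgebra (Q.prod (stdForm R r))

/-- The isometric inclusion of `(V, Q) ⊕ R` in `(V, Q) ⊕ R²`. -/
def inclIsometry (Q : QuadraticForm R V) :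
    (Q.prod (stdForm R 1)) →qᵢ (Q.prod (stdForm R 2)) where
  toLinearMap := LinearMap.prodMap LinearMap.id
    (LinearMap.pi ![LinearMap.proj 0, 0])
  map_app' := by
    rintro ⟨v, t⟩
    simp [stdForm, Fin.sum_univ_two, QuadraticMap.pi_apply]

lemma inclIsometry_apply (Q : QuadraticForm R V) (w : V × (Fin 1 → R)) :
    inclIsometry Q w = (w.1, ![w.2 0, 0]) := by
  refine Prod.ext rfl (funext fun i => ?_)
  fin_cases i <;> rfl

/-- The homomorphism `C(V, Q) ⊗̂ C^{0,1} → C(V, Q) ⊗̂ C^{0,2}`. -/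
def clIncl (Q : QuadraticForm R V) : ClTensor Q 1 →ₐ[R] ClTensor Q 2 :=
  CliffordAlgebra.map (inclIsometry Q)

/-- Modules over `C(V, Q) ⊗̂ C^{0,1}`. As `2` is invertible, these are the same as `ℤ/2`-graded
`C(V, Q)`-modules: the generator of `C^{0,1}` acts as the grading involution. -/
abbrev GrMod (Q : QuadraticForm R V) : Type (u + 1) := AlgMod R (ClTensor Q 1)

/-- The subgroup of `K(C(V, Q) ⊗̂ C^{0,1})` generated by the classes of the modules which are
restrictions of finitely generated projective modules over `C(V, Q) ⊗̂ C^{0,2}`. -/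
def restrictionImage (Q : QuadraticForm R V) : AddSubgroup (KGroup R (ClTensor Q 1)) :=
  AddSubgroup.closure {x | ∃ (N : FGPMod R (ClTensor Q 1)) (M : FGPMod R (ClTensor Q 2))
    (e : N.1.carrier ≃+ M.1.carrier), (∀ a n, e (a • n) = clIncl Q a • e n) ∧ x = KGroup.mk N}

/-- The graded Grothendieck group of the Clifford algebra `C(V, Q)`: the cokernel of the
restriction map `K(C(V, Q) ⊗̂ C^{0,2}) → K(C(V, Q) ⊗̂ C^{0,1})`. -/
abbrev GrK (Q : QuadraticForm R V) : Type (u + 1) :=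
  KGroup R (ClTensor Q 1) ⧸ restrictionImage Q

namespace GrMod

/-- The action of `v ∈ V` on a graded Clifford module. -/
def vec {Q : QuadraticForm R V} (M : GrMod Q) : V →ₗ[R] Module.End R M.carrier :=
  M.op.toLinearMap ∘ₗ CliffordAlgebra.ι _ ∘ₗ LinearMap.inl R V (Fin 1 → R)

/-- The grading involution of a graded Clifford module: `1` in degree `0`, `-1` in degree `1`. -/
def eps {Q : QuadraticForm R V} (M : GrMod Q) : Module.End R M.carrier :=
  M.op (CliffordAlgebra.ι _ ((0 : V), fun _ => (1 : R)))

lemma vec_mul_vec {Q : QuadraticForm R V} (M : GrMod Q) (v : V) :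
    M.vec v * M.vec v = Q v • 1 := by
  simp only [vec, LinearMap.comp_apply, AlgHom.toLinearMap_apply, ← map_mul,
    CliffordAlgebra.ι_sq_scalar, AlgHom.commutes]
  simp [stdForm, Algebra.algebraMap_eq_smul_one]

lemma eps_mul_eps {Q : QuadraticForm R V} (M : GrMod Q) : M.eps * M.eps = 1 := by
  simp only [eps, ← map_mul, CliffordAlgebra.ι_sq_scalar, AlgHom.commutes]
  simp [stdForm, QuadraticMap.pi_apply]

lemma vec_mul_eps {Q : QuadraticForm R V} (M : GrMod Q) (v : V) :
    M.vec v * M.eps = -(M.eps * M.vec v) := by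
  have h := CliffordAlgebra.ι_mul_ι_add_swap (Q := Q.prod (stdForm R 1))
    ((v, 0) : V × (Fin 1 → R)) ((0 : V), fun _ => (1 : R))
  have h0 : QuadraticMap.polar (Q.prod (stdForm R 1)) ((v, 0) : V × (Fin 1 → R))
      ((0 : V), fun _ => (1 : R)) = 0 := by
    simp [QuadraticMap.polar, stdForm, QuadraticMap.pi_apply]
  rw [h0, map_zero] at h
  have h2 := congrArg M.op h
  rw [map_add, map_mul, map_mul, map_zero] at h2
  exact eq_neg_of_add_eq_zero_left h2

/-- The graded Clifford module given by operators `c v` (for `v ∈ V`) and a grading involution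
`e`, with `(c v)² = Q v`, `e² = 1` and `c v` of odd degree. -/
def ofOps (Q : QuadraticForm R V) (M : Type u) [AddCommGroup M] [Module R M]
    (c : V →ₗ[R] Module.End R M) (e : Module.End R M) (hc : ∀ v, c v * c v = Q v • 1)
    (he : e * e = 1) (hce : ∀ v, c v * e = -(e * c v)) : GrMod Q :=
  AlgMod.ofRep M (CliffordAlgebra.lift _
    ⟨c.coprod ((LinearMap.toSpanSingleton R _ e) ∘ₗ LinearMap.proj 0), by
      rintro ⟨v, t⟩
      simp [stdForm, QuadraticMap.pi_apply, add_mul, mul_add, hc, he, hce,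
        Algebra.algebraMap_eq_smul_one, add_smul, smul_smul]⟩)

/-- The graded tensor product `M ⊗̂ N` of graded Clifford modules over `(V, Q₁)` and `(V, Q₂)`,
as a graded Clifford module over `(V, Q₁ + Q₂)` through the diagonal `V → V × V`: the vector `v`
acts by `m ⊗ n ↦ v m ⊗ n + (-1)^{deg m} m ⊗ v n`. -/
def tensor {Q₁ Q₂ Q₃ : QuadraticForm R V} (h : Q₁ + Q₂ = Q₃) (M : GrMod Q₁) (N : GrMod Q₂) :
    GrMod Q₃ :=
  ofOps Q₃ (M.carrier ⊗[R] N.carrier)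
    ((TensorProduct.mapBilinear (RingHom.id R) M.carrier N.carrier M.carrier N.carrier).flip 1
        ∘ₗ M.vec +
      TensorProduct.mapBilinear (RingHom.id R) M.carrier N.carrier M.carrier N.carrier M.eps
        ∘ₗ N.vec)
    (TensorProduct.map M.eps N.eps)
    (fun v => by
      simp only [LinearMap.add_apply, LinearMap.comp_apply, LinearMap.flip_apply,
        TensorProduct.mapBilinear_apply, add_mul, mul_add, ← TensorProduct.map_mul, vec_mul_vec,
        eps_mul_eps, vec_mul_eps, one_mul, mul_one, ← h, add_apply]
      ext m n
      simp [add_smul, TensorProduct.neg_tmul, TensorProduct.smul_tmul'])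
    (by rw [← TensorProduct.map_mul, eps_mul_eps, eps_mul_eps, TensorProduct.map_one])
    (fun v => by
      simp only [LinearMap.add_apply, LinearMap.comp_apply, LinearMap.flip_apply,
        TensorProduct.mapBilinear_apply, add_mul, mul_add, ← TensorProduct.map_mul,
        vec_mul_eps, eps_mul_eps, one_mul, mul_one]
      ext m n
      simp [TensorProduct.neg_tmul, TensorProduct.tmul_neg, add_comm])

section Power

variable {Q : QuadraticForm R V} (M : GrMod Q) (k : ℕ)

/-- The vector `v` acting on the `j`-th factor of `M^{⊗̂k}`, with the sign of the degrees of the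
factors before it: `ε ⊗ ⋯ ⊗ ε ⊗ v ⊗ 1 ⊗ ⋯ ⊗ 1`. -/
def vecAt (j : Fin k) : V →ₗ[R] Module.End R (⨂[R] _ : Fin k, M.carrier) :=
  (PiTensorProduct.mapMultilinear R (fun _ : Fin k => M.carrier)
    (fun _ : Fin k => M.carrier)).toLinearMap (fun l => if l < j then M.eps else 1) j ∘ₗ M.vec

/-- The grading involution of `M^{⊗̂k}`. -/
def epsPow : Module.End R (⨂[R] _ : Fin k, M.carrier) :=
  PiTensorProduct.map fun _ => M.eps

lemma vecAt_apply (j : Fin k) (v : V) :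
    M.vecAt k j v = PiTensorProduct.map
      (Function.update (fun l => if l < j then M.eps else 1) j (M.vec v)) := rfl

lemma map_eq_neg_map {ι : Type} [Fintype ι] [DecidableEq ι] {W : Type u} [AddCommGroup W]
    [Module R W] (f g : ι → Module.End R W) (j : ι) (hj : f j = -g j)
    (h : ∀ l, l ≠ j → f l = g l) :
    (PiTensorProduct.map f : Module.End R (⨂[R] _ : ι, W)) = -PiTensorProduct.map g := by
  have hf : f = Function.update g j ((-1 : R) • g j) := by
    funext l
    by_cases hl : l = j
    · subst hl; simp [hj]
    · simp [hl, h l hl]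
  rw [hf, PiTensorProduct.map_update_smul, Function.update_eq_self]
  exact neg_one_smul R (PiTensorProduct.map g : Module.End R (⨂[R] _ : ι, W))

lemma vecAt_sq (j : Fin k) (v : V) : M.vecAt k j v * M.vecAt k j v = Q v • 1 := by
  rw [vecAt_apply, ← PiTensorProduct.map_mul]
  have : (fun l => Function.update (fun l => if l < j then M.eps else 1) j (M.vec v) l *
      Function.update (fun l => if l < j then M.eps else 1) j (M.vec v) l) =
      Function.update (fun _ => (1 : Module.End R M.carrier)) j (Q v • 1) := by
    funext l
    by_cases hl : l = j
    · subst hl; simp [vec_mul_vec]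
    · by_cases hl' : l < j <;> simp [hl, hl', eps_mul_eps]
  rw [this, PiTensorProduct.map_update_smul, Function.update_eq_self_iff.2 rfl,
    PiTensorProduct.map_one]

lemma vecAt_anticomm {i j : Fin k} (hij : i < j) (v : V) :
    M.vecAt k i v * M.vecAt k j v = -(M.vecAt k j v * M.vecAt k i v) := by
  rw [vecAt_apply, vecAt_apply, ← PiTensorProduct.map_mul, ← PiTensorProduct.map_mul]
  refine map_eq_neg_map _ _ i ?_ fun l hl => ?_
  · simp [hij, hij.ne, vec_mul_eps]
  · by_cases hlj : l = j
    · subst hlj; simp [hl, not_lt.2 hij.le]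
    · by_cases h1 : l < i <;> by_cases h2 : l < j <;> simp [hl, hlj, h1, h2]

lemma vecAt_mul_epsPow (j : Fin k) (v : V) :
    M.vecAt k j v * M.epsPow k = -(M.epsPow k * M.vecAt k j v) := by
  rw [vecAt_apply, epsPow, ← PiTensorProduct.map_mul, ← PiTensorProduct.map_mul]
  refine map_eq_neg_map _ _ j ?_ fun l hl => ?_
  · simp [vec_mul_eps]
  · by_cases h1 : l < j <;> simp [hl, h1]

/-- The graded tensor power `M^{⊗̂k}`, a graded Clifford module over `(V, k Q)` through the
diagonal `V → V^k`. -/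
def tpow : GrMod (k • Q) :=
  ofOps (k • Q) (⨂[R] _ : Fin k, M.carrier) (∑ j, M.vecAt k j) (M.epsPow k)
    (fun v => by
      have key : ∀ s : Finset (Fin k), (∑ j ∈ s, M.vecAt k j v) * (∑ j ∈ s, M.vecAt k j v) =
          s.card • (Q v • (1 : Module.End R (⨂[R] _ : Fin k, M.carrier))) := by
        intro s
        induction s using Finset.induction_on with
        | empty => simp
        | insert a s ha ih =>
          have hx : M.vecAt k a v * (∑ j ∈ s, M.vecAt k j v) =
              -((∑ j ∈ s, M.vecAt k j v) * M.vecAt k a v) := by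
            rw [Finset.mul_sum, Finset.sum_mul, ← Finset.sum_neg_distrib]
            refine Finset.sum_congr rfl fun j hj => ?_
            rcases lt_trichotomy a j with h | h | h
            · exact M.vecAt_anticomm k h v
            · exact absurd (h ▸ hj) ha
            · rw [M.vecAt_anticomm k h v, neg_neg]
          rw [Finset.sum_insert ha, Finset.card_insert_of_notMem ha, add_mul, mul_add, mul_add,
            hx, ih, vecAt_sq, add_smul, one_smul]
          abel
      rw [LinearMap.sum_apply, key]
      simp [← smul_assoc])
    (by
      rw [epsPow, ← PiTensorProduct.map_mul]
      simp only [eps_mul_eps]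
      exact PiTensorProduct.map_one)
    (fun v => by
      rw [LinearMap.sum_apply, Finset.sum_mul, Finset.mul_sum, ← Finset.sum_neg_distrib]
      exact Finset.sum_congr rfl fun j _ => M.vecAt_mul_epsPow k j v)

variable [Invertible (2 : R)]

/-- The projection of a graded module onto its part of degree `0` or `1`. -/
def proj (d : ZMod 2) : Module.End R M.carrier :=
  if d = 0 then (⅟2 : R) • (1 + M.eps) else (⅟2 : R) • (1 - M.eps)

/-- The Koszul sign of a permutation of homogeneous elements of degrees `d`: one sign for each
pair of elements of odd degree which is put in the opposite order. -/
def koszulSign {k : ℕ} (σ : Equiv.Perm (Fin k)) (d : Fin k → ZMod 2) : ℤ :=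
  ∏ i : Fin k, ∏ j : Fin k, if i < j ∧ σ j < σ i ∧ d i = 1 ∧ d j = 1 then -1 else 1

/-- The action of a permutation on `M^{⊗̂k}`: on homogeneous elements it permutes the factors, the
factor in position `i` going to position `σ i`, and multiplies by the Koszul sign. -/
def permAct (σ : Equiv.Perm (Fin k)) : Module.End R (⨂[R] _ : Fin k, M.carrier) :=
  ∑ d : Fin k → ZMod 2, koszulSign σ d •
    ((PiTensorProduct.reindex R (fun _ : Fin k => M.carrier) σ).toLinearMap ∘ₗ
      PiTensorProduct.map fun i => M.proj (d i))

/-- The graded exterior power `λ^k(M)`: the quotient of `M^{⊗̂k}` by the relations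
`m - sign(σ) m^σ`. -/
def extPow : GrMod (k • Q) :=
  (M.tpow k).quotient (Submodule.span (ClTensor (k • Q) 1)
    {x : (M.tpow k).carrier | ∃ (m : ⨂[R] _ : Fin k, M.carrier) (σ : Equiv.Perm (Fin k)),
      x = m - (Equiv.Perm.sign σ : ℤ) • M.permAct k σ m})

end Power

/-! Every class in the graded Grothendieck group is the class of a graded module: the class of
`N` with the opposite grading is the opposite of the class of `N`. -/

/-- `N` with the opposite grading and the opposite action of `V`. -/
def opp {Q : QuadraticForm R V} (N : GrMod Q) : GrMod Q :=
  AlgMod.ofRep N.carrier (N.op.comp CliffordAlgebra.involute)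

lemma opp_isFGP {Q : QuadraticForm R V} {N : GrMod Q} (hN : N.IsFGP) : N.opp.IsFGP := by
  obtain ⟨h1, h2⟩ := hN
  let σ : ClTensor Q 1 ≃+* ClTensor Q 1 := CliffordAlgebra.involuteEquiv.toRingEquiv
  have : RingHomInvPair (σ : ClTensor Q 1 →+* ClTensor Q 1) (σ.symm : ClTensor Q 1 →+* _) :=
    RingHomInvPair.of_ringEquiv σ
  have : RingHomInvPair (σ.symm : ClTensor Q 1 →+* ClTensor Q 1) (σ : ClTensor Q 1 →+* _) :=
    RingHomInvPair.of_ringEquiv σ.symm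
  let e : N.carrier ≃ₛₗ[(σ : ClTensor Q 1 →+* ClTensor Q 1)] N.opp.carrier :=
    { toFun := fun n => (n : N.carrier)
      invFun := fun n => (n : N.carrier)
      map_add' := fun _ _ => rfl
      left_inv := fun _ => rfl
      right_inv := fun _ => rfl
      map_smul' := fun a n => by
        change a • n = CliffordAlgebra.involute (CliffordAlgebra.involute a) • n
        rw [CliffordAlgebra.involute_involute] }
  exact ⟨Module.Finite.of_surjective e.toLinearMap e.surjective,
    Module.Projective.of_equiv e⟩

/-- The operators `(n, n') ↦ (w n + t n', t n - w n')` on `N × N`. -/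
def dblOps {Q : QuadraticForm R V} (N : GrMod Q) :
    V × (Fin 2 → R) →ₗ[R] Module.End R (N.carrier × N.carrier) where
  toFun w :=
    let x : Module.End R N.carrier := N.op (CliffordAlgebra.ι _ (w.1, fun _ => w.2 0))
    (x ∘ₗ LinearMap.fst R _ _ + w.2 1 • LinearMap.snd R _ _).prod
      (w.2 1 • LinearMap.fst R _ _ - x ∘ₗ LinearMap.snd R _ _)
  map_add' w w' := by
    have : ((w + w').1, fun _ : Fin 1 => (w + w').2 0) =
        (w.1, fun _ : Fin 1 => w.2 0) + (w'.1, fun _ : Fin 1 => w'.2 0) := rfl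
    ext n <;> simp only [this, map_add] <;> simp [add_smul] <;> abel
  map_smul' r w := by
    have : ((r • w).1, fun _ : Fin 1 => (r • w).2 0) = r • (w.1, fun _ : Fin 1 => w.2 0) := rfl
    ext n <;> simp only [this, map_smul] <;> simp [mul_smul]

/-- `N ⊕ N.opp` as a module over `C(V, Q) ⊗̂ C^{0,2}`. -/
def dbl {Q : QuadraticForm R V} (N : GrMod Q) : AlgMod R (ClTensor Q 2) :=
  AlgMod.ofRep (N.carrier × N.carrier) (CliffordAlgebra.lift _ ⟨N.dblOps, by
    intro w
    have h := congrArg N.op (CliffordAlgebra.ι_sq_scalar (Q.prod (stdForm R 1))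
      (w.1, fun _ => w.2 0))
    rw [map_mul, AlgHom.commutes] at h
    have h' : ∀ n, N.op (CliffordAlgebra.ι _ (w.1, fun _ => w.2 0))
        (N.op (CliffordAlgebra.ι _ (w.1, fun _ => w.2 0)) n) =
        Q w.1 • n + (w.2 0 * w.2 0) • n := fun n => by
      have := LinearMap.congr_fun h n
      simpa [stdForm, QuadraticMap.pi_apply, add_smul, mul_smul] using this
    refine LinearMap.ext fun n => ?_
    simp only [dblOps, LinearMap.coe_mk, AddHom.coe_mk, Module.End.mul_apply, LinearMap.prod_apply,
      Function.prod_apply, LinearMap.add_apply, LinearMap.sub_apply, LinearMap.comp_apply, LinearMap.smul_apply,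
      LinearMap.fst_apply, LinearMap.snd_apply, map_add, map_sub, map_smul, h',
      Module.algebraMap_end_apply]
    ext <;> simp [stdForm, QuadraticMap.pi_apply, Fin.sum_univ_two, add_smul, smul_add, smul_sub,
      smul_smul] <;> abel⟩)

lemma dbl_smul {Q : QuadraticForm R V} (N : GrMod Q) (w : V × (Fin 2 → R))
    (n : N.carrier × N.carrier) :
    (CliffordAlgebra.ι (Q.prod (stdForm R 2)) w • (show N.dbl.carrier from n) : N.dbl.carrier) =
      N.dblOps w n := by
  exact LinearMap.congr_fun (CliffordAlgebra.lift_ι_apply (Q := Q.prod (stdForm R 2))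
    N.dblOps _ w) n

lemma dbl_restrict {Q : QuadraticForm R V} (N : GrMod Q) (a : ClTensor Q 1)
    (n : N.carrier × N.carrier) :
    (clIncl Q a • (show N.dbl.carrier from n) : N.dbl.carrier) =
      ((a • n.1, CliffordAlgebra.involute a • n.2) : N.carrier × N.carrier) := by
  induction a using CliffordAlgebra.induction generalizing n with
  | algebraMap r =>
    rw [AlgHom.commutes, AlgHom.commutes, algebraMap_smul, algebraMap_smul, algebraMap_smul]
    rfl
  | ι w =>
    rw [clIncl, CliffordAlgebra.map_apply_ι, dbl_smul, CliffordAlgebra.involute_ι]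
    have : ((w.1, fun _ => w.2 0) : V × (Fin 1 → R)) = w := by
      refine Prod.ext rfl (funext fun i => ?_)
      rw [Subsingleton.elim i 0]
    rw [inclIsometry_apply]
    simp [dblOps, AlgMod.op, this]
    rfl
  | mul a b ha hb =>
    rw [map_mul, map_mul, mul_smul, mul_smul, mul_smul]
    refine (congrArg _ (hb n)).trans (ha _)
  | add a b ha hb =>
    rw [map_add, map_add, add_smul, add_smul, add_smul]
    refine (congrArg₂ _ (ha n) (hb n)).trans rfl


lemma clIncl_mul_ι {Q : QuadraticForm R V} (a : ClTensor Q 1) :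
    clIncl Q a * CliffordAlgebra.ι (Q.prod (stdForm R 2)) ((0 : V), ![(0 : R), 1]) =
      CliffordAlgebra.ι (Q.prod (stdForm R 2)) ((0 : V), ![(0 : R), 1]) *
        clIncl Q (CliffordAlgebra.involute a) := by
  induction a using CliffordAlgebra.induction with
  | algebraMap r => rw [AlgHom.commutes, AlgHom.commutes, AlgHom.commutes, Algebra.commutes]
  | ι w =>
    rw [CliffordAlgebra.involute_ι, map_neg, mul_neg, clIncl, CliffordAlgebra.map_apply_ι,
      eq_neg_iff_add_eq_zero, CliffordAlgebra.ι_mul_ι_add_swap]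
    have : QuadraticMap.polar (Q.prod (stdForm R 2)) (inclIsometry Q w) (0, ![0, 1]) = 0 := by
      rw [inclIsometry_apply]
      simp [QuadraticMap.polar, stdForm, QuadraticMap.pi_apply, Fin.sum_univ_two]
    rw [this, map_zero]
  | mul a b ha hb => rw [map_mul, map_mul, map_mul, mul_assoc, hb, ← mul_assoc, ha, mul_assoc]
  | add a b ha hb => rw [map_add, map_add, map_add, add_mul, ha, hb, mul_add]

lemma dbl_isFGP {Q : QuadraticForm R V} {N : GrMod Q} (hN : N.IsFGP) : N.dbl.IsFGP := by
  obtain ⟨h1, h2⟩ := hN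
  have hl : ∀ (a : ClTensor Q 1) (n : N.carrier),
      (clIncl Q a • (show N.dbl.carrier from ((n, 0) : N.carrier × N.carrier)) : N.dbl.carrier) =
        ((a • n, 0) : N.carrier × N.carrier) := fun a n => by
    rw [dbl_restrict]; simp; rfl
  let f₂ : ClTensor Q 2 := CliffordAlgebra.ι _ ((0 : V), ![(0 : R), 1])
  have hf₂ : ∀ n : N.carrier × N.carrier,
      (f₂ • (show N.dbl.carrier from n) : N.dbl.carrier) = ((n.2, n.1) : N.carrier × N.carrier) := by
    intro n
    rw [dbl_smul]
    have : ((0, fun _ => 0) : V × (Fin 1 → R)) = 0 := rfl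
    simp [dblOps, AlgMod.op, this]
    rfl
  let inl : N.carrier →+ N.dbl.carrier := AddMonoidHom.inl N.carrier N.carrier
  have hinl : ∀ (a : ClTensor Q 1) (n : N.carrier), inl (a • n) = clIncl Q a • inl n :=
    fun a n => (hl a n).symm
  have hdec : ∀ n : N.carrier × N.carrier,
      (show N.dbl.carrier from n) = inl n.1 + f₂ • inl n.2 := by
    intro n
    have : f₂ • inl n.2 = ((0, n.2) : N.carrier × N.carrier) := hf₂ (n.2, 0)
    rw [this]
    exact Prod.ext (add_zero n.1).symm (zero_add n.2).symm
  constructor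
  · obtain ⟨s, hs⟩ := h1
    classical
    refine ⟨⟨s.image inl, ?_⟩⟩
    have hmem : ∀ n, inl n ∈ Submodule.span (ClTensor Q 2)
        ((s.image inl : Finset N.dbl.carrier) : Set N.dbl.carrier) := by
      intro n
      have hn : n ∈ Submodule.span (ClTensor Q 1) (s : Set N.carrier) := hs ▸ Submodule.mem_top
      induction hn using Submodule.span_induction with
      | mem x hx => exact Submodule.subset_span (Finset.mem_image_of_mem _ hx)
      | zero => rw [map_zero]; exact zero_mem _
      | add x y _ _ hx hy => rw [map_add]; exact add_mem hx hy
      | smul a x _ hx => rw [hinl]; exact Submodule.smul_mem _ _ hx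
    refine eq_top_iff.2 fun n _ => ?_
    rw [hdec n]
    exact add_mem (hmem _) (Submodule.smul_mem _ _ (hmem _))
  · refine Module.Projective.of_lifting_property' fun {X Y} _ _ _ _ f g hf => ?_
    let _ : Module (ClTensor Q 1) X := Module.compHom X (clIncl Q).toRingHom
    let _ : Module (ClTensor Q 1) Y := Module.compHom Y (clIncl Q).toRingHom
    let f' : X →ₗ[ClTensor Q 1] Y :=
      { toFun := f, map_add' := map_add f, map_smul' := fun a x => map_smul f (clIncl Q a) x }
    let g' : N.carrier →ₗ[ClTensor Q 1] Y :=
      { toFun := fun n => g (inl n)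
        map_add' := fun x y => by rw [map_add, map_add]
        map_smul' := fun a x => by
          rw [hinl]; exact map_smul g (clIncl Q a) (inl x) }
    obtain ⟨p, hp⟩ := Module.projective_lifting_property f' g' hf
    have hp' : ∀ n, f (p n) = g (inl n) := fun n => LinearMap.congr_fun hp n
    have hps : ∀ (a : ClTensor Q 1) n, p (a • n) = clIncl Q a • p n := fun a n => map_smul p a n
    have hf₂f₂ : f₂ * f₂ = 1 := by
      have : (Q.prod (stdForm R 2)) (0, ![0, 1]) = 1 := by
        simp [stdForm, QuadraticMap.pi_apply, Fin.sum_univ_two]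
      rw [CliffordAlgebra.ι_sq_scalar, this, map_one]
    let H : N.dbl.carrier →+ X :=
      { toFun := fun n : N.carrier × N.carrier => p n.1 + f₂ • p n.2
        map_zero' := by
          change p 0 + f₂ • p 0 = 0
          rw [map_zero, smul_zero, add_zero]
        map_add' := fun x y => by
          change p (x.1 + y.1) + f₂ • p (x.2 + y.2) = _
          rw [map_add, map_add, smul_add]; exact add_add_add_comm _ _ _ _ }
    have hH : ∀ n n' : N.carrier, H ((n, n') : N.carrier × N.carrier) = p n + f₂ • p n' :=
      fun _ _ => rfl
    have h1 : ∀ (a : ClTensor Q 1) (n : N.dbl.carrier), H (clIncl Q a • n) = clIncl Q a • H n := by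
      rintro a ⟨n, n'⟩
      refine (congrArg H (dbl_restrict N a (n, n'))).trans ?_
      rw [hH, hH, hps, hps, smul_add, ← mul_smul, ← mul_smul, clIncl_mul_ι]
    have h2 : ∀ n : N.dbl.carrier, H (f₂ • n) = f₂ • H n := by
      rintro ⟨n, n'⟩
      refine (congrArg H (hf₂ (n, n'))).trans ?_
      rw [hH, hH, smul_add, ← mul_smul, hf₂f₂, one_smul, add_comm]
    have hlin : ∀ (a : ClTensor Q 2) (n : N.dbl.carrier), H (a • n) = a • H n := by
      intro a
      induction a using CliffordAlgebra.induction with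
      | algebraMap r => rw [← AlgHom.commutes (clIncl Q)]; exact h1 _
      | ι w =>
        have : CliffordAlgebra.ι (Q.prod (stdForm R 2)) w =
            clIncl Q (CliffordAlgebra.ι _ (w.1, fun _ => w.2 0)) +
              clIncl Q (algebraMap R _ (w.2 1)) * f₂ := by
          rw [AlgHom.commutes, ← Algebra.smul_def, clIncl, CliffordAlgebra.map_apply_ι,
            ← map_smul, ← map_add, inclIsometry_apply]
          congr 1
          refine Prod.ext (by simp) (funext fun i => ?_)
          fin_cases i <;> simp
        intro n
        rw [this, add_smul, add_smul, map_add, h1, mul_smul, mul_smul, h1, h2]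
      | mul a b ha hb => intro n; rw [mul_smul, mul_smul, ha, hb]
      | add a b ha hb => intro n; rw [add_smul, add_smul, map_add, ha, hb]
    refine ⟨{ toFun := H, map_add' := map_add H, map_smul' := hlin }, LinearMap.ext fun n => ?_⟩
    change f (p n.1 + f₂ • p n.2) = g n
    rw [map_add, map_smul, hp', hp', ← map_smul, ← map_add]
    exact congrArg g (hdec n).symm

end GrMod

/-- The class in `GrK` of a graded module (zero if it is not finitely generated projective). -/
def GrMod.cls {Q : QuadraticForm R V} (M : GrMod Q) : GrK Q :=
  open Classical in
  if h : M.IsFGP then QuotientAddGroup.mk (KGroup.mk ⟨M, h⟩) else 0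

lemma GrK.exists_rep {Q : QuadraticForm R V} (x : GrK Q) :
    ∃ M : GrMod Q, M.IsFGP ∧ M.cls = x := by
  obtain ⟨y, rfl⟩ := QuotientAddGroup.mk_surjective x
  induction y using AddLocalization.ind with | _ y
  obtain ⟨⟨M⟩, ⟨⟨N⟩, hN⟩⟩ := y
  let N' : FGPMod R (ClTensor Q 1) := ⟨GrMod.opp N.1, GrMod.opp_isFGP N.2⟩
  refine ⟨(M.prod N').1, (M.prod N').2, ?_⟩
  have hmem : KGroup.mk (N.prod N') ∈ restrictionImage Q :=
    AddSubgroup.subset_closure ⟨N.prod N', ⟨GrMod.dbl N.1, GrMod.dbl_isFGP N.2⟩,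
      AddEquiv.refl (N.1.carrier × N.1.carrier),
      fun a (n : N.1.carrier × N.1.carrier) => (GrMod.dbl_restrict (Q := Q) N.1 a n).symm, rfl⟩
  have hx : ∀ A B : FGPMod R (ClTensor Q 1), KGroup.mk (A.prod B) = KGroup.mk A + KGroup.mk B :=
    fun A B => map_add Algebra.GrothendieckAddGroup.of A.isoClass B.isoClass
  have hy : (AddLocalization.mk M.isoClass ⟨N.isoClass, hN⟩ : KGroup R (ClTensor Q 1)) =
      KGroup.mk M - KGroup.mk N := by
    rw [eq_sub_iff_add_eq, KGroup.mk, KGroup.mk, Algebra.GrothendieckAddGroup.of]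
    change _ + AddLocalization.mk _ 0 = AddLocalization.mk _ 0
    rw [AddLocalization.mk_add, AddLocalization.mk_eq_mk_iff, AddLocalization.r_iff_exists]
    exact ⟨0, by simp [add_comm]⟩
  rw [GrMod.cls, dif_pos (M.prod N').2]
  refine (QuotientAddGroup.eq.2 ?_).trans (congrArg _ hy.symm)
  have : -KGroup.mk (⟨(M.prod N').1, (M.prod N').2⟩ : FGPMod R (ClTensor Q 1)) +
      (KGroup.mk M - KGroup.mk N) = -KGroup.mk (N.prod N') := by
    change -KGroup.mk (M.prod N') + _ = _
    rw [hx, hx]; abel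
  rw [this]
  exact neg_mem hmem

namespace GrK

/-- A graded module representing a class of `GrK`. -/
def rep {Q : QuadraticForm R V} (x : GrK Q) : GrMod Q := x.exists_rep.choose

lemma rep_isFGP {Q : QuadraticForm R V} (x : GrK Q) : x.rep.IsFGP := x.exists_rep.choose_spec.1

lemma cls_rep {Q : QuadraticForm R V} (x : GrK Q) : x.rep.cls = x := x.exists_rep.choose_spec.2

/-- The cup-product `K(C(V, Q₁)) × K(C(V, Q₂)) → K(C(V, Q₁ + Q₂))`, `[M] · [N] = [M ⊗̂ N]`. -/
def cup {Q₁ Q₂ Q₃ : QuadraticForm R V} (h : Q₁ + Q₂ = Q₃) (x : GrK Q₁) (y : GrK Q₂) : GrK Q₃ :=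
  (x.rep.tensor h y.rep).cls

variable [Invertible (2 : R)]

/-- The operation `λ^k : K(C(V, Q)) → K(C(V, k Q))`, `λ^k [M] = [λ^k(M)]`. -/
def lam (k : ℕ) {Q : QuadraticForm R V} (x : GrK Q) : GrK (k • Q) := (x.rep.extPow k).cls

/-- The Adams operation `Ψ^k(x) = Q_k(λ^1(x), …, λ^k(x))`, with `Q_k` the Newton polynomial
(`x₁^k + ⋯ + xₙ^k` in terms of the elementary symmetric functions), given by its recursion
`Q_{k+1} = ∑_{i < k} (-1)^i σ_{i+1} Q_{k-i} + (-1)^k (k+1) σ_{k+1}`. The value at `k = 0` is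
irrelevant. -/
def adams {Q : QuadraticForm R V} (x : GrK Q) : (k : ℕ) → GrK (k • Q)
  | 0 => 0
  | k + 1 =>
    (∑ i : Fin k, (-1 : ℤ) ^ (i : ℕ) •
      cup (show ((i : ℕ) + 1) • Q + (k - i) • Q = (k + 1) • Q by
        rw [← add_smul]; congr 1; omega) (lam (i + 1) x) (adams x (k - i))) +
    ((-1 : ℤ) ^ k * (k + 1)) • lam (k + 1) x

end GrK

/-- A quadratic orientation of a quadratic module `(V, q)` of rank `n = 2m`: an isometry between
`⋀ⁿ V` and `(R, x ↦ x²)`. Here `f` is the bilinear form with `f (v, v) = q v`, and the form on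
`⋀ⁿ V` is the one induced by `q`, with the sign of the discriminant:
`⟨v₁ ∧ ⋯ ∧ vₙ, w₁ ∧ ⋯ ∧ wₙ⟩ = (-1)^m det (f (vᵢ, wⱼ))`. This is the normalisation for which the
corresponding element `u` of `C⁰(V, q)` satisfies `u² = 1`. -/
structure QuadOrientation [Invertible (2 : R)] (q : QuadraticForm R V) (m : ℕ) where
  equiv : (⋀[R]^(2 * m) V) ≃ₗ[R] R
  isometry : ∀ v w : Fin (2 * m) → V,
    equiv (exteriorPower.ιMulti R (2 * m) v) * equiv (exteriorPower.ιMulti R (2 * m) w) =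
      (-1) ^ m * Matrix.det (Matrix.of fun i j => QuadraticMap.associated (R := R) q (v i) (w j))

end Clifford

end

/-! The Adams operation is a virtual summand of a tensor power. Since `k!` is invertible, the graded
exterior power λ^i(M) is the summand of the i-th graded tensor power of M cut out by the sign
idempotent of S_i (`splits_extPow`), and a cup-product of such summands is cut out by the product of
the idempotents in a block subgroup (`clsOf_permRep_blockMul`). The Newton polynomial thus becomes a
fixed integral combination of idempotents in the group algebra A of S_k over B = ℤ[1/k!], and Ψ^k[M]
is the same combination of classes of summands of the k-th tensor power (`adams_cls`). All that has
to be known of this combination is its trace: every class function takes on it the value that it has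
at a k-cycle (`sum_newtonList_extend`). This is Newton's identity in the group algebra.

Multiplicativity is then formal. The k-th tensor power of M ⊗̂ N is the product of the k-th tensor
powers of M and N, with S_k acting diagonally (`shuffleEquiv_permAct`). So Ψ^k(x · y) comes from the
image of the combination under the diagonal A → A ⊗ A, and Ψ^k(x) · Ψ^k(y) from its tensor square.
The diagonal sends a group element g to g ⊗ g, so on both sides a product of two class functions χ₁,
χ₂ takes the value χ₁(g)χ₂(g) with g the k-cycle (`sum_diag_eq`).

To pass from traces to classes, A is shown to be split over B (`nonempty_splitFamily`), hence so is
A ⊗ A. As B is a principal ideal domain, every idempotent is a sum of orthogonal idempotents, each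
equivalent to one of a finite list of standard ones (`SplitFamily.exists_decomposition`), and as B
has characteristic zero the multiplicities are read off from traces. So a linear relation between
traces of idempotents holds for the classes of the summands they cut out
(`SplitFamily.sum_smul_eq_zero`).

Well-definedness rests on three facts. Over a nondegenerate form, a Clifford module is finitely
generated projective exactly when it is so over `R` (`AlgMod.isFGP_iff`, by averaging over local
orthogonal bases), so tensor constructions preserve this property. Equality of classes means
isomorphism after adding modules with an odd involution (`GrMod.exists_iso_of_cls_eq`). Such
modules, called null, are harmless: for products this is immediate. For tensor powers let F be an
odd involution of P. The sum of F over all positions of the k-th tensor power of M ⊕ P is odd,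
commutes with S_k, and its square counts the factors in P; it is therefore invertible off the k-th
tensor power of M, because 1, …, k are invertible.

An invertible odd operator is not yet an involution, and here the orientation is used. It gives an
even u in the Clifford algebra with u² = 1 that anticommutes with vectors
(`QuadOrientation.isOriented`). With ε the grading, uε commutes with vectors and with ε but
anticommutes with odd operators, so an invertible odd F interchanges its eigenspaces; F on one of
them and F⁻¹ on the other make up an odd involution (`GrMod.IsOdd.isNull`). -/

noncomputable section

/-! ### The group algebra of the symmetric group is split -/

/-- The group algebra of the symmetric group on `Fin n`. -/
abbrev PermAlg (B : Type*) [CommRing B] (n : ℕ) : Type _ :=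
  MonoidAlgebra B (Equiv.Perm (Fin n))

namespace PermAlg

variable {B : Type*} [CommRing B] {n : ℕ}

/-- The basis element of the group algebra given by a permutation. -/
def of (σ : Equiv.Perm (Fin n)) : PermAlg B n := MonoidAlgebra.single σ 1

lemma of_mul (σ τ : Equiv.Perm (Fin n)) : (of (σ * τ) : PermAlg B n) = of σ * of τ := by
  simp [of, MonoidAlgebra.single_mul_single]

lemma of_one : (of 1 : PermAlg B n) = 1 := rfl

lemma coeff_of (σ τ : Equiv.Perm (Fin n)) :
    (of σ : PermAlg B n).coeff τ = if σ = τ then 1 else 0 := by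
  classical
  simp [of, Finsupp.single_apply]

lemma eq_sum_of (x : PermAlg B n) : x = ∑ σ, x.coeff σ • of σ := by
  classical
  ext τ
  simp [coeff_of]

/-- The linear extension of a function on the symmetric group. -/
def extend (χ : Equiv.Perm (Fin n) → B) : PermAlg B n →ₗ[B] B where
  toFun x := ∑ σ, x.coeff σ * χ σ
  map_add' x y := by simp [add_mul, Finset.sum_add_distrib]
  map_smul' b x := by simp [Finset.mul_sum, mul_assoc]

lemma extend_of (χ : Equiv.Perm (Fin n) → B) (σ : Equiv.Perm (Fin n)) :
    extend χ (of σ) = χ σ := by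
  classical
  simp [extend, coeff_of]

lemma linearMap_ext {W : Type*} [AddCommGroup W] [Module B W] {f g : PermAlg B n →ₗ[B] W}
    (h : ∀ σ, f (of σ) = g (of σ)) : f = g := by
  refine LinearMap.ext fun x => ?_
  rw [eq_sum_of x]
  simp [h]

/-- The coefficient of the identity. -/
def trace : PermAlg B n →ₗ[B] B where
  toFun x := x.coeff 1
  map_add' x y := by simp
  map_smul' b x := by simp

lemma trace_of (σ : Equiv.Perm (Fin n)) :
    trace (of σ : PermAlg B n) = if σ = 1 then 1 else 0 := coeff_of _ _

lemma trace_mul_comm (x y : PermAlg B n) : trace (x * y) = trace (y * x) := by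
  classical
  rw [eq_sum_of x, eq_sum_of y]
  simp only [Finset.sum_mul, Finset.mul_sum, map_sum, smul_mul_smul_comm, ← of_mul, map_smul,
    trace_of, mul_eq_one_iff_eq_inv]
  rw [Finset.sum_comm]
  refine Finset.sum_congr rfl fun i _ => Finset.sum_congr rfl fun j _ => ?_
  rw [mul_comm (x.coeff i)]
  congr 2
  rw [eq_inv_iff_mul_eq_one, eq_inv_iff_mul_eq_one, mul_eq_one_comm]

/-- The families σ and σ⁻¹ are dual bases for the symmetric form `trace (x * y)`. -/
lemma eq_sum_trace (x : PermAlg B n) : x = ∑ σ, trace (x * of σ⁻¹) • of σ := by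
  classical
  conv_lhs => rw [eq_sum_of x]
  refine Finset.sum_congr rfl fun σ _ => ?_
  congr 1
  conv_rhs => rw [eq_sum_of x]
  simp [Finset.sum_mul, ← of_mul, trace_of, mul_inv_eq_one]

lemma commute_of_commute_of {z : PermAlg B n} (h : ∀ σ, of σ * z = z * of σ) (x : PermAlg B n) :
    x * z = z * x := by
  rw [eq_sum_of x]
  simp [Finset.sum_mul, Finset.mul_sum, h]

/-! ### Averages over Young subgroups and their corner rings. -/

section Young

/-- The permutations which preserve a colouring. -/
def colourStab (f : Fin n → Fin n) : Subgroup (Equiv.Perm (Fin n)) where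
  carrier := {σ | f ∘ σ = f}
  mul_mem' {a b} ha hb := by
    change f ∘ (a ∘ b) = f
    rw [← Function.comp_assoc, show f ∘ a = f from ha, show f ∘ b = f from hb]
  one_mem' := rfl
  inv_mem' {a} ha := by
    change f ∘ (a⁻¹ : Equiv.Perm _) = f
    conv_lhs => rw [← show f ∘ a = f from ha]
    ext; simp

lemma mem_colourStab {f : Fin n → Fin n} {σ : Equiv.Perm (Fin n)} :
    σ ∈ colourStab f ↔ ∀ x, f (σ x) = f x := funext_iff

instance (f : Fin n → Fin n) : Fintype (colourStab f) := Fintype.ofFinite _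

/-- The average over the permutations which preserve a colouring. -/
def young (f : Fin n → Fin n) : PermAlg B n :=
  Ring.inverse (Fintype.card (colourStab f) : B) • ∑ σ : colourStab f, of (σ : Equiv.Perm (Fin n))

lemma isUnit_of_dvd_factorial (hB : IsUnit (n.factorial : B)) {m : ℕ} (h : m ∣ n.factorial) :
    IsUnit (m : B) := by
  obtain ⟨c, hc⟩ := h
  rw [hc, Nat.cast_mul] at hB
  exact isUnit_of_mul_isUnit_left hB

lemma isUnit_of_le (hB : IsUnit (n.factorial : B)) {m : ℕ} (h0 : 0 < m) (h : m ≤ n) :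
    IsUnit (m : B) := isUnit_of_dvd_factorial hB (Nat.dvd_factorial h0 h)

lemma isUnit_card_subgroup (hB : IsUnit (n.factorial : B)) (H : Subgroup (Equiv.Perm (Fin n)))
    [Fintype H] : IsUnit (Fintype.card H : B) := by
  refine isUnit_of_dvd_factorial hB ?_
  have := Subgroup.card_subgroup_dvd_card H
  rwa [Nat.card_eq_fintype_card, Nat.card_eq_fintype_card, Fintype.card_perm, Fintype.card_fin]
    at this

lemma of_mul_young {f : Fin n → Fin n} {σ : Equiv.Perm (Fin n)} (h : σ ∈ colourStab f) :
    (of σ * young f : PermAlg B n) = young f := by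
  rw [young, mul_smul_comm, Finset.mul_sum]
  congr 1
  exact Fintype.sum_equiv (Equiv.mulLeft (⟨σ, h⟩ : colourStab f)) _ _ fun τ => by simp [of_mul]

lemma young_mul_of {f : Fin n → Fin n} {σ : Equiv.Perm (Fin n)} (h : σ ∈ colourStab f) :
    (young f * of σ : PermAlg B n) = young f := by
  rw [young, smul_mul_assoc, Finset.sum_mul]
  congr 1
  exact Fintype.sum_equiv (Equiv.mulRight (⟨σ, h⟩ : colourStab f)) _ _ fun τ => by simp [of_mul]

lemma young_mul_of_forall (hB : IsUnit (n.factorial : B)) {f : Fin n → Fin n} {x : PermAlg B n}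
    (h : ∀ σ ∈ colourStab f, of σ * x = x) : young f * x = x := by
  rw [young, smul_mul_assoc, Finset.sum_mul, Finset.sum_congr rfl fun (σ : colourStab f) _ => h σ σ.2]
  rw [Finset.sum_const, Finset.card_univ, ← Nat.cast_smul_eq_nsmul B, smul_smul,
    Ring.inverse_mul_cancel _ (isUnit_card_subgroup hB _), one_smul]

lemma young_mul_young (hB : IsUnit (n.factorial : B)) (f : Fin n → Fin n) :
    (young f * young f : PermAlg B n) = young f :=
  young_mul_of_forall hB fun _ => of_mul_young

/-- The stabilisers are conjugate: `colourStab (f ∘ τ)` is τ⁻¹ `colourStab f` τ. -/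
lemma of_mul_young_comp (f : Fin n → Fin n) (τ : Equiv.Perm (Fin n)) :
    (of τ * young (f ∘ τ) : PermAlg B n) = young f * of τ := by
  let e : colourStab (f ∘ τ) ≃ colourStab f :=
    { toFun := fun (σ : colourStab (f ∘ τ)) => (⟨τ * σ * τ⁻¹, mem_colourStab.2 fun x => by
        simpa using mem_colourStab.1 σ.2 (τ⁻¹ x)⟩ : colourStab f)
      invFun := fun (σ : colourStab f) => (⟨τ⁻¹ * σ * τ, mem_colourStab.2 fun x => by
        simpa using mem_colourStab.1 σ.2 (τ x)⟩ : colourStab (f ∘ τ))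
      left_inv := fun σ => Subtype.ext (by simp [mul_assoc])
      right_inv := fun σ => Subtype.ext (by simp [mul_assoc]) }
  have hc := Fintype.card_congr e
  rw [young, young, hc, mul_smul_comm, smul_mul_assoc, Finset.mul_sum, Finset.sum_mul]
  congr 1
  refine Fintype.sum_equiv e _ _ fun σ => ?_
  simp [← of_mul, e]

/-- The discrete colouring has trivial stabiliser. Through it the unit of the group algebra is
reached at the end of the induction over colour types. -/
lemma young_id : (young id : PermAlg B n) = 1 := by
  have h : ∀ σ : colourStab (id : Fin n → Fin n), σ = 1 := fun σ => by
    ext x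
    exact congrArg Fin.val (mem_colourStab.1 σ.2 x)
  have : Unique (colourStab (id : Fin n → Fin n)) := ⟨⟨1⟩, h⟩
  simp [young, h default, of_one]

/-- The sizes of the colour classes of a colouring, in lexicographic order. -/
def colourType (f : Fin n → Fin n) : Lex (Fin n → ℕ) :=
  toLex fun c => (Finset.univ.filter fun x => f x = c).card

/-- Take `c` to be the first colour whose classes under `f` and `g` differ. These two classes have
equal size, `g` being a rearrangement of `f`, so some `x` has colour `c` under `f` only. Giving it
this colour under `g` too enlarges the class of `c` and leaves those of smaller colours as they are
for `f`, so the type increases lexicographically. -/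
lemma exists_first_difference {f g : Fin n → Fin n} {τ : Equiv.Perm (Fin n)} (hg : g = f ∘ τ)
    (hfg : g ≠ f) : ∃ (c x : Fin n), f x = c ∧ g x ≠ c ∧
      colourType f < colourType (Function.update g x c) := by
  classical
  obtain ⟨z, hz⟩ := Function.ne_iff.1 hfg
  let S : Finset (Fin n) := Finset.univ.filter fun c => ∃ x, ¬ (f x = c ↔ g x = c)
  have hS : S.Nonempty := ⟨f z, by
    simp only [S, Finset.mem_filter, Finset.mem_univ, true_and]
    exact ⟨z, by simp [hz]⟩⟩
  let c := S.min' hS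
  have hlow : ∀ d < c, ∀ x, f x = d ↔ g x = d := by
    intro d hd x
    by_contra h
    exact absurd (S.min'_le d (by simpa [S] using ⟨x, by tauto⟩)) (not_le.2 hd)
  have hcard : ∀ d, (Finset.univ.filter fun x => g x = d).card =
      (Finset.univ.filter fun x => f x = d).card := by
    intro d
    refine Finset.card_bij (fun x _ => τ x) ?_ (fun _ _ _ _ h => τ.injective h) ?_
    · intro x hx; simpa [hg] using hx
    · intro y hy; exact ⟨τ⁻¹ y, by simpa [hg] using hy, by simp⟩
  have hx : ∃ x, f x = c ∧ g x ≠ c := by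
    by_contra! hcon
    have hsub : (Finset.univ.filter fun x => f x = c) ⊆ Finset.univ.filter fun x => g x = c := by
      intro x; simpa using hcon x
    have heq := Finset.eq_of_subset_of_card_le hsub (hcard c).le
    obtain ⟨y, hy⟩ : ∃ x, ¬ (f x = c ↔ g x = c) := by
      have := S.min'_mem hS
      simpa [S] using this
    have := Finset.ext_iff.1 heq y
    simp only [Finset.mem_filter, Finset.mem_univ, true_and] at this
    exact hy this
  obtain ⟨x, hfx, hgx⟩ := hx
  refine ⟨c, x, hfx, hgx, c, ?_, ?_⟩
  · intro d hd
    change (Finset.univ.filter fun x => f x = d).card =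
      (Finset.univ.filter fun y => Function.update g x c y = d).card
    congr 1
    ext y
    simp only [Finset.mem_filter, Finset.mem_univ, true_and]
    by_cases hy : y = x
    · subst hy
      simp [hfx, hd.ne']
    · rw [Function.update_of_ne hy]; exact hlow d hd y
  · change (Finset.univ.filter fun x => f x = c).card <
      (Finset.univ.filter fun y => Function.update g x c y = c).card
    rw [← hcard c]
    refine Finset.card_lt_card ⟨fun y => ?_, fun h => ?_⟩
    · simp only [Finset.mem_filter, Finset.mem_univ, true_and]
      intro hy
      by_cases hyx : y = x
      · subst hyx; simp
      · rwa [Function.update_of_ne hyx]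
    · have := @h x (by simp)
      simp only [Finset.mem_filter, Finset.mem_univ, true_and] at this
      exact hgx this

/-- A straightening argument, by induction on the number of points where `f` and `f ∘ τ` differ. The
colouring `h` of `exists_first_difference` has a larger type, so `w` kills its average; expanding a
suitable element fixed by `young h` gives a relation that expresses the product through colourings
closer to `f`. -/
lemma young_mul_young_comp (hB : IsUnit (n.factorial : B)) {w : PermAlg B n}
    (hw : ∀ x, x * w = w * x) {f : Fin n → Fin n}
    (hf : ∀ h, colourType f < colourType h → w * young h = 0) (τ : Equiv.Perm (Fin n)) :
    ∃ b : B, w * (young f * young (f ∘ τ)) = b • (w * (young f * of τ)) := by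
  classical
  induction hk : (Finset.univ.filter fun z => f z ≠ f (τ z)).card using
    Nat.strong_induction_on generalizing τ with | _ k ih
  by_cases hfg : f ∘ τ = f
  · refine ⟨1, ?_⟩
    rw [hfg, young_mul_young hB, young_mul_of (show τ ∈ colourStab f from hfg), one_smul]
  set g := f ∘ τ with hg
  obtain ⟨c, x, hfx, hgx, hty⟩ := exists_first_difference hg hfg
  set h := Function.update g x c with hh
  have hhx : h x = c := by simp [hh]
  have hhne : ∀ y, y ≠ x → h y = g y := fun y hy => by simp [hh, hy]
  let U : Finset (Fin n) := Finset.univ.filter fun y => h y = c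
  have hU : ∀ y, y ∈ U ↔ h y = c := fun y => by simp [U]
  let Z : PermAlg B n := ∑ y ∈ U, of (Equiv.swap x y) * young g
  -- The transpositions (x y) with `h y = c` represent the cosets of the point stabiliser of `x` in
  -- the stabiliser of `h`. An element of the latter permutes them up to factors which fix `x` and
  -- preserve `h`; these preserve `g`, which agrees with `h` off `x`, and are absorbed by `young g`.
  have hZ : young h * Z = Z := by
    refine young_mul_of_forall hB fun σ hσ => ?_
    rw [mem_colourStab] at hσ
    rw [Finset.mul_sum]
    refine Finset.sum_equiv σ (fun y => by rw [hU, hU, hσ]) fun y hy => ?_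
    rw [hU] at hy
    have key : σ * Equiv.swap x y = Equiv.swap x (σ y) * (Equiv.swap x (σ y) * σ * Equiv.swap x y) := by
      simp [← mul_assoc]
    rw [← mul_assoc, ← of_mul, key, of_mul, mul_assoc, of_mul_young]
    rw [mem_colourStab]
    have hs : ∀ y, h y = c → ∀ z, h (Equiv.swap x y z) = h z := by
      intro y hy z
      rcases eq_or_ne z x with rfl | hz
      · rw [Equiv.swap_apply_left, hy, hhx]
      rcases eq_or_ne z y with rfl | hz'
      · rw [Equiv.swap_apply_right, hy, hhx]
      · rw [Equiv.swap_apply_of_ne_of_ne hz hz']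
    intro z
    rcases eq_or_ne z x with rfl | hz
    · simp
    · have hz' : (Equiv.swap x (σ y) * σ * Equiv.swap x y) z ≠ x := by
        intro h1
        refine hz ((Equiv.swap x (σ y) * σ * Equiv.swap x y).injective (h1.trans ?_))
        simp
      rw [← hhne _ hz, ← hhne _ hz']
      simp only [Equiv.Perm.mul_apply]
      rw [hs _ (by rw [hσ, hy]), hσ, hs _ hy]
  have hwZ : w * (young f * Z) = 0 := by
    rw [← hZ, ← mul_assoc, ← hw, mul_assoc, ← mul_assoc w, hf h hty, zero_mul, mul_zero]
  -- If `f y = c`, then (x y) preserves `f` and disappears into `young f`. Otherwise it moves past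
  -- `young g` and replaces `τ` by `τ * swap x y`, which repairs the disagreement with `f` at `x`
  -- and creates none.
  have hsplit : young f * Z = ((U.filter fun y => f y = c).card : B) • (young f * young g) +
      ∑ y ∈ U.filter fun y => ¬ f y = c, (young f * young (f ∘ ⇑(τ * Equiv.swap x y))) *
        of (Equiv.swap x y) := by
    rw [Finset.mul_sum, ← Finset.sum_filter_add_sum_filter_not U fun y => f y = c]
    congr 1
    · rw [Nat.cast_smul_eq_nsmul, ← Finset.sum_const]
      refine Finset.sum_congr rfl fun y hy => ?_
      rw [← mul_assoc, young_mul_of]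
      rw [mem_colourStab]
      intro z
      have hy' : f y = c := (Finset.mem_filter.1 hy).2
      rcases eq_or_ne z x with rfl | hz
      · rw [Equiv.swap_apply_left, hy', hfx]
      rcases eq_or_ne z y with rfl | hz'
      · rw [Equiv.swap_apply_right, hy', hfx]
      · rw [Equiv.swap_apply_of_ne_of_ne hz hz']
    · refine Finset.sum_congr rfl fun y _ => ?_
      rw [mul_assoc, ← of_mul_young_comp]
      congr 3
      ext z; simp [hg]
  have hterm : ∀ y ∈ U.filter fun y => ¬ f y = c, ∃ b : B,
      w * ((young f * young (f ∘ ⇑(τ * Equiv.swap x y))) * of (Equiv.swap x y)) =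
        b • (w * (young f * of τ)) := by
    intro y hy
    obtain ⟨hyU, hfy⟩ := Finset.mem_filter.1 hy
    rw [hU] at hyU
    have hyx : y ≠ x := fun h => hfy (h ▸ hfx)
    have hgy : f (τ y) = c := by rw [← hyU, hhne y hyx]; rfl
    obtain ⟨b, hb⟩ := ih _ (by
      rw [← hk]
      refine Finset.card_lt_card ⟨fun z => ?_, fun hsub => ?_⟩
      · intro hz1
        have h1 := (Finset.mem_filter.1 hz1).2
        rw [Finset.mem_filter]
        refine ⟨Finset.mem_univ _, fun h2 => h1 ?_⟩
        rw [Equiv.Perm.mul_apply]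
        rcases eq_or_ne z x with rfl | hz
        · rw [Equiv.swap_apply_left, hfx, hgy]
        rcases eq_or_ne z y with rfl | hz'
        · exact absurd (h2.trans hgy) hfy
        · rw [Equiv.swap_apply_of_ne_of_ne hz hz', h2]
      · have := @hsub x (by
          simp only [Finset.mem_filter, Finset.mem_univ, true_and]
          rw [hfx]; exact fun h => hgx h.symm)
        have := (Finset.mem_filter.1 this).2
        rw [Equiv.Perm.mul_apply, Equiv.swap_apply_left] at this
        exact this (hfx.trans hgy.symm)) (τ * Equiv.swap x y) rfl
    refine ⟨b, ?_⟩
    rw [← mul_assoc, hb, smul_mul_assoc, mul_assoc, mul_assoc, ← of_mul]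
    simp [mul_assoc]
  choose! b hb using hterm
  -- The point `x` itself is counted, so the coefficient of the wanted product lies between 1 and
  -- `n` and can be divided out.
  have hN : IsUnit ((U.filter fun y => f y = c).card : B) := by
    refine isUnit_of_le hB (Finset.card_pos.2 ⟨x, ?_⟩) ?_
    · rw [Finset.mem_filter, hU]; exact ⟨hhx, hfx⟩
    · exact (Finset.card_le_univ _).trans_eq (Fintype.card_fin n)
  obtain ⟨N, hN⟩ := hN
  rw [hsplit, mul_add, mul_smul_comm, Finset.mul_sum, Finset.sum_congr rfl hb, ← Finset.sum_smul,
    ← hN] at hwZ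
  refine ⟨-((↑N⁻¹ : B) * ∑ y ∈ U.filter fun y => ¬ f y = c, b y), ?_⟩
  rw [neg_smul, mul_smul, ← smul_neg, ← eq_neg_of_add_eq_zero_left hwZ, smul_smul,
    Units.inv_mul, one_smul]

/-- For a permutation σ, `young f * of σ * young f` equals `young f * young (f ∘ σ⁻¹) * of σ`, to
which the straightening applies. Hence the corner ring at `w * young f` consists of scalars. -/
lemma young_mul_mul_young (hB : IsUnit (n.factorial : B)) {w : PermAlg B n}
    (hw : ∀ x, x * w = w * x) {f : Fin n → Fin n}
    (hf : ∀ h, colourType f < colourType h → w * young h = 0) (x : PermAlg B n) :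
    ∃ b : B, w * (young f * x * young f) = b • (w * young f) := by
  have hof : ∀ σ : Equiv.Perm (Fin n), ∃ b : B,
      w * (young f * of σ * young f) = b • (w * young f) := by
    intro σ
    obtain ⟨b, hb⟩ := young_mul_young_comp hB hw hf σ⁻¹
    refine ⟨b, ?_⟩
    have h1 := of_mul_young_comp (B := B) (f ∘ (σ⁻¹ : Equiv.Perm _)) σ
    have h2 : (f ∘ (σ⁻¹ : Equiv.Perm _)) ∘ σ = f := by ext; simp
    rw [h2] at h1
    rw [mul_assoc (young f), h1, ← mul_assoc, ← mul_assoc, mul_assoc w, hb, smul_mul_assoc,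
      mul_assoc, mul_assoc, ← of_mul]
    simp [of_one]
  choose b hb using hof
  refine ⟨∑ σ, x.coeff σ * b σ, ?_⟩
  conv_lhs => rw [eq_sum_of x]
  simp only [Finset.sum_mul, Finset.mul_sum, mul_smul_comm, smul_mul_assoc, hb, smul_smul,
    Finset.sum_smul]

end Young

end PermAlg

/-- A splitting of an algebra `A` over `B`: idempotents `a i` with corner rings generated by the
unit over `B`, mutually orthogonal in the strong sense, generating the unit ideal, and separated by
trace functionals. -/
structure SplitFamily (B A : Type*) [CommRing B] [Ring A] [Algebra B A] where
  ι : Type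
  [fintype : Fintype ι]
  a : ι → A
  idem : ∀ i, a i * a i = a i
  corner : ∀ i x, ∃ b : B, a i * x * a i = b • a i
  orth : ∀ i j x, i ≠ j → a i * x * a j = 0
  full : (1 : A) ∈ Submodule.span B {w : A | ∃ i x y, w = x * a i * y}
  χ : ι → A →ₗ[B] B
  χ_comm : ∀ i x y, χ i (x * y) = χ i (y * x)
  χ_self : ∀ i, χ i (a i) ≠ 0
  χ_ne : ∀ i j, i ≠ j → χ i (a j) = 0

attribute [instance] SplitFamily.fintype

/-! ### Central idempotents and the splitting of the group algebra. -/

namespace PermAlg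

variable {B : Type*} [CommRing B] {n : ℕ}

lemma trace_mul_eq {a y : PermAlg B n} {r : B} (ha : a * a = a) (h : a * y * a = r • a) :
    trace (a * y) = r * trace a := by
  calc trace (a * y) = trace (a * y * a) := by rw [trace_mul_comm _ a, ← mul_assoc, ha]
    _ = r * trace a := by rw [h, map_smul, smul_eq_mul]

/-- The central idempotent attached to an idempotent whose corner ring is generated by its unit. -/
lemma exists_central_idempotent {a : PermAlg B n} (ha : a * a = a)
    (h : ∀ x, ∃ b : B, a * x * a = b • a) :
    ∃ z : PermAlg B n, (∀ x, x * z = z * x) ∧ z * z = z ∧ z * a = a ∧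
      z ∈ Submodule.span B {w : PermAlg B n | ∃ x y, w = x * a * y} ∧
      (a ≠ 0 → trace a ≠ 0) ∧ ∀ w, (∀ x, x * w = w * x) → w * a = 0 → w * z = 0 := by
  choose r hr using h
  -- Expand the middle factor of a = a·a·a in the group basis: its coefficients are traces, and each
  -- is `trace a` times a corner coefficient. In particular `trace a` is nonzero if `a` is.
  have h1 : a = trace a • ∑ σ, r (of σ⁻¹) • (a * of σ * a) := by
    conv_lhs => rw [show a = a * (∑ σ, trace (a * of σ⁻¹) • of σ) * a by
      rw [← eq_sum_trace, ha, ha]]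
    simp only [trace_mul_eq ha (hr _), Finset.mul_sum, Finset.sum_mul, Finset.smul_sum,
      mul_smul_comm, smul_mul_assoc, smul_smul, mul_comm (trace a)]
  -- The sum of the conjugates of `a` is central, and `trace a • c` is the idempotent sought: by
  -- `h1` it acts as the identity on `a`, hence on all conjugates of `a`. No division is needed.
  let c : PermAlg B n := ∑ σ, of σ * a * of σ⁻¹
  have hc : ∀ x, x * c = c * x := commute_of_commute_of fun τ => by
    simp only [c, Finset.mul_sum, Finset.sum_mul]
    refine Fintype.sum_equiv (Equiv.mulLeft τ) _ _ fun σ => ?_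
    have : (of (τ * σ)⁻¹ : PermAlg B n) * of τ = of σ⁻¹ := by rw [← of_mul]; simp
    rw [Equiv.coe_mulLeft, mul_assoc _ _ (of τ), this, of_mul, mul_assoc, mul_assoc, mul_assoc]
  have hca : trace a • (c * a) = a := by
    conv_rhs => rw [h1]
    rw [show c * a = a * c * a by rw [hc, mul_assoc, ha]]
    congr 1
    simp only [c, Finset.mul_sum, Finset.sum_mul]
    refine Fintype.sum_congr _ _ fun σ => ?_
    rw [← mul_assoc, ← mul_assoc, mul_assoc _ _ a, mul_assoc _ _ (of σ⁻¹ * a), ← mul_assoc a (of _),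
      hr (of σ⁻¹), mul_smul_comm]
  have hcw : ∀ w, (∀ x, x * w = w * x) → w * c = ∑ σ, of σ * (w * a) * of σ⁻¹ := fun w hw => by
    simp only [c, Finset.mul_sum]
    refine Fintype.sum_congr _ _ fun σ => ?_
    rw [← mul_assoc, ← mul_assoc, ← hw, mul_assoc (of σ)]
  refine ⟨trace a • c, fun x => ?_, ?_, ?_, ?_, fun h0 h2 => ?_, fun w hw hwa => ?_⟩
  · rw [mul_smul_comm, smul_mul_assoc, hc]
  · rw [mul_smul_comm, hcw _ (fun x => by rw [mul_smul_comm, smul_mul_assoc, hc])]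
    simp only [smul_mul_assoc, hca]
    rfl
  · rw [smul_mul_assoc, hca]
  · exact Submodule.smul_mem _ _ (Submodule.sum_mem _ fun σ _ => Submodule.subset_span ⟨_, _, rfl⟩)
  · rw [h2, zero_smul] at h1; exact h0 h1
  · rw [mul_smul_comm, hcw w hw, hwa]; simp

/-- Induction over an upward closed set of colour types, from the largest type down. The complement
`w` of the central idempotents found so far kills the averages of all larger types, so `w * young f`
has a corner ring of scalars for the next type. If it is nonzero, it and its central idempotent are
adjoined. One colouring per type is enough, since the others are its rearrangements and have
conjugate averages. -/
lemma exists_partial_splitting (hB : IsUnit (n.factorial : B)) (s : Finset (Lex (Fin n → ℕ)))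
    (hs : ∀ t ∈ s, ∀ f : Fin n → Fin n, t ≤ colourType f → colourType f ∈ s) :
    ∃ (ι : Type) (_ : Fintype ι) (a z : ι → PermAlg B n),
      (∀ i, a i * a i = a i) ∧ (∀ i x, ∃ b : B, a i * x * a i = b • a i) ∧
      (∀ i x, x * z i = z i * x) ∧ (∀ i, z i * z i = z i) ∧ (∀ i j, i ≠ j → z i * z j = 0) ∧
      (∀ i, z i * a i = a i) ∧
      (∀ i, z i ∈ Submodule.span B {w : PermAlg B n | ∃ x y, w = x * a i * y}) ∧
      (∀ i, trace (a i) ≠ 0) ∧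
      ∀ f : Fin n → Fin n, colourType f ∈ s → (∑ i, z i) * young f = young f := by
  classical
  induction s using Finset.induction_on_min with
  | empty => exact ⟨Empty, inferInstance, fun e => e.elim, fun e => e.elim, fun e => e.elim,
      fun e => e.elim, fun e => e.elim, fun e => e.elim, fun e => e.elim, fun e => e.elim,
      fun e => e.elim, fun e => e.elim, fun f hf => by simp at hf⟩
  | insert t s ht ih =>
    obtain ⟨ι, _, a, z, h1, h2, h3, h4, h5, h6, h7, h8, h9⟩ := ih fun t' ht' f hf => by
      have := hs t' (Finset.mem_insert_of_mem ht') f hf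
      exact (Finset.mem_insert.1 this).resolve_left ((ht t' ht').trans_le hf).ne'
    let w : PermAlg B n := 1 - ∑ i, z i
    have hw : ∀ x, x * w = w * x := fun x => by
      simp [w, mul_sub, sub_mul, Finset.mul_sum, Finset.sum_mul, h3]
    have hzz : ∀ i, z i * ∑ j, z j = z i := fun i => by
      rw [Finset.mul_sum, Finset.sum_eq_single i (fun j _ hj => h5 i j hj.symm)
        (fun h => absurd (Finset.mem_univ i) h), h4]
    have hzw : ∀ i, z i * w = 0 := fun i => by rw [mul_sub, mul_one, hzz, sub_self]
    have hww : w * w = w := by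
      conv_lhs => enter [1]; rw [show w = 1 - ∑ i, z i from rfl]
      rw [sub_mul, one_mul, Finset.sum_mul]
      simp [hzw]
    have hkill : ∀ f : Fin n → Fin n, colourType f ∈ s → w * young f = 0 := fun f hf => by
      rw [sub_mul, one_mul, h9 f hf, sub_self]
    -- adjoin one more idempotent for each type, if it is not yet generated
    by_cases hex : ∃ f : Fin n → Fin n, colourType f = t ∧ (w * young f : PermAlg B n) ≠ 0
    swap
    · push Not at hex
      refine ⟨ι, inferInstance, a, z, h1, h2, h3, h4, h5, h6, h7, h8, fun f hf => ?_⟩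
      rcases Finset.mem_insert.1 hf with h | h
      · have := hex f h
        rw [sub_mul, one_mul, sub_eq_zero] at this
        exact this.symm
      · exact h9 f h
    obtain ⟨f, hft, hf0⟩ := hex
    let a' : PermAlg B n := w * young f
    have ha' : a' * a' = a' := by
      simp only [a']
      rw [mul_assoc, ← mul_assoc (young f), hw, mul_assoc w, young_mul_young hB, ← mul_assoc, hww]
    have hlarge : ∀ h : Fin n → Fin n, colourType f < colourType h → w * young h = 0 :=
      fun h hh => hkill h ((Finset.mem_insert.1 (hs t (Finset.mem_insert_self _ _) h
        (hft ▸ hh.le))).resolve_left (hft ▸ hh.ne'))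
    have hcor : ∀ x, ∃ b : B, a' * x * a' = b • a' := fun x => by
      obtain ⟨b, hb⟩ := young_mul_mul_young hB hw hlarge x
      refine ⟨b, ?_⟩
      rw [← hb]
      simp only [a']
      rw [mul_assoc, mul_assoc, ← mul_assoc x w, hw x]
      rw [mul_assoc w x, ← mul_assoc (young f) w, hw (young f), mul_assoc w (young f),
        ← mul_assoc w w, hww, mul_assoc (young f)]
    obtain ⟨z', hz1, hz2, hz3, hz4, hz5, hz6⟩ := exists_central_idempotent ha' hcor
    have hzz' : ∀ i, z i * z' = 0 := fun i => hz6 _ (h3 i) (by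
      simp only [a']; rw [← mul_assoc, hzw, zero_mul])
    refine ⟨Option ι, inferInstance, fun o => o.elim a' a, fun o => o.elim z' z, ?_, ?_, ?_, ?_,
      ?_, ?_, ?_, ?_, ?_⟩
    · rintro (_ | i); exacts [ha', h1 i]
    · rintro (_ | i); exacts [hcor, h2 i]
    · rintro (_ | i); exacts [hz1, h3 i]
    · rintro (_ | i); exacts [hz2, h4 i]
    · rintro (_ | i) (_ | j) hij
      · exact absurd rfl hij
      · exact (h3 j z').trans (hzz' j)
      · exact hzz' i
      · exact h5 i j fun h => hij (congrArg _ h)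
    · rintro (_ | i); exacts [hz3, h6 i]
    · rintro (_ | i); exacts [hz4, h7 i]
    · rintro (_ | i); exacts [hz5 hf0, h8 i]
    · intro g hg
      rw [Fintype.sum_option]
      simp only [Option.elim]
      rcases Finset.mem_insert.1 hg with h | h
      -- Colourings with the same class sizes differ by a permutation of the points, assembled from
      -- bijections of the classes.
      · have hperm : ∃ τ : Equiv.Perm (Fin n), g = f ∘ τ := by
          have hc : ∀ c, Fintype.card {x // g x = c} = Fintype.card {x // f x = c} := fun c => by
            have := congrFun (congrArg ofLex (h.trans hft.symm)) c
            rw [Fintype.card_subtype, Fintype.card_subtype]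
            exact this
          let e : ∀ c, {x // g x = c} ≃ {x // f x = c} := fun c => Fintype.equivOfCardEq (hc c)
          refine ⟨((Equiv.sigmaFiberEquiv g).symm.trans (Equiv.sigmaCongrRight e)).trans
            (Equiv.sigmaFiberEquiv f), funext fun x => ?_⟩
          exact (e (g x) ⟨x, rfl⟩).2.symm
        obtain ⟨τ, rfl⟩ := hperm
        have hy : (young (f ∘ τ) : PermAlg B n) = of τ⁻¹ * young f * of τ := by
          rw [mul_assoc, ← of_mul_young_comp, ← mul_assoc, ← of_mul]
          simp [of_one]
        have hwy : w * young (f ∘ τ) = of τ⁻¹ * a' * of τ := by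
          rw [hy, ← mul_assoc, ← mul_assoc, ← hw, mul_assoc (of _) w]
        -- A central element that kills `a'` also kills `z'`; here it is `1 - w`.
        have hzw' : z' * w = z' := by
          have : (1 - w) * z' = 0 := hz6 _ (fun x => by rw [mul_sub, sub_mul, hw, mul_one, one_mul])
            (by simp only [a']; rw [← mul_assoc, sub_mul, one_mul, hww, sub_self, zero_mul])
          rw [hz1, mul_sub, mul_one, sub_eq_zero] at this
          · exact this.symm
        have : z' * young (f ∘ τ) = w * young (f ∘ τ) := by
          rw [← hzw', mul_assoc, hwy, ← mul_assoc, ← mul_assoc, ← hz1, mul_assoc (of _) z', hz3]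
        rw [add_mul, this, sub_mul, one_mul, sub_add_cancel]
      · rw [add_mul, h9 g h]
        have : z' * young g = 0 := by
          have hzw' : z' * w = z' := by
            have : (1 - w) * z' = 0 := hz6 _
              (fun x => by rw [mul_sub, sub_mul, hw, mul_one, one_mul])
              (by simp only [a']; rw [← mul_assoc, sub_mul, one_mul, hww, sub_self, zero_mul])
            rw [hz1, mul_sub, mul_one, sub_eq_zero] at this
            exact this.symm
          rw [← hzw', mul_assoc, hkill g h, mul_zero]
        rw [this, zero_add]

/-- The group algebra of the symmetric group is split if the group order is invertible. -/
theorem nonempty_splitFamily (hB : IsUnit (n.factorial : B)) :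
    Nonempty (SplitFamily B (PermAlg B n)) := by
  classical
  obtain ⟨ι, _, a, z, h1, h2, h3, h4, h5, h6, h7, h8, h9⟩ := exists_partial_splitting hB
    (Finset.univ.image (colourType (n := n))) fun _ _ f _ => Finset.mem_image_of_mem _ (Finset.mem_univ _)
  -- The discrete colouring, whose average is 1, is among those covered.
  have hsum : ∑ i, z i = 1 := by
    have := h9 id (Finset.mem_image_of_mem _ (Finset.mem_univ _))
    rwa [young_id, mul_one] at this
  have haz : ∀ i j, i ≠ j → a j * z i = 0 := fun i j hij => by
    rw [h3, ← h6 j, ← mul_assoc, h5 i j hij, zero_mul]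
  exact ⟨{
    ι := ι
    a := a
    idem := h1
    corner := h2
    orth := fun i j x hij => by
      rw [← h6 j, ← mul_assoc, mul_assoc, mul_assoc, ← mul_assoc x, h3 j, ← mul_assoc, ← mul_assoc,
        haz j i hij.symm, zero_mul, zero_mul]
    full := by
      rw [← hsum]
      refine Submodule.sum_mem _ fun i _ => ?_
      refine Submodule.span_mono ?_ (h7 i)
      rintro w ⟨x, y, rfl⟩
      exact ⟨i, x, y, rfl⟩
    -- The trace of the group algebra, cut down to the two-sided ideal of the i-th central
    -- idempotent.
    χ := fun i => trace ∘ₗ LinearMap.mulRight B (z i)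
    χ_comm := fun i x y => by
      simp only [LinearMap.comp_apply, LinearMap.mulRight_apply]
      rw [mul_assoc, trace_mul_comm, mul_assoc, ← h3, ← mul_assoc]
    χ_self := fun i => by
      simp only [LinearMap.comp_apply, LinearMap.mulRight_apply]
      rw [h3, h6]; exact h8 i
    χ_ne := fun i j hij => by
      simp only [LinearMap.comp_apply, LinearMap.mulRight_apply]
      rw [haz i j hij, map_zero] }⟩

end PermAlg

/-! ### Split algebras: tensor products, decomposition of idempotents, multiplicities. -/

namespace SplitFamily

variable {B A A' : Type*} [CommRing B] [Ring A] [Algebra B A] [Ring A'] [Algebra B A']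

/-- The tensor product of two splittings. -/
def tensor [NoZeroDivisors B] (S : SplitFamily B A) (S' : SplitFamily B A') :
    SplitFamily B (A ⊗[B] A') where
  ι := S.ι × S'.ι
  a p := S.a p.1 ⊗ₜ S'.a p.2
  idem p := by rw [Algebra.TensorProduct.tmul_mul_tmul, S.idem, S'.idem]
  corner p x := by
    induction x with
    | zero => exact ⟨0, by simp⟩
    | tmul x y =>
      obtain ⟨b, hb⟩ := S.corner p.1 x
      obtain ⟨b', hb'⟩ := S'.corner p.2 y
      refine ⟨b * b', ?_⟩
      rw [Algebra.TensorProduct.tmul_mul_tmul, Algebra.TensorProduct.tmul_mul_tmul, hb, hb',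
        TensorProduct.smul_tmul_smul]
    | add x y hx hy =>
      obtain ⟨b, hb⟩ := hx
      obtain ⟨b', hb'⟩ := hy
      exact ⟨b + b', by rw [mul_add, add_mul, hb, hb', add_smul]⟩
  orth p q x hpq := by
    induction x with
    | zero => simp
    | tmul x y =>
      rw [Algebra.TensorProduct.tmul_mul_tmul, Algebra.TensorProduct.tmul_mul_tmul]
      by_cases h : p.1 = q.1
      · rw [S'.orth _ _ y fun h' => hpq (Prod.ext h h'), TensorProduct.tmul_zero]
      · rw [S.orth _ _ x h, TensorProduct.zero_tmul]
    | add x y hx hy => rw [mul_add, add_mul, hx, hy, add_zero]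
  full := by
    rw [Algebra.TensorProduct.one_def]
    refine Submodule.span_induction (p := fun x _ => x ⊗ₜ[B] (1 : A') ∈ _) ?_ ?_ ?_ ?_ S.full
    · rintro _ ⟨i, x, y, rfl⟩
      refine Submodule.span_induction
        (p := fun z _ => (x * S.a i * y) ⊗ₜ[B] (z : A') ∈ _) ?_ ?_ ?_ ?_ S'.full
      · rintro _ ⟨i', x', y', rfl⟩
        refine Submodule.subset_span ⟨(i, i'), x ⊗ₜ x', y ⊗ₜ y', ?_⟩
        simp only [Algebra.TensorProduct.tmul_mul_tmul]
      · rw [TensorProduct.tmul_zero]; exact zero_mem _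
      · intro u v _ _ hu hv; rw [TensorProduct.tmul_add]; exact add_mem hu hv
      · intro b u _ hu; rw [TensorProduct.tmul_smul]; exact Submodule.smul_mem _ _ hu
    · rw [TensorProduct.zero_tmul]; exact zero_mem _
    · intro u v _ _ hu hv; rw [TensorProduct.add_tmul]; exact add_mem hu hv
    · intro b u _ hu; rw [← TensorProduct.smul_tmul']; exact Submodule.smul_mem _ _ hu
  χ p := LinearMap.mul' B B ∘ₗ TensorProduct.map (S.χ p.1) (S'.χ p.2)
  χ_comm p x y := by
    induction x with
    | zero => simp
    | tmul x x' =>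
      induction y with
      | zero => simp
      | tmul y y' => simp [S.χ_comm p.1 x y, S'.χ_comm p.2 x' y']
      | add u v hu hv => rw [mul_add, add_mul, map_add, map_add, hu, hv]
    | add u v hu hv => rw [mul_add, add_mul, map_add, map_add, hu, hv]
  χ_self p := by simpa using ⟨S.χ_self p.1, S'.χ_self p.2⟩
  χ_ne p q hpq := by
    by_cases h : p.1 = q.1
    · simp [S'.χ_ne _ _ fun h' => hpq (Prod.ext h h')]
    · simp [S.χ_ne _ _ h]

/-- A decomposition of an idempotent `e` as a sum of idempotents equivalent to the `S.a i`. -/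
structure IsDecomposition (S : SplitFamily B A) (e : A) {κ : Type} [Fintype κ] [DecidableEq κ]
    (l : κ → S.ι) (b c : κ → A) : Prop where
  left_b : ∀ t, e * b t = b t
  b_right : ∀ t, b t * S.a (l t) = b t
  left_c : ∀ t, S.a (l t) * c t = c t
  c_right : ∀ t, c t * e = c t
  c_mul_b : ∀ s t, c t * b s = if t = s then S.a (l t) else 0
  sum : ∑ t, b t * c t = e

variable [IsDomain B]

/-- Each e A aᵢ is a submodule of a finite free module over a principal ideal domain, so it has a
basis; its members are the `b t`. Because the `S.a i` generate the unit ideal, `e` can be written as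
a sum of products `b t * c t` with `c t` in aᵢ A e. Multiplying this by `b s` and comparing
coordinates shows that the `c t` are dual to the `b t`. -/
lemma exists_decomposition [IsPrincipalIdealRing B] [Module.Finite B A] [Module.Free B A]
    (S : SplitFamily B A) {e : A} (he : e * e = e) :
    ∃ (κ : Type) (_ : Fintype κ) (_ : DecidableEq κ) (l : κ → S.ι) (b c : κ → A),
      S.IsDecomposition e l b c := by
  classical
  let N : S.ι → Submodule B A := fun i =>
    LinearMap.range (LinearMap.mulRight B (S.a i) ∘ₗ LinearMap.mulLeft B e)
  have hN : ∀ i (x : N i), e * (x : A) = x ∧ (x : A) * S.a i = x := by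
    rintro i ⟨_, x, rfl⟩
    simp only [LinearMap.comp_apply, LinearMap.mulRight_apply, LinearMap.mulLeft_apply]
    rw [← mul_assoc, ← mul_assoc, he, mul_assoc (e * x), S.idem]
    exact ⟨rfl, rfl⟩
  let bas := fun i => (Submodule.basisOfPid (Module.Free.chooseBasis B A) (N i)).2
  let κ := Σ i, Fin (Submodule.basisOfPid (Module.Free.chooseBasis B A) (N i)).1
  let b : κ → A := fun t => bas t.1 t.2
  -- For w = x aᵢ y one has e w e = (e x aᵢ)(aᵢ y e), and the coordinates of the first factor in the
  -- chosen basis are moved to the second. The general case follows by linearity, and `w = 1` is the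
  -- one needed.
  have hspan : ∀ w ∈ Submodule.span B {w : A | ∃ i x y, w = x * S.a i * y},
      ∃ c : κ → A, (∀ t, S.a t.1 * c t = c t ∧ c t * e = c t) ∧ e * w * e = ∑ t, b t * c t := by
    intro w hw
    induction hw using Submodule.span_induction with
    | mem w hw =>
      obtain ⟨i, x, y, rfl⟩ := hw
      let m : N i := ⟨e * x * S.a i, x, rfl⟩
      refine ⟨fun t => if h : t.1 = i then
        (bas i).repr m (Fin.cast (by rw [h]) t.2) • (S.a i * y * e) else 0, ?_, ?_⟩
      · rintro ⟨j, t⟩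
        by_cases h : j = i
        · subst h
          simp only [dite_true, mul_smul_comm, smul_mul_assoc]
          rw [mul_assoc _ e e, he, ← mul_assoc, ← mul_assoc, S.idem]
          exact ⟨rfl, rfl⟩
        · simp [h]
      · rw [Fintype.sum_sigma, Finset.sum_eq_single i]
        · simp only [dite_true, mul_smul_comm, Fin.cast_eq_self, b]
          have h1 : e * (x * S.a i * y) * e = (m : A) * (S.a i * y * e) := by
            simp only [m]
            rw [mul_assoc (e * x), ← mul_assoc (S.a i), ← mul_assoc (S.a i), S.idem]
            simp only [mul_assoc]
          have h2 : (m : A) = ∑ s, (bas i).repr m s • ((bas i s : N i) : A) := by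
            have := congrArg (N i).subtype ((bas i).sum_repr m)
            rw [map_sum] at this
            simpa only [map_smul, Submodule.subtype_apply] using this.symm
          rw [h1, h2, Finset.sum_mul]
          simp only [smul_mul_assoc]
        · intro j _ hj; simp [hj]
        · intro h; exact absurd (Finset.mem_univ _) h
    | zero => exact ⟨0, by simp, by simp⟩
    | add u v _ _ hu hv =>
      obtain ⟨c, hc, hcu⟩ := hu
      obtain ⟨d, hd, hdv⟩ := hv
      refine ⟨c + d, fun t => ?_, ?_⟩
      · simp [mul_add, add_mul, hc, hd]
      · simp [mul_add, add_mul, hcu, hdv, Finset.sum_add_distrib]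
    | smul r u _ hu =>
      obtain ⟨c, hc, hcu⟩ := hu
      refine ⟨r • c, fun t => ?_, ?_⟩
      · simp [hc]
      · simp [hcu, Finset.smul_sum]
  have hb : ∀ t, e * b t = b t ∧ b t * S.a t.1 = b t := fun t => hN _ _
  obtain ⟨c, hc, hsum⟩ := hspan 1 S.full
  rw [mul_one, he] at hsum
  refine ⟨κ, inferInstance, inferInstance, fun t => t.1, b, c, fun t => (hN _ _).1,
    fun t => (hN _ _).2, fun t => (hc t).1, fun t => (hc t).2, ?_, hsum.symm⟩
  have hne : ∀ s t : κ, t.1 ≠ s.1 → c t * b s = 0 := fun s t h => by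
    rw [← (hc t).1, ← (hb s).2, ← mul_assoc, mul_assoc (S.a t.1), S.orth _ _ _ h]
  have hγ : ∀ s t : κ, ∃ γ : B, t.1 = s.1 → c t * b s = γ • S.a t.1 := fun s t => by
    obtain ⟨γ, hγ⟩ := S.corner t.1 (c t * b s)
    refine ⟨γ, fun h => ?_⟩
    rw [← hγ, ← mul_assoc, (hc t).1, mul_assoc, h]
    congr 1
    exact (hN s.1 (bas s.1 s.2)).2.symm
  choose γ hγ using hγ
  -- From b_s = e b_s = ∑ b_t (c_t b_s), where c_t b_s is the scalar γ times aᵢ, linear independence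
  -- of the basis forces the Kronecker delta.
  have hkey : ∀ (i : S.ι) (s t), γ ⟨i, s⟩ ⟨i, t⟩ = if t = s then 1 else 0 := by
    intro i s
    have h1 : b ⟨i, s⟩ = ∑ t, γ ⟨i, s⟩ ⟨i, t⟩ • b ⟨i, t⟩ := by
      conv_lhs => rw [← (hb ⟨i, s⟩).1, hsum, Finset.sum_mul]
      rw [Fintype.sum_sigma, Finset.sum_eq_single i]
      · refine Fintype.sum_congr _ _ fun t => ?_
        rw [mul_assoc, hγ ⟨i, s⟩ ⟨i, t⟩ rfl, mul_smul_comm]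
        congr 1
        exact (hN i (bas i t)).2
      · intro j _ hj
        refine Finset.sum_eq_zero fun t _ => ?_
        rw [mul_assoc, hne ⟨i, s⟩ ⟨j, t⟩ hj, mul_zero]
      · intro h; exact absurd (Finset.mem_univ _) h
    have h2 : bas i s = ∑ t, γ ⟨i, s⟩ ⟨i, t⟩ • bas i t := Subtype.ext (by simpa [b] using h1)
    intro t
    have h3 := congrArg (fun x => (bas i).repr x t) h2
    simp only [Module.Basis.repr_self, map_sum, map_smul, Finsupp.coe_finsetSum,
      Finset.sum_apply, Finsupp.smul_apply, Finsupp.single_apply, smul_eq_mul, mul_ite, mul_one,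
      mul_zero, Finset.sum_ite_eq', Finset.mem_univ, if_true] at h3
    rw [← h3]
    simp only [eq_comm]
  rintro ⟨i, s⟩ ⟨j, t⟩
  by_cases h : j = i
  · subst h
    rw [hγ ⟨j, s⟩ ⟨j, t⟩ rfl, hkey]
    by_cases hst : t = s
    · subst hst; simp
    · have hst' : (⟨j, t⟩ : κ) ≠ ⟨j, s⟩ := fun h => hst (eq_of_heq (Sigma.mk.inj h).2)
      rw [if_neg hst, if_neg hst', zero_smul]
  · rw [hne _ _ h, if_neg]
    intro h'
    exact h (congrArg Sigma.fst h')

-- By the trace property χ(bc) = χ(cb), each summand `b t * c t` contributes `χ i (a (l t))`: the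
-- trace counts the summands of type `i`.
omit [IsDomain B] in
lemma IsDecomposition.χ_eq {S : SplitFamily B A} {e : A} {κ : Type} [Fintype κ] [DecidableEq κ]
    [DecidableEq S.ι] {l : κ → S.ι} {b c : κ → A} (h : S.IsDecomposition e l b c) (i : S.ι) :
    S.χ i e = (Finset.univ.filter fun t => l t = i).card * S.χ i (S.a i) := by
  conv_lhs => rw [← h.sum]
  rw [map_sum, Finset.card_filter, Nat.cast_sum, Finset.sum_mul]
  refine Fintype.sum_congr _ _ fun t => ?_
  rw [S.χ_comm, h.c_mul_b, if_pos rfl]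
  by_cases ht : l t = i
  · simp [ht]
  · simp [ht, S.χ_ne i (l t) (Ne.symm ht)]

/-- A linear relation between the traces of idempotents holds for every additive invariant. -/
theorem sum_smul_eq_zero [CharZero B] [IsPrincipalIdealRing B] [Module.Finite B A]
    [Module.Free B A] (S : SplitFamily B A) {J : Type*} [Fintype J] (n : J → ℤ) {e : J → A}
    (he : ∀ j, e j * e j = e j) (hχ : ∀ i, ∑ j, n j • S.χ i (e j) = 0) {K : Type*} [AddCommGroup K]
    (Φ : J → K) (φ : S.ι → K)
    (hΦ : ∀ j (κ : Type) [Fintype κ] [DecidableEq κ] (l : κ → S.ι) (b c : κ → A),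
      S.IsDecomposition (e j) l b c → Φ j = ∑ t, φ (l t)) :
    ∑ j, n j • Φ j = 0 := by
  classical
  choose κ hκ hκ' l b c h using fun j => S.exists_decomposition (he j)
  -- The factor `χ i (a i)` is nonzero in a domain of characteristic zero, so the relation between
  -- traces becomes one between integer multiplicities.
  have hcount : ∀ i, ∑ j, n j * ((Finset.univ.filter fun t => l j t = i).card : ℤ) = 0 := by
    intro i
    have := hχ i
    simp only [(h _).χ_eq, zsmul_eq_mul, ← mul_assoc, ← Finset.sum_mul] at this
    have := (mul_eq_zero.1 this).resolve_right (S.χ_self i)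
    exact_mod_cast this
  have hΦ' : ∀ j, Φ j = ∑ i, ((Finset.univ.filter fun t => l j t = i).card : ℤ) • φ i := by
    intro j
    rw [hΦ j _ _ _ _ (h j), ← Finset.sum_fiberwise Finset.univ (l j)]
    refine Fintype.sum_congr _ _ fun i => ?_
    rw [natCast_zsmul, ← Finset.sum_const]
    exact Finset.sum_congr rfl fun t ht => by rw [(Finset.mem_filter.1 ht).2]
  simp only [hΦ', Finset.smul_sum, smul_smul]
  rw [Finset.sum_comm]
  simp only [← Finset.sum_smul, hcount, zero_smul, Finset.sum_const_zero]

end SplitFamily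

/-! ### The diagonal of the group algebra and products of characters. -/

namespace PermAlg

variable {B : Type*} [CommRing B] {n : ℕ}


variable (B n) in
/-- The diagonal of the group algebra. -/
def diag : PermAlg B n →ₐ[B] PermAlg B n ⊗[B] PermAlg B n :=
  MonoidAlgebra.lift B _ _
    { toFun := fun σ => of σ ⊗ₜ of σ
      map_one' := by rw [of_one, Algebra.TensorProduct.one_def]
      map_mul' := fun σ τ => by rw [of_mul, Algebra.TensorProduct.tmul_mul_tmul] }

lemma diag_of (σ : Equiv.Perm (Fin n)) : diag B n (of σ) = of σ ⊗ₜ of σ := by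
  simp [diag, of]

/-- If a combination of idempotents has the same character as a permutation `c`, then its image
under the diagonal and its tensor square have the same products of characters. -/
lemma sum_diag_eq {ι : Type*} [Fintype ι] {c : ι → ℤ} {e : ι → PermAlg B n}
    {g : Equiv.Perm (Fin n)}
    (h : ∀ χ : Equiv.Perm (Fin n) → B, (∀ σ τ, χ (σ * τ) = χ (τ * σ)) →
      ∑ i, c i • extend χ (e i) = χ g) (χ₁ χ₂ : PermAlg B n →ₗ[B] B)
    (h₁ : ∀ x y, χ₁ (x * y) = χ₁ (y * x)) (h₂ : ∀ x y, χ₂ (x * y) = χ₂ (y * x)) :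
    ∑ i, c i • (LinearMap.mul' B B ∘ₗ TensorProduct.map χ₁ χ₂) (diag B n (e i)) =
      ∑ p : ι × ι, (c p.1 * c p.2) • (LinearMap.mul' B B ∘ₗ TensorProduct.map χ₁ χ₂)
        (e p.1 ⊗ₜ e p.2) := by
  have hext : ∀ χ : PermAlg B n →ₗ[B] B, χ = extend fun σ => χ (of σ) := fun χ =>
    linearMap_ext fun σ => by rw [extend_of]
  have hsum : ∀ χ : PermAlg B n →ₗ[B] B, (∀ σ τ, χ (of (σ * τ)) = χ (of (τ * σ))) →
      ∑ i, c i • χ (e i) = χ (of g) := fun χ hχ => by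
    rw [← h (fun σ => χ (of σ)) hχ, ← hext]
  -- The composite of the two functionals with the diagonal is again a class function on the group,
  -- with value χ₁(g)χ₂(g) at `g`.
  have hd := hsum ((LinearMap.mul' B B ∘ₗ TensorProduct.map χ₁ χ₂) ∘ₗ (diag B n).toLinearMap)
    fun σ τ => by simp [diag_of, of_mul, h₁ (of σ), h₂ (of σ)]
  have e1 := hsum χ₁ fun σ τ => by rw [of_mul, h₁, ← of_mul]
  have e2 := hsum χ₂ fun σ τ => by rw [of_mul, h₂, ← of_mul]
  simp only [LinearMap.comp_apply, AlgHom.toLinearMap_apply, diag_of, TensorProduct.map_tmul,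
    LinearMap.mul'_apply] at hd ⊢
  rw [hd, ← e1, ← e2, Finset.sum_mul_sum, Fintype.sum_prod_type]
  refine Fintype.sum_congr _ _ fun i => Fintype.sum_congr _ _ fun j => ?_
  simp only [zsmul_eq_mul, Int.cast_mul]
  ring

end PermAlg

/-- An ideal of the localization is generated by its contraction, hence by the image of a generator
of the contraction. -/
lemma IsLocalization.isPrincipalIdealRing_of {R : Type*} [CommRing R] [IsPrincipalIdealRing R]
    (M : Submonoid R) (S : Type*) [CommRing S] [Algebra R S] [IsLocalization M S] :
    IsPrincipalIdealRing S := by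
  refine ⟨fun J => ?_⟩
  obtain ⟨x, hx⟩ := (IsPrincipalIdealRing.principal (J.comap (algebraMap R S)))
  refine ⟨algebraMap R S x, ?_⟩
  rw [← IsLocalization.map_under M S J, Ideal.under, hx]
  simp [Ideal.map_span, ← Ideal.submodule_span_eq]

namespace PermAlg

/-! ### Block permutations -/

/-- The identification of two consecutive blocks with an interval. -/
def blockEquiv {a b n : ℕ} (h : a + b = n) : Fin a ⊕ Fin b ≃ Fin n :=
  finSumFinEquiv.trans (finCongr h)

lemma blockEquiv_inl_val {a b n : ℕ} (h : a + b = n) (i : Fin a) :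
    (blockEquiv h (Sum.inl i) : ℕ) = i := by simp [blockEquiv]

lemma blockEquiv_inr_val {a b n : ℕ} (h : a + b = n) (i : Fin b) :
    (blockEquiv h (Sum.inr i) : ℕ) = a + i := by simp [blockEquiv]

/-- The permutation which acts on two consecutive blocks by given permutations. -/
def blockPerm {a b n : ℕ} (h : a + b = n) :
    Equiv.Perm (Fin a) × Equiv.Perm (Fin b) →* Equiv.Perm (Fin n) :=
  ((blockEquiv h).permCongrHom.toMonoidHom).comp (Equiv.Perm.sumCongrHom _ _)

lemma blockPerm_apply_inl {a b n : ℕ} (h : a + b = n) (p : Equiv.Perm (Fin a) × Equiv.Perm (Fin b))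
    (i : Fin a) : blockPerm h p (blockEquiv h (Sum.inl i)) = blockEquiv h (Sum.inl (p.1 i)) := by
  simp [blockPerm, Equiv.permCongrHom]

lemma blockPerm_apply_inr {a b n : ℕ} (h : a + b = n) (p : Equiv.Perm (Fin a) × Equiv.Perm (Fin b))
    (i : Fin b) : blockPerm h p (blockEquiv h (Sum.inr i)) = blockEquiv h (Sum.inr (p.2 i)) := by
  simp [blockPerm, Equiv.permCongrHom]

lemma blockPerm_symm_blockEquiv {a b n : ℕ} (h : a + b = n)
    (p : Equiv.Perm (Fin a) × Equiv.Perm (Fin b)) (x : Fin n) :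
    (blockEquiv h).symm (blockPerm h p x) = Sum.map p.1 p.2 ((blockEquiv h).symm x) := by
  obtain ⟨y, rfl⟩ := (blockEquiv h).surjective x
  rcases y with y | y
  · rw [blockPerm_apply_inl]; simp
  · rw [blockPerm_apply_inr]; simp

lemma blockPerm_rotate_val {a b n : ℕ} (h : a + b = n) (x : Fin n) :
    (blockPerm h (1, finRotate b) x : ℕ) =
      if (x : ℕ) < a then (x : ℕ) else if (x : ℕ) + 1 < n then (x : ℕ) + 1 else a := by
  obtain ⟨y, rfl⟩ := (blockEquiv h).surjective x
  rcases y with y | y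
  · rw [blockPerm_apply_inl, blockEquiv_inl_val, blockEquiv_inl_val, if_pos y.2]; rfl
  · rw [blockPerm_apply_inr, blockEquiv_inr_val, blockEquiv_inr_val, if_neg (by omega)]
    obtain ⟨b, rfl⟩ : ∃ c, b = c + 1 := ⟨b - 1, by have := y.2; omega⟩
    rcases eq_or_ne y (Fin.last b) with rfl | hy
    · rw [finRotate_last, if_neg (by simp; omega)]; simp
    · have h1 : (y : ℕ) < b := Fin.val_lt_last hy
      rw [if_pos (by omega)]
      have := coe_finRotate_of_ne_last hy
      simp only at this ⊢
      rw [this]; omega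

lemma sign_blockPerm_one {a b n : ℕ} (h : a + b = n) (σ : Equiv.Perm (Fin a)) :
    Equiv.Perm.sign (blockPerm h (σ, 1)) = Equiv.Perm.sign σ := by
  simp [blockPerm, Equiv.permCongrHom, Equiv.Perm.sign_permCongr, Equiv.Perm.sumCongrHom]

/-! ### The Newton identity in the group algebra -/

section Newton

variable {B : Type*} [CommRing B] {n : ℕ}

/-- The permutations which fix all points from `m` on. -/
def initialPerms (n m : ℕ) : Finset (Equiv.Perm (Fin n)) :=
  Finset.univ.filter fun σ => ∀ x : Fin n, m ≤ (x : ℕ) → σ x = x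

lemma mem_initialPerms {m : ℕ} {σ : Equiv.Perm (Fin n)} :
    σ ∈ initialPerms n m ↔ ∀ x : Fin n, m ≤ (x : ℕ) → σ x = x := by simp [initialPerms]

/-- The cycle on the points from `m` on. -/
def tailCycle (n m : ℕ) : Equiv.Perm (Fin n) :=
  if h : m ≤ n then blockPerm (Nat.add_sub_of_le h) (1, finRotate (n - m)) else 1

lemma tailCycle_val {m : ℕ} (h : m ≤ n) (x : Fin n) : (tailCycle n m x : ℕ) =
    if (x : ℕ) < m then (x : ℕ) else if (x : ℕ) + 1 < n then (x : ℕ) + 1 else m := by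
  rw [tailCycle, dif_pos h, blockPerm_rotate_val]

/-- The cycle m → m+1 → … → n−1 → m is the cycle on the points from m+1 on followed by the
transposition of m and m+1. -/
lemma tailCycle_pred {m : ℕ} (h : m + 1 < n) :
    tailCycle n m = Equiv.swap ⟨m + 1, h⟩ ⟨m, by omega⟩ * tailCycle n (m + 1) := by
  ext x
  have h1 := tailCycle_val h.le x
  have h2 := tailCycle_val (show m ≤ n by omega) x
  rw [h2, Equiv.Perm.mul_apply, Equiv.swap_apply_def]
  simp only [Fin.ext_iff]
  rw [apply_ite Fin.val, apply_ite Fin.val, h1]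
  have := x.2
  split_ifs <;> simp_all <;> omega

lemma tailCycle_last (k : ℕ) : tailCycle (k + 1) k = 1 := by
  ext x
  rw [tailCycle_val (by omega)]
  have := x.2
  simp only [Equiv.Perm.one_apply]
  split_ifs <;> omega

lemma tailCycle_zero : tailCycle n 0 = finRotate n := by
  ext x
  rw [tailCycle_val (by omega)]
  obtain ⟨k, rfl⟩ : ∃ k, n = k + 1 := ⟨n - 1, by have := x.2; omega⟩
  rcases eq_or_ne x (Fin.last k) with rfl | hx
  · simp
  · have h1 : (x : ℕ) < k := Fin.val_lt_last hx
    rw [coe_finRotate_of_ne_last hx, if_neg (by omega), if_pos (by omega)]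

/-- The symmetric group on the points 0, …, m is the union of the cosets of the one on 0, …, m−1,
represented by the transpositions (m y) with y ≤ m; the case y = m is the trivial coset. -/
lemma sum_initialPerms_succ {m : ℕ} (h : m < n) (F : Equiv.Perm (Fin n) → B) :
    ∑ σ ∈ initialPerms n (m + 1), F σ =
      ∑ y ∈ Finset.univ.filter fun y : Fin n => (y : ℕ) ≤ m, ∑ σ ∈ initialPerms n m,
        F (σ * Equiv.swap ⟨m, h⟩ y) := by
  rw [← Finset.sum_product']
  symm
  refine Finset.sum_bij' (fun p _ => p.2 * Equiv.swap ⟨m, h⟩ p.1)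
    (fun σ _ => (σ⁻¹ ⟨m, h⟩, σ * Equiv.swap ⟨m, h⟩ (σ⁻¹ ⟨m, h⟩))) ?_ ?_ ?_ ?_ fun _ _ => rfl
  · rintro ⟨y, σ⟩ hp
    simp only [Finset.mem_product, Finset.mem_filter, Finset.mem_univ, true_and,
      mem_initialPerms] at hp ⊢
    intro x hx
    rw [Equiv.Perm.mul_apply, Equiv.swap_apply_of_ne_of_ne, hp.2 x (by omega)]
    · intro h'; rw [h'] at hx; simp at hx
    · intro h'; rw [h'] at hx; omega
  · intro σ hσ
    simp only [Finset.mem_product, Finset.mem_filter, Finset.mem_univ, true_and,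
      mem_initialPerms] at hσ ⊢
    refine ⟨?_, fun x hx => ?_⟩
    · by_contra hcon
      have := hσ (σ⁻¹ ⟨m, h⟩) (by omega)
      have h2 : σ (σ⁻¹ ⟨m, h⟩) = ⟨m, h⟩ := by simp
      rw [this.symm.trans h2] at hcon
      simp at hcon
    · rcases eq_or_ne x ⟨m, h⟩ with rfl | hx'
      · simp
      · have hxm : m + 1 ≤ (x : ℕ) := by
          have : (x : ℕ) ≠ m := fun h' => hx' (Fin.ext h')
          omega
        have h1 : x ≠ σ⁻¹ ⟨m, h⟩ := fun h' => by
          have := hσ x hxm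
          have h2 : σ (σ⁻¹ ⟨m, h⟩) = ⟨m, h⟩ := by simp
          rw [← h', this] at h2
          exact hx' h2
        rw [Equiv.Perm.mul_apply, Equiv.swap_apply_of_ne_of_ne hx' h1, hσ x hxm]
  · rintro ⟨y, σ⟩ hp
    simp only [Finset.mem_product, mem_initialPerms] at hp
    have hm : σ⁻¹ ⟨m, h⟩ = ⟨m, h⟩ := by rw [Equiv.Perm.inv_eq_iff_eq, hp.2 _ le_rfl]
    have h1 : (σ * Equiv.swap ⟨m, h⟩ y)⁻¹ ⟨m, h⟩ = y := by
      rw [mul_inv_rev, Equiv.Perm.mul_apply, hm]; simp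
    refine Prod.ext h1 ?_
    simp only [h1, mul_assoc, Equiv.swap_mul_self, mul_one]
  · intro σ _
    simp [mul_assoc]

/-- The trivial coset gives the first sum. For each of the other m+1 cosets, conjugation by ρ = (y
m) is harmless for a class function: it preserves the smaller group and commutes with the cycle from
m+1 on. It turns (m+1 y) into (m+1 m), which lengthens the cycle by the point m. The transposition
changes the sign, so these cosets contribute m+1 equal negative terms. -/
lemma initialPerms_sum_step {χ : Equiv.Perm (Fin n) → B} (hχ : ∀ σ τ, χ (σ * τ) = χ (τ * σ))
    {m : ℕ} (h : m + 1 < n) :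
    ∑ σ ∈ initialPerms n (m + 2), (Equiv.Perm.sign σ : ℤ) • χ (σ * tailCycle n (m + 1)) =
      ∑ σ ∈ initialPerms n (m + 1), (Equiv.Perm.sign σ : ℤ) • χ (σ * tailCycle n (m + 1)) -
      ((m + 1 : ℕ) : B) *
        ∑ σ ∈ initialPerms n (m + 1), (Equiv.Perm.sign σ : ℤ) • χ (σ * tailCycle n m) := by
  have hm : m < n := by omega
  rw [sum_initialPerms_succ h]
  have hset : (Finset.univ.filter fun y : Fin n => (y : ℕ) ≤ m + 1) =
      insert ⟨m + 1, h⟩ (Finset.univ.filter fun y : Fin n => (y : ℕ) < m + 1) := by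
    ext y; simp [Fin.ext_iff]; omega
  have hcard : (Finset.univ.filter fun y : Fin n => (y : ℕ) < m + 1).card = m + 1 := by
    have := Fin.card_filter_val_lt (n := n) (m := m + 1)
    rw [this]; omega
  rw [hset, Finset.sum_insert (by simp), sub_eq_add_neg]
  congr 1
  · simp only [Equiv.swap_self, ← Equiv.Perm.one_def, mul_one]
  rw [← mul_neg, ← nsmul_eq_mul]
  have hconst : ∀ X : B, (m + 1) • X =
      ∑ _y ∈ Finset.univ.filter fun y : Fin n => (y : ℕ) < m + 1, X := fun X => by
    rw [Finset.sum_const, hcard]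
  rw [hconst]
  refine Finset.sum_congr rfl fun y hy => ?_
  have hy' : (y : ℕ) < m + 1 := (Finset.mem_filter.1 hy).2
  let ρ : Equiv.Perm (Fin n) := Equiv.swap y ⟨m, hm⟩
  have hρ : ρ⁻¹ = ρ := Equiv.swap_inv _ _
  have hρfix : ∀ x : Fin n, m + 1 ≤ (x : ℕ) → ρ x = x := fun x hx =>
    Equiv.swap_apply_of_ne_of_ne (fun h' => by rw [h'] at hx; omega)
      (fun h' => by rw [h'] at hx; simp at hx)
  have hρc : ρ * tailCycle n (m + 1) = tailCycle n (m + 1) * ρ := by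
    have hfix : ∀ x : Fin n, (x : ℕ) < m + 1 → tailCycle n (m + 1) x = x := fun x hx =>
      Fin.ext (by rw [tailCycle_val h.le, if_pos hx])
    have hρlt : ∀ x : Fin n, (x : ℕ) < m + 1 → (ρ x : ℕ) < m + 1 := fun x hx => by
      simp only [ρ, Equiv.swap_apply_def]
      split_ifs <;> simp <;> omega
    ext x
    simp only [Equiv.Perm.mul_apply]
    by_cases hx : (x : ℕ) < m + 1
    · rw [hfix x hx, hfix _ (hρlt x hx)]
    · rw [hρfix x (by omega), hρfix]
      rw [tailCycle_val h.le, if_neg hx]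
      split_ifs <;> omega
  rw [← Finset.sum_neg_distrib]
  refine Finset.sum_bij' (fun σ _ => ρ * σ * ρ) (fun σ _ => ρ * σ * ρ) ?_ ?_ ?_ ?_ ?_
  · intro σ hσ
    rw [mem_initialPerms] at hσ ⊢
    intro x hx
    rw [Equiv.Perm.mul_apply, Equiv.Perm.mul_apply, hρfix x hx, hσ x hx, hρfix x hx]
  · intro σ hσ
    rw [mem_initialPerms] at hσ ⊢
    intro x hx
    rw [Equiv.Perm.mul_apply, Equiv.Perm.mul_apply, hρfix x hx, hσ x hx, hρfix x hx]
  · intro σ _; simp [ρ, mul_assoc]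
  · intro σ _; simp [ρ, mul_assoc]
  · intro σ _
    have hne : (⟨m + 1, h⟩ : Fin n) ≠ y := fun h' => by rw [← h'] at hy'; simp at hy'
    have hsw : ρ * Equiv.swap ⟨m + 1, h⟩ y * ρ = Equiv.swap ⟨m + 1, h⟩ ⟨m, hm⟩ := by
      have := Equiv.mul_swap_eq_swap_mul ρ ⟨m + 1, h⟩ y
      rw [this, hρfix _ le_rfl, mul_assoc]
      simp [ρ]
    rw [tailCycle_pred h, ← neg_smul]
    congr 1
    · simp only [Equiv.Perm.sign_mul, Equiv.Perm.sign_swap hne, Units.val_mul]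
      have : ((Equiv.Perm.sign ρ : ℤˣ) : ℤ) * (Equiv.Perm.sign ρ : ℤˣ) = 1 := by
        rw [← Units.val_mul, Int.units_mul_self]; rfl
      simp only [Units.val_neg, Units.val_one]
      linear_combination (Equiv.Perm.sign σ : ℤ) * this
    · have hρρ : ρ * ρ = 1 := Equiv.swap_mul_self _ _
      rw [← hsw]
      have e1 : ρ * σ * ρ * (ρ * Equiv.swap ⟨m + 1, h⟩ y * ρ * tailCycle n (m + 1)) =
          ρ * (σ * Equiv.swap ⟨m + 1, h⟩ y * tailCycle n (m + 1) * ρ) := by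
        calc _ = ρ * σ * (ρ * ρ) * Equiv.swap ⟨m + 1, h⟩ y * (ρ * tailCycle n (m + 1)) := by
              simp only [mul_assoc]
          _ = _ := by rw [hρρ, hρc, mul_one]; simp only [mul_assoc]
      rw [e1, hχ ρ, mul_assoc _ ρ ρ, hρρ, mul_one]

variable (B) in
/-- The sign idempotent of the symmetric group. -/
def signIdem (n : ℕ) : PermAlg B n :=
  Ring.inverse (n.factorial : B) • ∑ σ, (Equiv.Perm.sign σ : ℤ) • of σ

lemma of_mul_signIdem (σ : Equiv.Perm (Fin n)) :
    of σ * signIdem B n = (Equiv.Perm.sign σ : ℤ) • signIdem B n := by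
  have key : of σ * ∑ τ, (Equiv.Perm.sign τ : ℤ) • (of τ : PermAlg B n) =
      (Equiv.Perm.sign σ : ℤ) • ∑ τ, (Equiv.Perm.sign τ : ℤ) • (of τ : PermAlg B n) := by
    rw [Finset.mul_sum, Finset.smul_sum]
    refine Fintype.sum_equiv (Equiv.mulLeft σ) _ _ fun τ => ?_
    rw [mul_smul_comm, smul_smul, ← of_mul, Equiv.coe_mulLeft, Equiv.Perm.sign_mul,
      ← Units.val_mul, ← mul_assoc, Int.units_mul_self, one_mul]
  rw [signIdem, mul_smul_comm, key, smul_comm]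

lemma signIdem_mul_of (σ : Equiv.Perm (Fin n)) :
    signIdem B n * of σ = (Equiv.Perm.sign σ : ℤ) • signIdem B n := by
  have key : (∑ τ, (Equiv.Perm.sign τ : ℤ) • (of τ : PermAlg B n)) * of σ =
      (Equiv.Perm.sign σ : ℤ) • ∑ τ, (Equiv.Perm.sign τ : ℤ) • (of τ : PermAlg B n) := by
    rw [Finset.sum_mul, Finset.smul_sum]
    refine Fintype.sum_equiv (Equiv.mulRight σ) _ _ fun τ => ?_
    rw [smul_mul_assoc, smul_smul, ← of_mul, Equiv.coe_mulRight, Equiv.Perm.sign_mul,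
      ← Units.val_mul, mul_comm (Equiv.Perm.sign τ), ← mul_assoc, Int.units_mul_self, one_mul]
  rw [signIdem, smul_mul_assoc, key, smul_comm]

lemma signIdem_mul_self (hB : IsUnit (n.factorial : B)) :
    signIdem B n * signIdem B n = signIdem B n := by
  conv_lhs => enter [1]; rw [signIdem]
  rw [smul_mul_assoc, Finset.sum_mul]
  have : ∀ σ : Equiv.Perm (Fin n), ((Equiv.Perm.sign σ : ℤ) • of σ) * signIdem B n =
      signIdem B n := fun σ => by
    rw [smul_mul_assoc, of_mul_signIdem, smul_smul, ← Units.val_mul, Int.units_mul_self]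
    simp
  rw [Finset.sum_congr rfl fun σ _ => this σ, Finset.sum_const, Finset.card_univ,
    Fintype.card_perm, Fintype.card_fin, ← Nat.cast_smul_eq_nsmul B, smul_smul,
    Ring.inverse_mul_cancel _ hB, one_smul]

variable (B) in
/-- The inclusion of the group algebra of the first of two block subgroups. -/
def leftHom {a b n : ℕ} (h : a + b = n) : PermAlg B a →ₐ[B] PermAlg B n :=
  MonoidAlgebra.mapDomainAlgHom B B ((blockPerm h).comp (MonoidHom.inl _ _))

variable (B) in
/-- The inclusion of the group algebra of the second of two block subgroups. -/
def rightHom {a b n : ℕ} (h : a + b = n) : PermAlg B b →ₐ[B] PermAlg B n :=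
  MonoidAlgebra.mapDomainAlgHom B B ((blockPerm h).comp (MonoidHom.inr _ _))

lemma leftHom_of {a b n : ℕ} (h : a + b = n) (σ : Equiv.Perm (Fin a)) :
    leftHom B h (of σ) = of (blockPerm h (σ, 1)) := by
  simp [leftHom, of]

lemma rightHom_of {a b n : ℕ} (h : a + b = n) (σ : Equiv.Perm (Fin b)) :
    rightHom B h (of σ) = of (blockPerm h (1, σ)) := by
  simp [rightHom, of]

lemma leftHom_comm_rightHom {a b n : ℕ} (h : a + b = n) (x : PermAlg B a) (y : PermAlg B b) :
    leftHom B h x * rightHom B h y = rightHom B h y * leftHom B h x := by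
  rw [eq_sum_of x, eq_sum_of y]
  simp only [map_sum, map_smul, leftHom_of, rightHom_of, Finset.sum_mul_sum, smul_mul_smul_comm,
    ← of_mul, ← map_mul, Prod.mk_mul_mk, one_mul, mul_one]
  rw [Finset.sum_comm]
  simp only [mul_comm]

/-- The product of elements of the group algebras of two block subgroups. -/
def blockMul {a b n : ℕ} (h : a + b = n) (x : PermAlg B a) (y : PermAlg B b) : PermAlg B n :=
  leftHom B h x * rightHom B h y

lemma blockMul_idem {a b n : ℕ} (h : a + b = n) {x : PermAlg B a} {y : PermAlg B b}
    (hx : x * x = x) (hy : y * y = y) : blockMul h x y * blockMul h x y = blockMul h x y := by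
  rw [blockMul, mul_assoc, ← mul_assoc (rightHom B h y), ← leftHom_comm_rightHom, mul_assoc,
    ← mul_assoc, ← map_mul, ← map_mul, hx, hy]

lemma exists_blockPerm_of_mem_initialPerms {a b n : ℕ} (h : a + b = n) {σ : Equiv.Perm (Fin n)}
    (hσ : σ ∈ initialPerms n a) : ∃ τ, blockPerm h (τ, 1) = σ := by
  rw [mem_initialPerms] at hσ
  let ρ : Equiv.Perm (Fin a ⊕ Fin b) := (blockEquiv h).symm.permCongr σ
  have hρr : ∀ i, ρ (Sum.inr i) = Sum.inr i := fun i => by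
    simp only [ρ, Equiv.permCongr_apply, Equiv.symm_symm]
    rw [hσ _ (by rw [blockEquiv_inr_val]; omega), Equiv.symm_apply_apply]
  have hmem : ρ ∈ (Equiv.Perm.sumCongrHom (Fin a) (Fin b)).range := by
    refine Equiv.Perm.mem_sumCongrHom_range_of_perm_mapsTo_inl ?_
    rw [Equiv.Perm.perm_mapsTo_inl_iff_mapsTo_inr]
    rintro _ ⟨i, rfl⟩
    exact ⟨i, (hρr i).symm⟩
  obtain ⟨⟨τ, τ'⟩, hτ⟩ := hmem
  refine ⟨τ, Equiv.ext fun x => ?_⟩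
  obtain ⟨y, rfl⟩ := (blockEquiv h).surjective x
  rcases y with y | y
  · rw [blockPerm_apply_inl]
    have := Equiv.congr_fun hτ (Sum.inl y)
    simp only [Equiv.Perm.sumCongrHom_apply, Equiv.Perm.sumCongr_apply, Sum.map_inl, ρ,
      Equiv.permCongr_apply, Equiv.symm_symm] at this
    rw [this, Equiv.apply_symm_apply]
  · rw [blockPerm_apply_inr, hσ _ (by rw [blockEquiv_inr_val]; omega)]; rfl

lemma extend_blockMul_signIdem {a b n : ℕ} (h : a + b = n) (χ : Equiv.Perm (Fin n) → B) :
    extend χ (blockMul h (signIdem B a) (of (finRotate b))) =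
      Ring.inverse (a.factorial : B) *
        ∑ σ ∈ initialPerms n a, (Equiv.Perm.sign σ : ℤ) • χ (σ * tailCycle n a) := by
  have hc : blockPerm h (1, finRotate b) = tailCycle n a := by
    obtain rfl : b = n - a := by omega
    rw [tailCycle, dif_pos (by omega)]
  simp only [blockMul, signIdem, map_smul, map_sum, leftHom_of, rightHom_of, map_zsmul,
    smul_mul_assoc, Finset.sum_mul, ← of_mul, extend_of, hc, smul_eq_mul]
  congr 1
  refine Finset.sum_bij (fun σ _ => blockPerm h (σ, 1)) ?_ ?_ ?_ ?_
  · intro σ _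
    rw [mem_initialPerms]
    intro x hx
    obtain ⟨y, rfl⟩ := (blockEquiv h).surjective x
    rcases y with y | y
    · rw [blockEquiv_inl_val] at hx; omega
    · rw [blockPerm_apply_inr]; rfl
  · intro σ _ τ _ hστ
    refine Equiv.ext fun x => ?_
    have := Equiv.congr_fun hστ (blockEquiv h (Sum.inl x))
    rw [blockPerm_apply_inl, blockPerm_apply_inl] at this
    simpa using this
  · intro σ hσ
    obtain ⟨τ, hτ⟩ := exists_blockPerm_of_mem_initialPerms h hσ
    exact ⟨τ, Finset.mem_univ _, hτ⟩
  · intro σ _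
    rw [sign_blockPerm_one]

/-- Newton's identity between the characters of the sign idempotents and of the cycles. -/
lemma newton_identity {k : ℕ} (hB : IsUnit ((k + 1).factorial : B))
    {χ : Equiv.Perm (Fin (k + 1)) → B} (hχ : ∀ σ τ, χ (σ * τ) = χ (τ * σ)) :
    ∑ i : Fin k, (-1 : ℤ) ^ (i : ℕ) • extend χ (blockMul
        (show ((i : ℕ) + 1) + (k - i) = k + 1 by omega) (signIdem B (i + 1))
          (of (finRotate (k - i)))) +
      ((-1 : ℤ) ^ k * (k + 1)) • extend χ (signIdem B (k + 1)) = χ (finRotate (k + 1)) := by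
  -- The group algebra form of a hook: antisymmetrise the points 0, …, m and multiply by the cycle
  -- on the points from m on, the two overlapping in m. The product of the sign idempotent of size
  -- i+1 with a (k−i)-cycle pairs to `α (i + 1) + α i`, so the alternating sum telescopes to `α 0`,
  -- which is the full cycle.
  let α : ℕ → B := fun m => Ring.inverse (m.factorial : B) *
    ∑ σ ∈ initialPerms (k + 1) (m + 1), (Equiv.Perm.sign σ : ℤ) • χ (σ * tailCycle (k + 1) m)
  have hfac : ∀ m ≤ k + 1, IsUnit (m.factorial : B) := fun m hm =>
    isUnit_of_dvd_factorial hB (Nat.factorial_dvd_factorial hm)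
  have hinv : ∀ m ≤ k, Ring.inverse ((m + 1).factorial : B) * ((m + 1 : ℕ) : B) =
      Ring.inverse (m.factorial : B) := fun m hm => by
    have h1 := hfac (m + 1) (by omega)
    have h2 := hfac m (by omega)
    refine h2.mul_right_cancel ?_
    rw [Ring.inverse_mul_cancel _ h2, mul_assoc, ← Nat.cast_mul, ← Nat.factorial_succ,
      Ring.inverse_mul_cancel _ h1]
  have hα0 : α 0 = χ (finRotate (k + 1)) := by
    have : initialPerms (k + 1) (0 + 1) = {1} := by
      ext σ
      rw [mem_initialPerms, Finset.mem_singleton]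
      constructor
      · intro h
        have h1 : ∀ x, x ≠ 0 → σ x = x := fun x hx =>
          h x (Nat.one_le_iff_ne_zero.2 fun h0 => hx (Fin.ext h0))
        ext x
        by_cases hx : x = 0
        · subst hx
          by_contra hcon
          have h2 : σ 0 ≠ 0 := fun h' => hcon (by rw [h']; rfl)
          exact h2 (σ.injective (h1 _ h2))
        · rw [h1 x hx]; rfl
      · rintro rfl x _; rfl
    simp only [α, this, Finset.sum_singleton, tailCycle_zero]
    simp
  have hαk : α k = ((k + 1 : ℕ) : B) * extend χ (signIdem B (k + 1)) := by
    have : initialPerms (k + 1) (k + 1) = Finset.univ := by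
      ext σ; simp only [mem_initialPerms, Finset.mem_univ, iff_true]
      intro x hx; have := x.2; omega
    simp only [α, this, tailCycle_last, mul_one]
    rw [signIdem, map_smul, smul_eq_mul, ← mul_assoc, mul_comm ((k + 1 : ℕ) : B), hinv k le_rfl]
    rw [map_sum]
    congr 1
    exact Fintype.sum_congr _ _ fun σ => by rw [map_zsmul, extend_of]
  have hstep : ∀ i (hi : i < k), extend χ (blockMul
        (show (i + 1) + (k - i) = k + 1 by omega) (signIdem B (i + 1))
          (of (finRotate (k - i)))) = α (i + 1) + α i := by
    intro i hi
    rw [extend_blockMul_signIdem]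
    simp only [α]
    rw [initialPerms_sum_step hχ (by omega), mul_sub, ← mul_assoc, hinv i hi.le]
    ring
  have htel : ∀ j ≤ k, ∑ i ∈ Finset.range j, (-1 : ℤ) ^ i • (α (i + 1) + α i) +
      (-1 : ℤ) ^ j • α j = α 0 := by
    intro j
    induction j with
    | zero => simp
    | succ j ih =>
      intro hj
      rw [← ih (by omega), Finset.sum_range_succ, pow_succ, smul_add, mul_neg_one, neg_smul]
      abel
  rw [← hα0, ← htel k le_rfl, Finset.sum_range]
  congr 1
  · exact Fintype.sum_congr _ _ fun i => by rw [hstep i i.2]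
  · rw [hαk, mul_smul, ← Nat.cast_succ, natCast_zsmul, nsmul_eq_mul]

variable (B) in
/-- The Newton polynomial as a formal combination of idempotents of the group algebra. -/
def newtonList : (n : ℕ) → List (ℤ × PermAlg B n)
  | 0 => []
  | k + 1 => ((List.finRange k).flatMap fun i : Fin k => (newtonList (k - i)).map fun p =>
      ((-1) ^ (i : ℕ) * p.1, blockMul (show ((i : ℕ) + 1) + (k - i) = k + 1 by omega)
        (signIdem B (i + 1)) p.2)) ++ [((-1 : ℤ) ^ k * (k + 1), signIdem B (k + 1))]

lemma sum_newtonList_succ {K : Type*} [AddCommGroup K] (k : ℕ) (F : ℤ × PermAlg B (k + 1) → K) :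
    ((newtonList B (k + 1)).map F).sum = (∑ i : Fin k, ((newtonList B (k - i)).map fun p =>
      F ((-1) ^ (i : ℕ) * p.1, blockMul (show ((i : ℕ) + 1) + (k - i) = k + 1 by omega)
        (signIdem B (i + 1)) p.2)).sum) + F ((-1) ^ k * (k + 1), signIdem B (k + 1)) := by
  rw [newtonList, List.map_append, List.sum_append, List.map_flatMap, List.flatMap_def,
    List.sum_flatten, Fin.sum_univ_def]
  simp [Function.comp_def]

lemma idem_of_mem_newtonList {n : ℕ} (hB : IsUnit (n.factorial : B)) :
    ∀ p ∈ newtonList B n, p.2 * p.2 = p.2 := by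
  induction n using Nat.strong_induction_on with | _ n ih
  rcases n with _ | k
  · simp [newtonList]
  intro p hp
  rw [newtonList, List.mem_append, List.mem_flatMap, List.mem_singleton] at hp
  rcases hp with ⟨i, _, hp⟩ | rfl
  · obtain ⟨p', hp', rfl⟩ := List.mem_map.1 hp
    refine blockMul_idem _ (signIdem_mul_self (isUnit_of_dvd_factorial hB
      (Nat.factorial_dvd_factorial (by omega)))) (ih (k - i) (by omega)
        (isUnit_of_dvd_factorial hB (Nat.factorial_dvd_factorial (by omega))) p' hp')
  · exact signIdem_mul_self hB

/-- Multiplying by the sign idempotent of the first block and applying χ gives a class function on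
the second block. By induction the shorter Newton combination there can be replaced by a cycle, and
`newton_identity` finishes. -/
lemma sum_newtonList_extend {n : ℕ} (hn : 0 < n) (hB : IsUnit (n.factorial : B))
    {χ : Equiv.Perm (Fin n) → B} (hχ : ∀ σ τ, χ (σ * τ) = χ (τ * σ)) :
    ((newtonList B n).map fun p => p.1 • extend χ p.2).sum = χ (finRotate n) := by
  induction n using Nat.strong_induction_on with | _ n ih
  obtain ⟨k, rfl⟩ : ∃ k, n = k + 1 := ⟨n - 1, by omega⟩
  rw [sum_newtonList_succ, ← newton_identity hB hχ]
  congr 1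
  refine Fintype.sum_congr _ _ fun i => ?_
  have hi : ((i : ℕ) + 1) + (k - i) = k + 1 := by omega
  let θ : PermAlg B (k - i) →ₗ[B] B :=
    extend χ ∘ₗ LinearMap.mulLeft B (leftHom B hi (signIdem B (i + 1))) ∘ₗ
      (rightHom B hi).toLinearMap
  have hθ : θ = extend fun σ => θ (of σ) := linearMap_ext fun σ => by rw [extend_of]
  have hcl : ∀ x y, extend χ (x * y) = extend χ (y * x) := by
    intro x y
    rw [eq_sum_of x, eq_sum_of y]
    simp only [Finset.sum_mul_sum, smul_mul_smul_comm, ← of_mul, map_sum, map_smul, extend_of]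
    rw [Finset.sum_comm]
    simp only [hχ, mul_comm]
  have hmain := ih (k - i) (by omega) (by omega)
    (isUnit_of_dvd_factorial hB (Nat.factorial_dvd_factorial (by omega)))
    (χ := fun σ => θ (of σ)) fun σ τ => by
      simp only [θ, LinearMap.comp_apply, AlgHom.toLinearMap_apply, LinearMap.mulLeft_apply, of_mul,
        map_mul]
      rw [← mul_assoc, hcl, ← mul_assoc, ← leftHom_comm_rightHom, mul_assoc]
  rw [← hθ] at hmain
  change _ = (-1 : ℤ) ^ (i : ℕ) • θ (of (finRotate (k - i)))
  rw [← hmain, List.smul_sum, List.map_map]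
  congr 2
  funext p
  exact mul_smul _ _ _

end Newton

end PermAlg

/-! ### Orthogonal systems in nondegenerate quadratic modules -/

section OrthogonalSystem

variable {R W : Type u} [CommRing R] [AddCommGroup W] [Module R W]

/-- A family of pairwise orthogonal vectors whose values are units modulo `p`. -/
structure IsOrthogonalSystem (Q : QuadraticForm R W) (p : Ideal R) {l : ℕ} (w : Fin l → W) :
    Prop where
  orthogonal : ∀ i j, i ≠ j → QuadraticMap.polar Q (w i) (w j) = 0
  notMem : ∀ i, Q (w i) ∉ p

variable [Invertible (2 : R)] {Q : QuadraticForm R W} {p : Ideal R}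

lemma mul_eq_of_two_mul_mem [p.IsPrime] {r : R} (h : 2 * r ∈ p) : r ∈ p := by
  have := p.mul_mem_left (⅟2 : R) h
  rwa [← mul_assoc, invOf_mul_self, one_mul] at this

omit [Invertible (2 : R)] in
lemma polar_mem_of_mem_smul_top {x : W} (hx : x ∈ p • (⊤ : Submodule R W)) (y : W) :
    QuadraticMap.polar Q x y ∈ p := by
  have : (p • (⊤ : Submodule R W)) ≤ Submodule.comap (Q.polarBilin.flip y) p := by
    rw [Submodule.smul_le]
    intro r hr n _
    rw [Submodule.mem_comap, map_smul, smul_eq_mul]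
    exact p.mul_mem_right _ hr
  exact this hx

/-- Pairing a relation with `w j` isolates twice its j-th coefficient times `Q (w j)`, and both 2
and `Q (w j)` are units modulo `p`. This bounds the length of an orthogonal system. -/
lemma IsOrthogonalSystem.linearIndependent [p.IsMaximal] {l : ℕ} {w : Fin l → W}
    (hw : IsOrthogonalSystem Q p w) :
    LinearIndependent (R ⧸ p) fun i => (Submodule.mkQ (p • (⊤ : Submodule R W)) (w i)) := by
  rw [Fintype.linearIndependent_iff]
  intro c hc j
  choose r hr using fun i => Ideal.Quotient.mk_surjective (c i)
  have h1 : ∑ i, r i • w i ∈ p • (⊤ : Submodule R W) := by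
    rw [← Submodule.Quotient.mk_eq_zero, ← Submodule.mkQ_apply, map_sum, ← hc]
    exact Finset.sum_congr rfl fun i _ => by rw [map_smul, ← hr]; rfl
  have h2 := polar_mem_of_mem_smul_top (Q := Q) h1 (w j)
  have h3 : QuadraticMap.polar Q (∑ i, r i • w i) (w j) = 2 * (r j * Q (w j)) := by
    change Q.polarBilin (∑ i, r i • w i) (w j) = _
    rw [map_sum, LinearMap.sum_apply, Finset.sum_eq_single j]
    · simp [QuadraticMap.polar_self]; ring
    · intro i _ hij
      simp [hw.orthogonal i j hij]
    · simp
  rw [h3] at h2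
  rw [← hr, Ideal.Quotient.eq_zero_iff_mem]
  exact (Ideal.IsPrime.mem_or_mem inferInstance (mul_eq_of_two_mul_mem h2)).resolve_right
    (hw.notMem j)

variable [Module.Finite R W] [Module.Projective R W]

-- Nondegeneracy represents the coordinate forms of a dual basis by vectors `y i`, and then `x` is
-- the combination of the `y i` with coefficients the pairings of `x` with the generators.
omit [Invertible (2 : R)] in
lemma mem_smul_top_of_polar_mem (hQ : Function.Bijective Q.polarBilin) {x : W}
    (hx : ∀ y, QuadraticMap.polar Q x y ∈ p) : x ∈ p • (⊤ : Submodule R W) := by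
  obtain ⟨n, f, g, hf, hg, hfg⟩ := Module.Finite.exists_comp_eq_id_of_projective R W
  choose y hy using fun i : Fin n => hQ.2 (LinearMap.proj i ∘ₗ g)
  have : x = ∑ i, QuadraticMap.polar Q x (f (Pi.single i 1)) • y i := by
    apply hQ.1
    refine LinearMap.ext fun z => ?_
    simp only [map_sum, map_smul, LinearMap.sum_apply, LinearMap.smul_apply, hy]
    conv_lhs => rw [← LinearMap.id_apply (R := R) z, ← hfg, LinearMap.comp_apply,
      pi_eq_sum_univ' (g z), map_sum, map_sum]
    refine Finset.sum_congr rfl fun i _ => ?_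
    rw [map_smul, map_smul, smul_eq_mul, smul_eq_mul, mul_comm]
    rfl
  rw [this]
  exact Submodule.sum_mem _ fun i _ => Submodule.smul_mem_smul (hx _) trivial

/-- A nondegenerate quadratic module has, near each maximal ideal, an orthogonal basis. -/
lemma exists_orthogonalSystem (hQ : Function.Bijective Q.polarBilin) [p.IsMaximal] :
    ∃ (l : ℕ) (w : Fin l → W) (s : R), IsOrthogonalSystem Q p w ∧ s ∉ p ∧
      ∀ x, s • x ∈ Submodule.span R (Set.range w) := by
  by_contra hcon
  push Not at hcon
  -- If no orthogonal system spans near `p`, each can be lengthened, against the dimension of the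
  -- fibre at `p`.
  have hP : ∀ l : ℕ, ∃ w : Fin l → W, IsOrthogonalSystem Q p w := by
    intro l
    induction l with
    | zero => exact ⟨Fin.elim0, ⟨fun i => i.elim0, fun i => i.elim0⟩⟩
    | succ l ih =>
      obtain ⟨w, hw⟩ := ih
      let d : R := ∏ i, (2 * Q (w i))
      have hd : d ∉ p := by
        rw [Ideal.IsPrime.prod_mem_iff]
        rintro ⟨i, _, hi⟩
        exact hw.notMem i (mul_eq_of_two_mul_mem hi)
      -- Gram–Schmidt with denominators cleared: `y x` is `d` times the component of `x` orthogonal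
      -- to the system.
      let y : W →ₗ[R] W := d • LinearMap.id - ∑ i,
        (∏ j ∈ Finset.univ.erase i, (2 * Q (w j))) • (Q.polarBilin (w i)).smulRight (w i)
      have hy : ∀ x j, QuadraticMap.polar Q (y x) (w j) = 0 := by
        intro x j
        change Q.polarBilin (y x) (w j) = 0
        simp only [y, LinearMap.sub_apply, LinearMap.smul_apply, LinearMap.sum_apply,
          LinearMap.id_apply, map_sub, map_sum, map_smul, LinearMap.smulRight_apply]
        rw [Finset.sum_eq_single j]
        · simp only [QuadraticMap.polarBilin_apply_apply, QuadraticMap.polar_self, d]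
          rw [← Finset.mul_prod_erase _ _ (Finset.mem_univ j), QuadraticMap.polar_comm Q x]
          simp only [smul_eq_mul, nsmul_eq_mul]
          push_cast
          ring
        · intro i _ hij
          simp [hw.orthogonal i j hij]
        · simp
      have hyx : ∀ x, d • x - y x ∈ Submodule.span R (Set.range w) := by
        intro x
        simp only [y, LinearMap.sub_apply, LinearMap.smul_apply, LinearMap.sum_apply,
          LinearMap.id_apply, LinearMap.smulRight_apply, sub_sub_cancel]
        exact Submodule.sum_mem _ fun i _ => Submodule.smul_mem _ _
          (Submodule.smul_mem _ _ (Submodule.subset_span ⟨i, rfl⟩))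
      by_cases hx : ∃ x, Q (y x) ∉ p
      · obtain ⟨x, hx⟩ := hx
        refine ⟨Fin.cons (y x) w, ⟨fun i j hij => ?_, fun i => ?_⟩⟩
        · induction i using Fin.cases with
          | zero =>
            induction j using Fin.cases with
            | zero => exact absurd rfl hij
            | succ j => exact hy x j
          | succ i =>
            induction j using Fin.cases with
            | zero => rw [QuadraticMap.polar_comm]; exact hy x i
            | succ j => exact hw.orthogonal i j fun h => hij (congrArg _ h)
        · refine Fin.cases hx (fun i => ?_) i
          exact hw.notMem i
      · push Not at hx
        exfalso
        -- No vector can be added, so Q is zero modulo `p` on all `y x`. By polarisation they pair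
        -- into `p` with each other, then with everything, since `d • z - y z` lies in the span of
        -- `w`. Nondegeneracy puts them in `p • ⊤`.
        have h1 : ∀ x z, QuadraticMap.polar Q (y x) (y z) ∈ p := fun x z => by
          rw [QuadraticMap.polar, ← map_add]
          exact sub_mem (sub_mem (hx _) (hx _)) (hx _)
        have h2 : ∀ x z, QuadraticMap.polar Q (y x) z ∈ p := by
          intro x z
          have h3 : ∀ v ∈ Submodule.span R (Set.range w), Q.polarBilin (y x) v = 0 := by
            intro v hv
            have : Submodule.span R (Set.range w) ≤ LinearMap.ker (Q.polarBilin (y x)) := by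
              rw [Submodule.span_le]
              rintro _ ⟨j, rfl⟩
              exact hy x j
            exact this hv
          have h4 := h3 _ (hyx z)
          rw [map_sub, map_smul, sub_eq_zero] at h4
          refine (Ideal.IsPrime.mem_or_mem (I := p) inferInstance (?_ : d * _ ∈ p)).resolve_left hd
          have := h1 x z
          rw [← QuadraticMap.polarBilin_apply_apply, ← h4] at this
          exact this
        have h5 : ∀ x, d • x ∈ Submodule.span R (Set.range w) ⊔ p • (⊤ : Submodule R W) := by
          intro x
          have := add_mem (Submodule.mem_sup_left (T := p • (⊤ : Submodule R W)) (hyx x))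
            (Submodule.mem_sup_right (mem_smul_top_of_polar_mem hQ (h2 x)))
          rwa [sub_add_cancel] at this
        have h6 : (⊤ : Submodule R (W ⧸ Submodule.span R (Set.range w))) ≤ p • ⊤ := by
          intro z _
          obtain ⟨x, rfl⟩ := Submodule.mkQ_surjective _ z
          have h7 : ∀ x, Submodule.mkQ (Submodule.span R (Set.range w)) (d • x) ∈
              p • (⊤ : Submodule R (W ⧸ Submodule.span R (Set.range w))) := by
            intro x
            obtain ⟨a, ha, b, hb, hab⟩ := Submodule.mem_sup.1 (h5 x)
            rw [← hab, map_add, Submodule.mkQ_apply, (Submodule.Quotient.mk_eq_zero _).2 ha,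
              zero_add]
            have := Submodule.mem_map_of_mem (f := Submodule.mkQ (Submodule.span R (Set.range w))) hb
            rw [Submodule.map_smul''] at this
            exact Submodule.smul_mono le_rfl le_top this
          obtain ⟨e, i, hi, he⟩ := Ideal.IsMaximal.exists_inv (I := p) inferInstance hd
          rw [← one_smul R x, ← he, add_smul, map_add, mul_smul, map_smul, map_smul]
          exact add_mem (Submodule.smul_mem _ _ (h7 x)) (by
            rw [map_smul]; exact Submodule.smul_mem_smul hi Submodule.mem_top)
        -- Nakayama for the quotient by the span of `w`: some `r` congruent to 1 modulo `p` kills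
        -- it, so `w` spans near `p` after all.
        obtain ⟨r, hr, hr'⟩ := Submodule.exists_sub_one_mem_and_smul_eq_zero_of_fg_of_le_smul p
          (⊤ : Submodule R (W ⧸ Submodule.span R (Set.range w))) Module.Finite.fg_top h6
        obtain ⟨x, hx⟩ := hcon l w r hw (fun h => Ideal.IsPrime.ne_top (I := p) inferInstance
          ((Ideal.eq_top_iff_one _).2 (by simpa using sub_mem h hr)))
        apply hx
        rw [← Submodule.Quotient.mk_eq_zero]
        exact hr' (Submodule.Quotient.mk x) trivial
  obtain ⟨w, hw⟩ := hP (Module.finrank (R ⧸ p) (W ⧸ p • (⊤ : Submodule R W)) + 1)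
  let _ : Field (R ⧸ p) := Ideal.Quotient.field p
  have : Module.Finite (R ⧸ p) (W ⧸ p • (⊤ : Submodule R W)) :=
    Module.Finite.of_restrictScalars_finite R _ _
  have := hw.linearIndependent.fintype_card_le_finrank
  simp at this

end OrthogonalSystem

/-! ### Splitting of surjections of modules over a nondegenerate Clifford algebra -/

section Averaging

variable {R W : Type u} [CommRing R] [AddCommGroup W] [Module R W] {Q : QuadraticForm R W}
  {M X : Type u} [AddCommGroup M] [Module R M] [Module (CliffordAlgebra Q) M]
  [IsScalarTower R (CliffordAlgebra Q) M] [AddCommGroup X] [Module R X]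
  [Module (CliffordAlgebra Q) X] [IsScalarTower R (CliffordAlgebra Q) X]

/-- The average `v φ v + Q(v) φ` of a linear map between Clifford modules. -/
def cliffordAverage (v : W) (φ : M →ₗ[R] X) : M →ₗ[R] X :=
  Q v • φ + Algebra.lsmul R R X (CliffordAlgebra.ι Q v) ∘ₗ φ ∘ₗ
    Algebra.lsmul R R M (CliffordAlgebra.ι Q v)

lemma cliffordAverage_apply (v : W) (φ : M →ₗ[R] X) (m : M) :
    cliffordAverage (Q := Q) v φ m = Q v • φ m +
      CliffordAlgebra.ι Q v • φ (CliffordAlgebra.ι Q v • m) := rfl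

omit [IsScalarTower R (CliffordAlgebra Q) M] in
lemma ι_smul_ι_smul [IsScalarTower R (CliffordAlgebra Q) M] (v : W) (m : M) :
    CliffordAlgebra.ι Q v • CliffordAlgebra.ι Q v • m = Q v • m := by
  rw [← mul_smul, CliffordAlgebra.ι_sq_scalar, algebraMap_smul]

omit [IsScalarTower R (CliffordAlgebra Q) M] [Module R M] in
lemma ι_smul_ι_smul_of_polar_eq_zero {v w : W} (h : QuadraticMap.polar Q v w = 0) (m : M) :
    CliffordAlgebra.ι Q v • CliffordAlgebra.ι Q w • m =
      -(CliffordAlgebra.ι Q w • CliffordAlgebra.ι Q v • m) := by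
  have := CliffordAlgebra.ι_mul_ι_add_swap (Q := Q) v w
  rw [h, map_zero] at this
  rw [← mul_smul, ← mul_smul, ← neg_smul, eq_neg_of_add_eq_zero_left this]

/-- As v² = Q(v), multiplication by `v` on either side interchanges the two terms of the average. -/
lemma cliffordAverage_ι_smul (v : W) (φ : M →ₗ[R] X) (m : M) :
    cliffordAverage (Q := Q) v φ (CliffordAlgebra.ι Q v • m) =
      CliffordAlgebra.ι Q v • cliffordAverage (Q := Q) v φ m := by
  rw [cliffordAverage_apply, cliffordAverage_apply, ι_smul_ι_smul, smul_add, ι_smul_ι_smul,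
    φ.map_smul, add_comm]

/-- `w` anticommutes with both outer factors `v`, and the two signs cancel. -/
lemma cliffordAverage_ι_smul_of_polar_eq_zero {v w : W} (h : QuadraticMap.polar Q v w = 0)
    (φ : M →ₗ[R] X)
    (hφ : ∀ m, φ (CliffordAlgebra.ι Q w • m) = CliffordAlgebra.ι Q w • φ m) (m : M) :
    cliffordAverage (Q := Q) v φ (CliffordAlgebra.ι Q w • m) =
      CliffordAlgebra.ι Q w • cliffordAverage (Q := Q) v φ m := by
  rw [cliffordAverage_apply, cliffordAverage_apply, hφ, ι_smul_ι_smul_of_polar_eq_zero h,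
    map_neg, hφ, smul_neg, ι_smul_ι_smul_of_polar_eq_zero h, neg_neg, smul_add]
  rw [smul_comm (Q v)]

lemma comp_cliffordAverage (v : W) (φ : M →ₗ[R] X) (g : X →ₗ[CliffordAlgebra Q] M) {c : R}
    (hφ : ∀ m, g (φ m) = c • m) (m : M) :
    g (cliffordAverage (Q := Q) v φ m) = (2 * Q v * c) • m := by
  rw [cliffordAverage_apply, map_add, g.map_smul, hφ, g.map_smul_of_tower, hφ,
    smul_comm (CliffordAlgebra.ι Q v) c, ι_smul_ι_smul, smul_smul, smul_smul, ← add_smul]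
  congr 1; ring

/-- Average over the members one after the other: orthogonality preserves the commutation already
obtained. Each step costs a factor `2 * Q (w i)`, which is a unit modulo `p`. -/
lemma exists_commute_orthogonalSystem (g : X →ₗ[CliffordAlgebra Q] M) (s : M →ₗ[R] X)
    (hs : ∀ m, g (s m) = m) {p : Ideal R} {l : ℕ} {w : Fin l → W}
    (hw : IsOrthogonalSystem Q p w) :
    ∃ φ : M →ₗ[R] X, (∀ m, g (φ m) = (∏ i, (2 * Q (w i))) • m) ∧
      ∀ i m, φ (CliffordAlgebra.ι Q (w i) • m) = CliffordAlgebra.ι Q (w i) • φ m := by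
  classical
  have : ∀ t : Finset (Fin l), ∃ φ : M →ₗ[R] X, (∀ m, g (φ m) = (∏ i ∈ t, (2 * Q (w i))) • m) ∧
      ∀ i ∈ t, ∀ m, φ (CliffordAlgebra.ι Q (w i) • m) = CliffordAlgebra.ι Q (w i) • φ m := by
    intro t
    induction t using Finset.induction_on with
    | empty => exact ⟨s, by simpa using hs, by simp⟩
    | insert a t ha ih =>
      obtain ⟨φ, h1, h2⟩ := ih
      refine ⟨cliffordAverage (Q := Q) (w a) φ, fun m => ?_, fun i hi m => ?_⟩
      · rw [comp_cliffordAverage _ _ _ h1, Finset.prod_insert ha]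
      · rcases Finset.mem_insert.1 hi with rfl | hi
        · exact cliffordAverage_ι_smul _ _ _
        · exact cliffordAverage_ι_smul_of_polar_eq_zero
            (hw.orthogonal a i fun h => ha (by rwa [h])) _ (h2 i hi) m
  obtain ⟨φ, h1, h2⟩ := this Finset.univ
  exact ⟨φ, h1, fun i => h2 i (Finset.mem_univ i)⟩

variable [Invertible (2 : R)] [Module.Finite R W] [Module.Projective R W]

/-- A surjection of modules over a nondegenerate Clifford algebra splits if it splits over the
base ring. -/
theorem exists_clifford_section (hQ : Function.Bijective Q.polarBilin)
    (g : X →ₗ[CliffordAlgebra Q] M) (s : M →ₗ[R] X) (hs : ∀ m, g (s m) = m) :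
    ∃ ψ : M →ₗ[CliffordAlgebra Q] X, ∀ m, g (ψ m) = m := by
  let C (ψ : M →ₗ[R] X) : Prop :=
    ∀ (v : W) m, ψ (CliffordAlgebra.ι Q v • m) = CliffordAlgebra.ι Q v • ψ m
  -- The scalars whose multiplication on `M` lifts through `g` Clifford-linearly. The claim is that
  -- 1 is one of them, and it is enough that no maximal ideal contains them all.
  let J : Ideal R :=
    { carrier := {r | ∃ ψ : M →ₗ[R] X, C ψ ∧ ∀ m, g (ψ m) = r • m}
      add_mem' := by
        rintro a b ⟨ψ, h1, h2⟩ ⟨ψ', h1', h2'⟩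
        exact ⟨ψ + ψ', fun v m => by simp [h1 v, h1' v], fun m => by simp [h2, h2', add_smul]⟩
      zero_mem' := ⟨0, fun v m => by simp, fun m => by simp⟩
      smul_mem' := by
        rintro c a ⟨ψ, h1, h2⟩
        refine ⟨c • ψ, fun v m => ?_, fun m => ?_⟩
        · rw [LinearMap.smul_apply, LinearMap.smul_apply, h1 v, smul_comm]
        · rw [LinearMap.smul_apply, LinearMap.map_smul_of_tower, h2, smul_smul, smul_eq_mul] }
  have hJ : J = ⊤ := by
    by_contra hJ
    obtain ⟨p, hp, hJp⟩ := Ideal.exists_le_maximal J hJ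
    obtain ⟨l, w, r, hw, hr, hspan⟩ := exists_orthogonalSystem hQ (p := p)
    obtain ⟨φ, h1, h2⟩ := exists_commute_orthogonalSystem g s hs hw
    -- The average commutes with the span of the system only; multiplied by `r`, which carries every
    -- vector into that span, it commutes with all vectors.
    have hmem : r * ∏ i, (2 * Q (w i)) ∈ J := by
      refine ⟨r • φ, fun v m => ?_, fun m => ?_⟩
      · have h3 : ∀ v ∈ Submodule.span R (Set.range w),
            φ (CliffordAlgebra.ι Q v • m) = CliffordAlgebra.ι Q v • φ m := by
          intro v hv
          induction hv using Submodule.span_induction with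
          | mem x hx => obtain ⟨i, rfl⟩ := hx; exact h2 i m
          | zero => simp
          | add x y _ _ hx hy => rw [map_add, add_smul, map_add, hx, hy, add_smul]
          | smul c x _ hx => rw [LinearMap.map_smul, smul_assoc, φ.map_smul, hx, smul_assoc]
        have h4 := h3 _ (hspan v)
        rw [LinearMap.map_smul, smul_assoc, φ.map_smul, smul_assoc] at h4
        rw [LinearMap.smul_apply, h4, LinearMap.smul_apply, smul_comm]
      · rw [LinearMap.smul_apply, LinearMap.map_smul_of_tower, h1, smul_smul]
    rcases Ideal.IsPrime.mem_or_mem (I := p) inferInstance (hJp hmem) with h | h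
    · exact hr h
    · rw [Ideal.IsPrime.prod_mem_iff] at h
      obtain ⟨i, _, hi⟩ := h
      exact hw.notMem i (mul_eq_of_two_mul_mem hi)
  obtain ⟨ψ, h1, h2⟩ := (Ideal.eq_top_iff_one J).1 hJ
  refine ⟨{ ψ with map_smul' := fun a m => ?_ }, fun m => (h2 m).trans (one_smul R m)⟩
  change ψ (a • m) = a • ψ m
  induction a using CliffordAlgebra.induction generalizing m with
  | algebraMap r => rw [algebraMap_smul, algebraMap_smul, map_smul]
  | ι w => exact h1 w m
  | mul a b ha hb => rw [mul_smul, mul_smul, ha, hb]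
  | add a b ha hb => rw [add_smul, add_smul, map_add, ha, hb]

end Averaging

/-! ### Finitely generated projective modules over a Clifford algebra -/

/-- A retraction of a finite free module onto `V` induces one of exterior algebras, and that of the
free module has a finite basis. -/
lemma ExteriorAlgebra.finite_projective {R V : Type u} [CommRing R] [AddCommGroup V] [Module R V]
    [Module.Finite R V] [Module.Projective R V] :
    Module.Finite R (ExteriorAlgebra R V) ∧ Module.Projective R (ExteriorAlgebra R V) := by
  obtain ⟨n, f, g, hf, hg, hfg⟩ := Module.Finite.exists_comp_eq_id_of_projective R V
  let e := (Pi.basisFun R (Fin n)).ExteriorAlgebra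
  have hF : Module.Free R (ExteriorAlgebra R (Fin n → R)) := Module.Free.of_basis e
  have hfin : Module.Finite R (ExteriorAlgebra R (Fin n → R)) := Module.Finite.of_basis e
  have hcomp : (ExteriorAlgebra.map f).toLinearMap ∘ₗ (ExteriorAlgebra.map g).toLinearMap =
      LinearMap.id := by
    have : (ExteriorAlgebra.map f).comp (ExteriorAlgebra.map g) = AlgHom.id R _ := by
      rw [ExteriorAlgebra.map_comp_map, hfg, ExteriorAlgebra.map_id]
    exact congrArg AlgHom.toLinearMap this
  exact ⟨Module.Finite.of_surjective (ExteriorAlgebra.map f).toLinearMap fun x =>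
    ⟨_, LinearMap.congr_fun hcomp x⟩, Module.Projective.of_split _ _ hcomp⟩

section FGP

variable {R W : Type u} [CommRing R] [Invertible (2 : R)] [AddCommGroup W] [Module R W]
  [Module.Finite R W] [Module.Projective R W]

lemma CliffordAlgebra.finite_projective (Q : QuadraticForm R W) :
    Module.Finite R (CliffordAlgebra Q) ∧ Module.Projective R (CliffordAlgebra Q) := by
  obtain ⟨h1, h2⟩ := ExteriorAlgebra.finite_projective (R := R) (V := W)
  exact ⟨Module.Finite.equiv (CliffordAlgebra.equivExterior Q).symm,
    Module.Projective.of_equiv (CliffordAlgebra.equivExterior Q).symm⟩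

lemma Module.Projective.of_tower {R A M : Type*} [CommRing R] [Ring A] [Algebra R A]
    [AddCommGroup M] [Module R M] [Module A M] [IsScalarTower R A M] [Module.Projective R A]
    [Module.Projective A M] : Module.Projective R M := by
  obtain ⟨s, hs⟩ := Module.projective_lifting_property
    (Finsupp.linearCombination A (id : M → M)) LinearMap.id
    (Finsupp.linearCombination_id_surjective _ _)
  have : Module.Projective R (M →₀ A) := by
    classical exact Module.Projective.of_equiv (finsuppLequivDFinsupp (ι := M) (M := A) R).symm
  exact Module.Projective.of_split (s.restrictScalars R)
    ((Finsupp.linearCombination A (id : M → M)).restrictScalars R)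
    (LinearMap.ext fun m => LinearMap.congr_fun hs m)

/-- The free Clifford module on the elements of `M` maps onto `M`. If `M` is projective over `R`
this map splits over `R`, hence by averaging over the Clifford algebra. -/
lemma AlgMod.isFGP_iff {Q : QuadraticForm R W} (hQ : Function.Bijective Q.polarBilin)
    (M : AlgMod R (CliffordAlgebra Q)) :
    M.IsFGP ↔ Module.Finite R M.carrier ∧ Module.Projective R M.carrier := by
  obtain ⟨h1, h2⟩ := CliffordAlgebra.finite_projective Q
  constructor
  · rintro ⟨h3, h4⟩
    exact ⟨Module.Finite.trans (CliffordAlgebra Q) _, Module.Projective.of_tower (A := CliffordAlgebra Q)⟩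
  · rintro ⟨h3, h4⟩
    refine ⟨Module.Finite.of_restrictScalars_finite R _ _, ?_⟩
    let g : (M.carrier →₀ CliffordAlgebra Q) →ₗ[CliffordAlgebra Q] M.carrier :=
      Finsupp.linearCombination _ id
    obtain ⟨s, hs⟩ := Module.projective_lifting_property (g.restrictScalars R) LinearMap.id
      (Finsupp.linearCombination_id_surjective _ _)
    obtain ⟨ψ, hψ⟩ := exists_clifford_section hQ g s fun m => LinearMap.congr_fun hs m
    exact Module.Projective.of_split ψ g (LinearMap.ext hψ)

omit [Module.Finite R W] [Module.Projective R W] in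
lemma polarBilin_prod_stdForm_bijective {Q : QuadraticForm R W}
    (hQ : Function.Bijective Q.polarBilin) (r : ℕ) :
    Function.Bijective (Q.prod (stdForm R r)).polarBilin := by
  have hpol : ∀ w w' : W × (Fin r → R), (Q.prod (stdForm R r)).polarBilin w w' =
      Q.polarBilin w.1 w'.1 + ∑ i, 2 * (w.2 i * w'.2 i) := by
    intro w w'
    simp only [QuadraticMap.polarBilin_apply_apply, QuadraticMap.polar, QuadraticMap.prod_apply,
      stdForm, QuadraticMap.pi_apply, Prod.fst_add, Prod.snd_add, Pi.add_apply,
      QuadraticMap.sq_apply]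
    have : ∑ i, (w.2 i + w'.2 i) * (w.2 i + w'.2 i) = ∑ i, w.2 i * w.2 i +
        ∑ i, w'.2 i * w'.2 i + ∑ i, 2 * (w.2 i * w'.2 i) := by
      rw [← Finset.sum_add_distrib, ← Finset.sum_add_distrib]
      exact Finset.sum_congr rfl fun i _ => by ring
    rw [this]; ring
  constructor
  · rw [injective_iff_map_eq_zero]
    intro w hw
    refine Prod.ext (hQ.1 (LinearMap.ext fun v => ?_)) (funext fun i => ?_)
    · have := LinearMap.congr_fun hw ((v, 0) : W × (Fin r → R))
      rw [hpol] at this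
      simpa using this
    · have := LinearMap.congr_fun hw ((0, Pi.single i (⅟2)) : W × (Fin r → R))
      rw [hpol] at this
      simpa [Pi.single_apply, mul_left_comm (2 : R)] using this
  · intro f
    obtain ⟨a, ha⟩ := hQ.2 (f ∘ₗ LinearMap.inl R _ _)
    refine ⟨(a, fun i => ⅟2 * f (0, Pi.single i 1)), LinearMap.ext fun w => ?_⟩
    rw [hpol, ha]
    have h1 : w = LinearMap.inl R _ _ w.1 + ∑ i, w.2 i • ((0, Pi.single i 1) : W × (Fin r → R)) := by
      refine Prod.ext ?_ ?_
      · simp [Prod.fst_sum]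
      · simp only [LinearMap.inl_apply, Prod.snd_add, zero_add, Prod.snd_sum, Prod.smul_snd]
        exact pi_eq_sum_univ' w.2
    conv_rhs => rw [h1, map_add, map_sum]
    congr 1
    refine Finset.sum_congr rfl fun i _ => ?_
    rw [map_smul, smul_eq_mul, ← mul_assoc, ← mul_assoc, mul_invOf_self, one_mul, mul_comm]

lemma GrMod.isFGP_iff {Q : QuadraticForm R W} (hQ : Function.Bijective Q.polarBilin)
    (M : GrMod Q) :
    M.IsFGP ↔ Module.Finite R M.carrier ∧ Module.Projective R M.carrier :=
  AlgMod.isFGP_iff (polarBilin_prod_stdForm_bijective hQ 1) M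

end FGP

/-! ### The orientation element of the Clifford algebra -/

section OrthogonalProducts

variable {R V : Type u} [CommRing R] [AddCommGroup V] [Module R V] {Q : QuadraticForm R V}

lemma ι_mul_ι_of_polar_eq_zero {v w : V} (h : QuadraticMap.polar Q v w = 0) :
    CliffordAlgebra.ι Q v * CliffordAlgebra.ι Q w =
      -(CliffordAlgebra.ι Q w * CliffordAlgebra.ι Q v) := by
  have := CliffordAlgebra.ι_mul_ι_add_swap (Q := Q) v w
  rw [h, map_zero] at this
  exact eq_neg_of_add_eq_zero_left this

lemma prod_mul_ι_of_orthogonal {v : V} {L : List V} (h : ∀ w ∈ L, QuadraticMap.polar Q v w = 0) :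
    (L.map (CliffordAlgebra.ι Q)).prod * CliffordAlgebra.ι Q v =
      (-1) ^ L.length * (CliffordAlgebra.ι Q v * (L.map (CliffordAlgebra.ι Q)).prod) := by
  induction L with
  | nil => simp
  | cons a L ih =>
    rw [List.map_cons, List.prod_cons, mul_assoc, ih fun w hw => h w (List.mem_cons_of_mem _ hw),
      List.length_cons, pow_succ]
    rw [← mul_assoc (CliffordAlgebra.ι Q v) (CliffordAlgebra.ι Q a),
      ι_mul_ι_of_polar_eq_zero (h a List.mem_cons_self), ← mul_assoc,
      ((Commute.neg_one_right (CliffordAlgebra.ι Q a)).pow_right L.length).eq]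
    simp only [mul_assoc, neg_mul, mul_neg, one_mul, neg_neg]

/-- `v` commutes with its own occurrence and anticommutes with the other factors. -/
lemma ι_mul_prod_of_mem {v : V} {L : List V}
    (hL : L.Pairwise fun v w => QuadraticMap.polar Q v w = 0) (hv : v ∈ L) :
    CliffordAlgebra.ι Q v * (L.map (CliffordAlgebra.ι Q)).prod =
      (-1) ^ (L.length + 1) * ((L.map (CliffordAlgebra.ι Q)).prod * CliffordAlgebra.ι Q v) := by
  induction L with
  | nil => simp at hv
  | cons a L ih =>
    rw [List.pairwise_cons] at hL
    rw [List.map_cons, List.prod_cons, List.length_cons]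
    rcases List.mem_cons.1 hv with rfl | hv
    · rw [mul_assoc _ _ (CliffordAlgebra.ι Q v), prod_mul_ι_of_orthogonal hL.1,
        ← mul_assoc _ ((-1) ^ L.length) (CliffordAlgebra.ι Q v * _),
        ((Commute.neg_one_right (CliffordAlgebra.ι Q v)).pow_right L.length).eq,
        mul_assoc ((-1) ^ L.length), ← mul_assoc ((-1) ^ (L.length + 1 + 1)), ← pow_add,
        Even.neg_one_pow ⟨L.length + 1, by ring⟩, one_mul]
    · rw [← mul_assoc, ι_mul_ι_of_polar_eq_zero (by rw [QuadraticMap.polar_comm]; exact hL.1 v hv),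
        neg_mul, mul_assoc, ih hL.2 hv, ← mul_assoc _ ((-1) ^ (L.length + 1)),
        ((Commute.neg_one_right (CliffordAlgebra.ι Q a)).pow_right (L.length + 1)).eq]
      simp only [pow_succ, mul_assoc, neg_mul, mul_neg, mul_one]

/-- Bringing each factor of the second copy next to its twin in the first exchanges every pair of
distinct factors once, whence the binomial exponent. -/
lemma prod_mul_prod_of_orthogonal {L : List V}
    (hL : L.Pairwise fun v w => QuadraticMap.polar Q v w = 0) :
    (L.map (CliffordAlgebra.ι Q)).prod * (L.map (CliffordAlgebra.ι Q)).prod =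
      algebraMap R _ ((-1) ^ (L.length.choose 2) * (L.map Q).prod) := by
  induction L with
  | nil => simp
  | cons a L ih =>
    rw [List.pairwise_cons] at hL
    rw [List.map_cons, List.prod_cons, List.length_cons, List.map_cons, List.prod_cons, mul_assoc,
      ← mul_assoc (List.map _ L).prod, prod_mul_ι_of_orthogonal hL.1, ← mul_assoc, ← mul_assoc,
      ((Commute.neg_one_right (CliffordAlgebra.ι Q a)).pow_right L.length).eq,
      mul_assoc ((-1) ^ L.length), ← mul_assoc (CliffordAlgebra.ι Q a), CliffordAlgebra.ι_sq_scalar,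
      mul_assoc, mul_assoc, ih hL.2, Nat.choose_succ_succ' _ 1, Nat.choose_one_right, pow_add]
    simp only [map_mul, map_pow, map_neg, map_one, mul_assoc]
    rw [← mul_assoc (algebraMap R _ (Q a)), Algebra.commutes]
    simp only [mul_assoc]

open CliffordAlgebra in
lemma contractLeft_prod_eq_zero {d : Module.Dual R V} {L : List V} (h : ∀ w ∈ L, d w = 0) :
    contractLeft d (L.map (ι Q)).prod = 0 := by
  induction L with
  | nil => simp
  | cons a L ih =>
    rw [List.map_cons, List.prod_cons, contractLeft_ι_mul, h a List.mem_cons_self,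
      ih fun w hw => h w (List.mem_cons_of_mem _ hw)]
    simp

/-- Under the identification, Clifford multiplication by `a` is the exterior product with `a`
corrected by a contraction against `a`; the contraction vanishes because the other factors are
orthogonal to `a`. -/
lemma equivExterior_prod_of_orthogonal [Invertible (2 : R)] {L : List V}
    (hL : L.Pairwise fun v w => QuadraticMap.polar Q v w = 0) :
    CliffordAlgebra.equivExterior Q (L.map (CliffordAlgebra.ι Q)).prod =
      (L.map (ExteriorAlgebra.ι R)).prod := by
  induction L with
  | nil => exact CliffordAlgebra.changeForm_one CliffordAlgebra.changeForm.associated_neg_proof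
  | cons a L ih =>
    rw [List.pairwise_cons] at hL
    rw [List.map_cons, List.prod_cons, List.map_cons, List.prod_cons, ← ih hL.2]
    have h0 : CliffordAlgebra.contractLeft (QuadraticMap.associated (-Q) a)
        (CliffordAlgebra.equivExterior Q (L.map (CliffordAlgebra.ι Q)).prod) = 0 := by
      refine (congrArg _ (ih hL.2)).trans (contractLeft_prod_eq_zero fun w hw => ?_)
      have := hL.1 w hw
      rw [QuadraticMap.polar] at this
      rw [map_neg, LinearMap.neg_apply, LinearMap.neg_apply, QuadraticMap.associated_apply, this,
        smul_zero, neg_zero]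
    exact (CliffordAlgebra.changeForm_ι_mul
      CliffordAlgebra.changeForm.associated_neg_proof a _).trans
      ((congrArg₂ HSub.hSub rfl h0).trans (sub_zero _))

end OrthogonalProducts

/-- Over the residue field the system is independent, by pairing with its members, and spans, as `s`
becomes invertible. So it is a basis of the fibre. -/
lemma IsOrthogonalSystem.eq_rankAtStalk {R W : Type u} [CommRing R] [Invertible (2 : R)]
    [AddCommGroup W] [Module R W] [Module.Finite R W] [Module.Projective R W]
    {Q : QuadraticForm R W} {p : Ideal R} [hp : p.IsMaximal] {l : ℕ} {w : Fin l → W}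
    (hw : IsOrthogonalSystem Q p w) {s : R} (hs : s ∉ p)
    (hspan : ∀ x, s • x ∈ Submodule.span R (Set.range w)) :
    l = Module.rankAtStalk W ⟨p, hp.isPrime⟩ := by
  rw [← Ideal.finrank_fiber_eq_rankAtStalk]
  let κ := p.ResidueField
  have hne : ∀ r : R, r ∉ p → algebraMap R κ r ≠ 0 := fun r hr h =>
    hr (by rwa [Ideal.algebraMap_residueField_eq_zero] at h)
  have h1 : LinearIndependent κ fun i => (1 : κ) ⊗ₜ[R] w i := by
    rw [Fintype.linearIndependent_iff]
    intro c hc j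
    let F : κ ⊗[R] W →ₗ[κ] κ := LinearMap.liftBaseChange κ
      ((Algebra.linearMap R κ) ∘ₗ (Q.polarBilin.flip (w j)))
    have := congrArg F hc
    rw [map_sum, map_zero, Finset.sum_eq_single j] at this
    · have hF : F ((1 : κ) ⊗ₜ[R] w j) = algebraMap R κ (2 * Q (w j)) := by
        simp [F, QuadraticMap.polar_self]
      rw [map_smul, hF, smul_eq_mul] at this
      exact (mul_eq_zero.1 this).resolve_right
        (hne _ fun h => hw.notMem j (mul_eq_of_two_mul_mem h))
    · intro i _ hij
      simp [F, hw.orthogonal i j hij]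
    · simp
  have h2 : ⊤ ≤ Submodule.span κ (Set.range fun i => (1 : κ) ⊗ₜ[R] w i) := by
    rintro x -
    induction x with
    | zero => exact zero_mem _
    | add x y hx hy => exact add_mem hx hy
    | tmul c v =>
      have h3 : ∀ y ∈ Submodule.span R (Set.range w), (1 : κ) ⊗ₜ[R] y ∈
          Submodule.span κ (Set.range fun i => (1 : κ) ⊗ₜ[R] w i) := by
        intro y hy
        induction hy using Submodule.span_induction with
        | mem x hx => obtain ⟨i, rfl⟩ := hx; exact Submodule.subset_span ⟨i, rfl⟩
        | zero => rw [TensorProduct.tmul_zero]; exact zero_mem _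
        | add x y _ _ hx hy => rw [TensorProduct.tmul_add]; exact add_mem hx hy
        | smul a x _ hx =>
          rw [TensorProduct.tmul_smul, algebra_compatible_smul κ a]
          exact Submodule.smul_mem _ _ hx
      have h4 : c ⊗ₜ[R] v = (c * (algebraMap R κ s)⁻¹) • ((1 : κ) ⊗ₜ[R] (s • v)) := by
        rw [TensorProduct.tmul_smul, algebra_compatible_smul κ s, smul_smul, mul_assoc,
          inv_mul_cancel₀ (hne s hs), mul_one, TensorProduct.smul_tmul', smul_eq_mul, mul_one]
      rw [h4]
      exact Submodule.smul_mem _ _ (h3 _ (hspan v))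
  have := Module.finrank_eq_card_basis (Module.Basis.mk h1 h2)
  rw [Fintype.card_fin] at this
  exact this.symm

/-! ### From an orientation to a central-type involution in the even Clifford algebra. -/

section Oriented

variable {R V : Type u} [CommRing R] [AddCommGroup V] [Module R V]

/-- A nondegenerate form whose Clifford algebra contains an even involution anticommuting with
vectors. -/
structure QuadraticForm.IsOriented (Q : QuadraticForm R V) : Prop where
  nondegenerate : Function.Bijective Q.polarBilin
  exists_involution : ∃ u : CliffordAlgebra Q, u * u = 1 ∧ CliffordAlgebra.involute u = u ∧
    ∀ v, u * CliffordAlgebra.ι Q v = -(CliffordAlgebra.ι Q v * u)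

variable [Invertible (2 : R)] [Module.Finite R V] [Module.Projective R V]

omit [Invertible (2 : R)] in
/-- An element of an `R`-module vanishes if it is killed, near each maximal ideal, by an element
outside the ideal. -/
lemma eq_zero_of_forall_isMaximal {M : Type*} [AddCommGroup M] [Module R M] {x : M}
    (h : ∀ p : Ideal R, p.IsMaximal → ∃ t : R, t ∉ p ∧ t • x = 0) : x = 0 := by
  rw [← Ideal.torsionOf_eq_top_iff R]
  by_contra hx
  obtain ⟨p, hp, hle⟩ := Ideal.exists_le_maximal _ hx
  obtain ⟨t, ht, htx⟩ := h p hp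
  exact ht (hle ((Ideal.mem_torsionOf_iff x t).2 htx))

/-- An oriented quadratic module of even rank is oriented by an element of its Clifford algebra. -/
theorem QuadOrientation.isOriented {q : QuadraticForm R V} {m : ℕ} (o : QuadOrientation q m)
    (hq : Function.Bijective q.polarBilin)
    (hrank : ∀ p : PrimeSpectrum R, Module.rankAtStalk V p = 2 * m) : q.IsOriented := by
  refine ⟨hq, ?_⟩
  -- The generator of the top exterior power with coordinate 1, seen in the Clifford algebra. Near
  -- each maximal ideal a multiple `t • u` is the product of an orthogonal basis, `t` being the
  -- coordinate of its exterior product, and the properties of `u` are checked there.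
  let u : CliffordAlgebra q := (CliffordAlgebra.equivExterior q).symm (o.equiv.symm 1 : _)
  have hloc : ∀ p : Ideal R, p.IsMaximal → ∃ (t s : R) (L : List V), t ∉ p ∧ s ∉ p ∧
      L.length = 2 * m ∧ (L.Pairwise fun v w => QuadraticMap.polar q v w = 0) ∧
      (∀ x, s • x ∈ Submodule.span R {v | v ∈ L}) ∧ t • u = (L.map (CliffordAlgebra.ι q)).prod ∧
      (t * t = (-1) ^ m * (L.map q).prod) := by
    intro p hp
    obtain ⟨l, w, s, hw, hs, hspan⟩ := exists_orthogonalSystem hq (p := p)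
    have hl := hw.eq_rankAtStalk hs hspan
    rw [hrank] at hl
    subst hl
    -- The Gram matrix of an orthogonal system is diagonal, so the isometry computes t² as (−1)^m
    -- times the product of the values of `q`; in particular `t` is not in `p`.
    have ht : o.equiv (exteriorPower.ιMulti R (2 * m) w) *
        o.equiv (exteriorPower.ιMulti R (2 * m) w) = (-1) ^ m * ((List.ofFn w).map q).prod := by
      rw [o.isometry]
      congr 1
      rw [Matrix.det_of_isUpperTriangular, List.map_ofFn, List.prod_ofFn]
      · refine Finset.prod_congr rfl fun i _ => ?_
        exact QuadraticMap.associated_eq_self_apply R q (w i)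
      · intro i j hij
        have := hw.orthogonal i j hij.ne'
        rw [QuadraticMap.polar] at this
        simp [QuadraticMap.associated_apply, this]
    have hpair : (List.ofFn w).Pairwise fun v w => QuadraticMap.polar q v w = 0 := by
      rw [List.pairwise_ofFn]
      exact fun i j hij => hw.orthogonal i j hij.ne
    refine ⟨o.equiv (exteriorPower.ιMulti R (2 * m) w), s, List.ofFn w, ?_, hs, List.length_ofFn,
      hpair, fun x => ?_, ?_, ht⟩
    · intro h
      have h1 := p.mul_mem_left (o.equiv (exteriorPower.ιMulti R (2 * m) w)) h
      rw [ht] at h1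
      have h2 := p.mul_mem_left ((-1) ^ m) h1
      rw [← mul_assoc, ← mul_pow, neg_one_mul, neg_neg, one_pow, one_mul, List.map_ofFn,
        List.prod_ofFn, Ideal.IsPrime.prod_mem_iff] at h2
      obtain ⟨i, _, hi⟩ := h2
      exact hw.notMem i hi
    · have : {v | v ∈ List.ofFn w} = Set.range w := by ext; simp [List.mem_ofFn]
      rw [this]
      exact hspan x
    · apply (CliffordAlgebra.equivExterior q).injective
      rw [map_smul, LinearEquiv.apply_symm_apply, equivExterior_prod_of_orthogonal hpair,
        List.map_ofFn, ← Submodule.coe_smul, ← map_smul, smul_eq_mul, mul_one,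
        LinearEquiv.symm_apply_apply]
      rfl
  refine ⟨u, ?_, ?_, fun v => ?_⟩
  · rw [← sub_eq_zero]
    refine eq_zero_of_forall_isMaximal (R := R) fun p hp => ?_
    obtain ⟨t, s, L, ht, hs, hlen, hL, hspan, hu, htt⟩ := hloc p hp
    refine ⟨t * t, fun h => ht ((Ideal.IsPrime.mem_or_mem hp.isPrime h).elim id id), ?_⟩
    rw [smul_sub, ← smul_mul_smul_comm, hu, prod_mul_prod_of_orthogonal hL, htt, hlen,
      Algebra.algebraMap_eq_smul_one, sub_eq_zero]
    congr 2
    rcases m with _ | m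
    · simp
    -- The binomial coefficient has the parity of half the rank, so its sign is the (−1)^m of the
    -- discriminant.
    · have : (2 * (m + 1)).choose 2 = (m + 1) + 2 * (m * (m + 1)) := by
        rw [Nat.choose_two_right]
        refine Nat.div_eq_of_eq_mul_left two_pos ?_
        rw [show 2 * (m + 1) - 1 = 2 * m + 1 by omega]
        ring
      rw [this, pow_add, pow_mul]
      simp
  · rw [← sub_eq_zero]
    refine eq_zero_of_forall_isMaximal (R := R) fun p hp => ?_
    obtain ⟨t, s, L, ht, hs, hlen, hL, hspan, hu, htt⟩ := hloc p hp
    refine ⟨t, ht, ?_⟩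
    rw [smul_sub, ← map_smul, hu, CliffordAlgebra.involute_prod_map_ι, hlen]
    simp
  · rw [eq_neg_iff_add_eq_zero]
    refine eq_zero_of_forall_isMaximal (R := R) fun p hp => ?_
    obtain ⟨t, s, L, ht, hs, hlen, hL, hspan, hu, htt⟩ := hloc p hp
    refine ⟨t * s, fun h => (Ideal.IsPrime.mem_or_mem hp.isPrime h).elim ht hs, ?_⟩
    have h3 : ∀ x ∈ Submodule.span R {v | v ∈ L}, (t • u) * CliffordAlgebra.ι q x +
        CliffordAlgebra.ι q x * (t • u) = 0 := by
      intro x hx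
      induction hx using Submodule.span_induction with
      | mem x hx =>
        -- The evenness of the rank makes this sign −1.
        rw [hu, ι_mul_prod_of_mem hL hx, hlen]
        simp [pow_succ]
      | zero => simp
      | add x y _ _ hx hy =>
        rw [map_add, mul_add, add_mul, add_add_add_comm, hx, hy, add_zero]
      | smul a x _ hx => rw [map_smul, mul_smul_comm, smul_mul_assoc a, ← smul_add, hx, smul_zero]
    have := h3 _ (hspan v)
    rw [map_smul, smul_mul_smul_comm, smul_mul_smul_comm, mul_comm s, ← smul_add] at this
    exact this

omit [Invertible (2 : R)] [Module.Finite R V] [Module.Projective R V] in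
lemma polarBilin_nsmul_bijective {q : QuadraticForm R V} (hq : Function.Bijective q.polarBilin)
    {j : ℕ} (hj : IsUnit (j : R)) : Function.Bijective (j • q).polarBilin := by
  have h : ∀ x, (j • q).polarBilin x = (j : R) • q.polarBilin x := fun x => by
    ext y
    simp [QuadraticMap.polar]
    ring
  have : ⇑(j • q).polarBilin = (fun f => (j : R) • f) ∘ q.polarBilin := funext h
  rw [this]
  refine Function.Bijective.comp ⟨fun f g hfg => ?_, fun f => ⟨Ring.inverse (j : R) • f, ?_⟩⟩ hq
  · have := congrArg (fun f => Ring.inverse (j : R) • f) hfg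
    simpa [smul_smul, Ring.inverse_mul_cancel _ hj] using this
  · simp [smul_smul, Ring.mul_inverse_cancel _ hj]

omit [Module.Finite R V] [Module.Projective R V] in
/-- A multiple of an oriented form by a unit is oriented. -/
def QuadOrientation.nsmul {q : QuadraticForm R V} {m : ℕ} (o : QuadOrientation q m) {j : ℕ}
    (hj : IsUnit (j : R)) : QuadOrientation (j • q) m where
  -- Scaling the form by `j` multiplies a determinant of size 2m by (j^m)², so the coordinate must
  -- be scaled by j^m.
  equiv := o.equiv.trans (LinearEquiv.smulOfUnit (hj.unit ^ m))
  isometry v w := by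
    have h : ∀ x, (o.equiv.trans (LinearEquiv.smulOfUnit (hj.unit ^ m))) x =
        (j : R) ^ m * o.equiv x := fun x => rfl
    have hm : (Matrix.of fun i k => QuadraticMap.associated (R := R) (j • q) (v i) (w k)) =
        (j : R) • Matrix.of fun i k => QuadraticMap.associated (R := R) q (v i) (w k) := by
      ext i k
      simp [QuadraticMap.associated_apply]
    rw [h, h, hm, Matrix.det_smul, Fintype.card_fin, mul_mul_mul_comm, o.isometry]
    ring

lemma QuadOrientation.isOriented_nsmul {q : QuadraticForm R V} {m : ℕ} (o : QuadOrientation q m)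
    (hq : Function.Bijective q.polarBilin)
    (hrank : ∀ p : PrimeSpectrum R, Module.rankAtStalk V p = 2 * m) {j : ℕ}
    (hj : IsUnit (j : R)) : (j • q).IsOriented :=
  (o.nsmul hj).isOriented (polarBilin_nsmul_bijective hq hj) hrank

end Oriented

/-! ### Homomorphisms of graded Clifford modules -/

namespace GrMod

section Hom

variable {R V : Type u} [CommRing R] [AddCommGroup V] [Module R V] {Q : QuadraticForm R V}

/-- Linear maps commuting with the vectors and with the gradings. -/
structure IsHom (M N : GrMod Q) (f : M.carrier →ₗ[R] N.carrier) : Prop where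
  vec : ∀ v m, f (M.vec v m) = N.vec v (f m)
  eps : ∀ m, f (M.eps m) = N.eps (f m)

variable {M N P : GrMod Q}

namespace IsHom

lemma id (M : GrMod Q) : IsHom M M LinearMap.id := ⟨fun _ _ => rfl, fun _ => rfl⟩

lemma one (M : GrMod Q) : IsHom M M 1 := id M

lemma zero (M N : GrMod Q) : IsHom M N 0 := ⟨fun v m => by simp, fun m => by simp⟩

variable {f f' : M.carrier →ₗ[R] N.carrier} {g : N.carrier →ₗ[R] P.carrier}

lemma comp (hg : IsHom N P g) (hf : IsHom M N f) : IsHom M P (g ∘ₗ f) :=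
  ⟨fun v m => by simp [hf.vec, hg.vec], fun m => by simp [hf.eps, hg.eps]⟩

lemma mul {f g : Module.End R M.carrier} (hg : IsHom M M g) (hf : IsHom M M f) :
    IsHom M M (g * f) := hg.comp hf

lemma add (hf : IsHom M N f) (hf' : IsHom M N f') : IsHom M N (f + f') :=
  ⟨fun v m => by simp [hf.vec, hf'.vec], fun m => by simp [hf.eps, hf'.eps]⟩

lemma smul (c : R) (hf : IsHom M N f) : IsHom M N (c • f) :=
  ⟨fun v m => by simp [hf.vec], fun m => by simp [hf.eps]⟩

lemma sub (hf : IsHom M N f) (hf' : IsHom M N f') : IsHom M N (f - f') :=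
  ⟨fun v m => by simp [hf.vec, hf'.vec], fun m => by simp [hf.eps, hf'.eps]⟩

lemma sum {ι : Type*} (s : Finset ι) {f : ι → M.carrier →ₗ[R] N.carrier}
    (hf : ∀ i ∈ s, IsHom M N (f i)) : IsHom M N (∑ i ∈ s, f i) := by
  classical
  induction s using Finset.induction_on with
  | empty => exact zero M N
  | insert a s ha ih =>
    rw [Finset.sum_insert ha]
    exact (hf a (Finset.mem_insert_self a s)).add (ih fun i hi => hf i (Finset.mem_insert_of_mem hi))

lemma symm {e : M.carrier ≃ₗ[R] N.carrier} (he : IsHom M N e.toLinearMap) :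
    IsHom N M e.symm.toLinearMap :=
  ⟨fun v m => e.injective (by
    simpa using (he.vec v (e.symm m)).symm), fun m => e.injective (by
    simpa using (he.eps (e.symm m)).symm)⟩

/-- The vectors of `V` and the grading involution generate the Clifford algebra of `V ⊕ R`. -/
lemma map_smul (hf : IsHom M N f) (a : ClTensor Q 1) (m : M.carrier) : f (a • m) = a • f m := by
  induction a using CliffordAlgebra.induction generalizing m with
  | algebraMap r => rw [algebraMap_smul, algebraMap_smul, LinearMap.map_smul]
  | ι w =>
    have hw : w = LinearMap.inl R V (Fin 1 → R) w.1 + w.2 0 • ((0 : V), fun _ => (1 : R)) := by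
      refine Prod.ext (by simp) (funext fun i => ?_)
      rw [Subsingleton.elim i 0]; simp
    rw [hw, map_add, LinearMap.map_smul, add_smul, add_smul, map_add, smul_assoc, smul_assoc,
      LinearMap.map_smul]
    exact congrArg₂ _ (hf.vec _ m) (congrArg _ (hf.eps m))
  | mul a b ha hb => rw [mul_smul, mul_smul, ha, hb]
  | add a b ha hb => rw [add_smul, add_smul, map_add, ha, hb]

/-- The homomorphism of Clifford modules. -/
def toLinearMap (hf : IsHom M N f) : M.carrier →ₗ[ClTensor Q 1] N.carrier :=
  { f with map_smul' := hf.map_smul }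

lemma of_linearMap (f : M.carrier →ₗ[ClTensor Q 1] N.carrier) : IsHom M N (f.restrictScalars R) :=
  ⟨fun _ _ => f.map_smul _ _, fun _ => f.map_smul _ _⟩

end IsHom

/-- Isomorphism of graded Clifford modules. -/
def Iso (M N : GrMod Q) : Prop := ∃ e : M.carrier ≃ₗ[R] N.carrier, IsHom M N e.toLinearMap

lemma Iso.refl (M : GrMod Q) : Iso M M := ⟨LinearEquiv.refl _ _, IsHom.id M⟩

lemma Iso.symm : Iso M N → Iso N M := fun ⟨e, he⟩ => ⟨e.symm, he.symm⟩

lemma Iso.trans : Iso M N → Iso N P → Iso M P :=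
  fun ⟨e, he⟩ ⟨e', he'⟩ => ⟨e.trans e', he'.comp he⟩

lemma Iso.linearEquiv : Iso M N → Nonempty (M.carrier ≃ₗ[ClTensor Q 1] N.carrier) :=
  fun ⟨e, he⟩ => ⟨{ he.toLinearMap, e with }⟩

lemma Iso.of_linearEquiv (e : M.carrier ≃ₗ[ClTensor Q 1] N.carrier) : Iso M N :=
  ⟨e.restrictScalars R, IsHom.of_linearMap e.toLinearMap⟩

lemma Iso.isFGP (h : Iso M N) (hM : M.IsFGP) : N.IsFGP := by
  obtain ⟨e⟩ := h.linearEquiv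
  obtain ⟨h1, h2⟩ := hM
  exact ⟨Module.Finite.equiv e, Module.Projective.of_equiv e⟩

lemma Iso.cls_eq (h : Iso M N) : M.cls = N.cls := by
  by_cases hM : M.IsFGP
  · obtain ⟨e⟩ := h.linearEquiv
    have : FGPMod.isoClass (R := R) (A := ClTensor Q 1) ⟨M, hM⟩ =
        FGPMod.isoClass ⟨N, h.isFGP hM⟩ := Quotient.sound ⟨e⟩
    rw [cls, cls, dif_pos hM, dif_pos (h.isFGP hM)]
    exact congrArg (fun c => QuotientAddGroup.mk (Algebra.GrothendieckAddGroup.of c)) this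
  · rw [cls, cls, dif_neg hM, dif_neg fun hN => hM (h.symm.isFGP hN)]

/-- Direct sum of graded Clifford modules. -/
abbrev dsum (M N : GrMod Q) : GrMod Q := AlgMod.prod M N

lemma isHom_inl (M N : GrMod Q) : IsHom M (M.dsum N) (LinearMap.inl R M.carrier N.carrier) :=
  ⟨fun v _ => Prod.ext rfl (map_zero (N.vec v)).symm, fun _ => Prod.ext rfl (map_zero N.eps).symm⟩

lemma isHom_inr (M N : GrMod Q) : IsHom N (M.dsum N) (LinearMap.inr R M.carrier N.carrier) :=
  ⟨fun v _ => Prod.ext (map_zero (M.vec v)).symm rfl, fun _ => Prod.ext (map_zero M.eps).symm rfl⟩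

lemma isHom_fst (M N : GrMod Q) : IsHom (M.dsum N) M (LinearMap.fst R M.carrier N.carrier) :=
  ⟨fun _ _ => rfl, fun _ => rfl⟩

lemma isHom_snd (M N : GrMod Q) : IsHom (M.dsum N) N (LinearMap.snd R M.carrier N.carrier) :=
  ⟨fun _ _ => rfl, fun _ => rfl⟩

lemma dsum_isFGP (hM : M.IsFGP) (hN : N.IsFGP) : (M.dsum N).IsFGP :=
  (FGPMod.prod ⟨M, hM⟩ ⟨N, hN⟩).2

lemma _root_.KGroup.mk_prod {A : Type u} [Ring A] [Algebra R A] (X Y : FGPMod R A) :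
    KGroup.mk (X.prod Y) = KGroup.mk X + KGroup.mk Y :=
  map_add Algebra.GrothendieckAddGroup.of X.isoClass Y.isoClass

lemma cls_dsum (hM : M.IsFGP) (hN : N.IsFGP) : (M.dsum N).cls = M.cls + N.cls := by
  rw [cls, cls, cls, dif_pos hM, dif_pos hN, dif_pos (dsum_isFGP hM hN)]
  exact congrArg QuotientAddGroup.mk (KGroup.mk_prod ⟨M, hM⟩ ⟨N, hN⟩)

/-! ### Modules of class zero -/

/-- An operator anticommuting with the vectors and with the grading. -/
structure IsOdd (M : GrMod Q) (F : Module.End R M.carrier) : Prop where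
  vec : ∀ v, F * M.vec v = -(M.vec v * F)
  eps : F * M.eps = -(M.eps * F)

/-- A graded module with an involution anticommuting with the vectors and with the grading, that
is, the restriction of a module over `C(V, Q) ⊗̂ C^{0,2}`. -/
def IsNull (M : GrMod Q) : Prop := ∃ F : Module.End R M.carrier, M.IsOdd F ∧ F * F = 1

lemma IsOdd.vec_apply {F : Module.End R M.carrier} (hF : M.IsOdd F) (v : V) (m : M.carrier) :
    F (M.vec v m) = -M.vec v (F m) := LinearMap.congr_fun (hF.vec v) m

lemma IsOdd.eps_apply {F : Module.End R M.carrier} (hF : M.IsOdd F) (m : M.carrier) :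
    F (M.eps m) = -M.eps (F m) := LinearMap.congr_fun hF.eps m

lemma IsNull.dsum (hM : M.IsNull) (hN : N.IsNull) : (M.dsum N).IsNull := by
  obtain ⟨F, hF, hF2⟩ := hM
  obtain ⟨G, hG, hG2⟩ := hN
  refine ⟨LinearMap.prodMap F G, ⟨fun v => LinearMap.ext fun x => ?_, LinearMap.ext fun x => ?_⟩,
    LinearMap.ext fun x => ?_⟩
  · exact Prod.ext (hF.vec_apply v x.1) (hG.vec_apply v x.2)
  · exact Prod.ext (hF.eps_apply x.1) (hG.eps_apply x.2)
  · exact Prod.ext (LinearMap.congr_fun hF2 x.1) (LinearMap.congr_fun hG2 x.2)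

lemma opp_vec_apply (M : GrMod Q) (v : V) (m : M.carrier) : M.opp.vec v m = -M.vec v m := by
  change CliffordAlgebra.involute (CliffordAlgebra.ι (Q.prod (stdForm R 1)) (v, 0)) • m =
    -(CliffordAlgebra.ι (Q.prod (stdForm R 1)) (v, 0) • m)
  rw [CliffordAlgebra.involute_ι, neg_smul]

lemma opp_eps_apply (M : GrMod Q) (m : M.carrier) : M.opp.eps m = -M.eps m := by
  change CliffordAlgebra.involute (CliffordAlgebra.ι (Q.prod (stdForm R 1)) (0, fun _ => 1)) • m =
    -(CliffordAlgebra.ι (Q.prod (stdForm R 1)) (0, fun _ => 1) • m)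
  rw [CliffordAlgebra.involute_ι, neg_smul]

/-- The exchange of the two copies is odd, because on the second one vectors and grading act with
opposite sign. -/
lemma isNull_dsum_opp (M : GrMod Q) : (M.dsum M.opp).IsNull := by
  refine ⟨(LinearMap.snd R M.carrier M.carrier).prod (LinearMap.fst R M.carrier M.carrier),
    ⟨fun v => LinearMap.ext fun x => ?_, LinearMap.ext fun x => ?_⟩, LinearMap.ext fun x => rfl⟩
  · exact Prod.ext (opp_vec_apply M v x.2)
      ((neg_neg (M.vec v x.1)).symm.trans (congrArg Neg.neg (opp_vec_apply M v x.1).symm))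
  · exact Prod.ext (opp_eps_apply M x.2)
      ((neg_neg (M.eps x.1)).symm.trans (congrArg Neg.neg (opp_eps_apply M x.1).symm))

lemma clIncl_vec (w : V × (Fin 1 → R)) :
    clIncl Q (CliffordAlgebra.ι _ w) = CliffordAlgebra.ι _ (w.1, ![w.2 0, 0]) := by
  rw [clIncl, CliffordAlgebra.map_apply_ι, inclIsometry_apply]

/-- Restrictions of modules over `C(V, Q) ⊗̂ C^{0,2}`. -/
lemma isNull_of_restriction (N : GrMod Q) (M : AlgMod R (ClTensor Q 2))
    (e : N.carrier ≃+ M.carrier) (he : ∀ a n, e (a • n) = clIncl Q a • e n) : N.IsNull := by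
  let e' : N.carrier ≃ₗ[R] M.carrier :=
    { e with
      map_smul' := fun r n => by
        change e (r • n) = r • e n
        rw [← algebraMap_smul (ClTensor Q 1) r n, he, AlgHom.commutes, algebraMap_smul] }
  have he' : ∀ a n, e' (a • n) = clIncl Q a • e' n := he
  let f₂ : ClTensor Q 2 := CliffordAlgebra.ι _ ((0 : V), ![(0 : R), 1])
  have hf₂ : f₂ * f₂ = 1 := by
    have : (Q.prod (stdForm R 2)) (0, ![0, 1]) = 1 := by
      simp [stdForm, QuadraticMap.pi_apply, Fin.sum_univ_two]
    rw [CliffordAlgebra.ι_sq_scalar, this, map_one]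
  have hanti : ∀ w : V × (Fin 1 → R), f₂ * clIncl Q (CliffordAlgebra.ι _ w) =
      -(clIncl Q (CliffordAlgebra.ι _ w) * f₂) := by
    intro w
    rw [clIncl_vec]
    refine ι_mul_ι_of_polar_eq_zero ?_
    simp only [QuadraticMap.polar, stdForm, QuadraticMap.prod_apply, QuadraticMap.pi_apply,
      Fin.sum_univ_two, QuadraticMap.sq_apply, Prod.fst_add, Prod.snd_add, Pi.add_apply]
    simp
    ring
  let F : Module.End R N.carrier :=
    e'.symm.toLinearMap ∘ₗ Algebra.lsmul R R M.carrier f₂ ∘ₗ e'.toLinearMap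
  have hF : ∀ n, e' (F n) = f₂ • e' n := fun n => e'.apply_symm_apply _
  have hw : ∀ (w : V × (Fin 1 → R)) (n : N.carrier),
      F (CliffordAlgebra.ι (Q.prod (stdForm R 1)) w • n) =
        -(CliffordAlgebra.ι (Q.prod (stdForm R 1)) w • F n) := by
    intro w n
    apply e'.injective
    rw [hF, he', map_neg, he', hF, ← mul_smul, hanti, neg_smul, mul_smul]
  refine ⟨F, ⟨fun v => LinearMap.ext fun n => hw _ n, LinearMap.ext fun n => hw _ n⟩,
    LinearMap.ext fun n => e'.injective ?_⟩
  change e' (F (F n)) = e' n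
  rw [hF, hF, ← mul_smul, hf₂, one_smul]

/-- Equality of classes is isomorphism up to modules of class zero. -/
theorem exists_iso_of_cls_eq (hM : M.IsFGP) (hN : N.IsFGP) (h : M.cls = N.cls) :
    ∃ P P' : GrMod Q, P.IsFGP ∧ P'.IsFGP ∧ P.IsNull ∧ P'.IsNull ∧
      Iso (M.dsum P) (N.dsum P') := by
  -- Null modules are closed under direct sums, so every element of the subgroup generated by
  -- restrictions is a difference of two null classes.
  have hcl : ∀ x ∈ restrictionImage Q, ∃ P P' : FGPMod R (ClTensor Q 1),
      IsNull P.1 ∧ IsNull P'.1 ∧ x = KGroup.mk P - KGroup.mk P' := by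
    intro x hx
    induction hx using AddSubgroup.closure_induction with
    | mem x hx =>
      obtain ⟨N, M, e, he, rfl⟩ := hx
      have hz : IsNull (FGPMod.zero (R := R) (A := ClTensor Q 1)).1 :=
        ⟨0, ⟨fun v => LinearMap.ext fun _ => rfl, LinearMap.ext fun _ => rfl⟩,
          LinearMap.ext fun _ => rfl⟩
      refine ⟨N, FGPMod.zero, isNull_of_restriction _ M.1 e he, hz, ?_⟩
      have : KGroup.mk (FGPMod.zero (R := R) (A := ClTensor Q 1)) = 0 :=
        map_zero Algebra.GrothendieckAddGroup.of
      rw [this, sub_zero]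
    | zero =>
      have hz : IsNull (FGPMod.zero (R := R) (A := ClTensor Q 1)).1 :=
        ⟨0, ⟨fun v => LinearMap.ext fun _ => rfl, LinearMap.ext fun _ => rfl⟩,
          LinearMap.ext fun _ => rfl⟩
      exact ⟨FGPMod.zero, FGPMod.zero, hz, hz, (sub_self _).symm⟩
    | add x y _ _ hx hy =>
      obtain ⟨P, P', h1, h2, rfl⟩ := hx
      obtain ⟨T, T', h3, h4, rfl⟩ := hy
      refine ⟨P.prod T, P'.prod T', IsNull.dsum h1 h3, IsNull.dsum h2 h4, ?_⟩
      rw [KGroup.mk_prod, KGroup.mk_prod]; abel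
    | neg x _ hx =>
      obtain ⟨P, P', h1, h2, rfl⟩ := hx
      exact ⟨P', P, h2, h1, by abel⟩
  rw [cls, cls, dif_pos hM, dif_pos hN, QuotientAddGroup.eq] at h
  obtain ⟨P, P', h1, h2, h3⟩ := hcl _ h
  have h4 : KGroup.mk (FGPMod.prod ⟨M, hM⟩ P) = KGroup.mk (FGPMod.prod ⟨N, hN⟩ P') := by
    refine (KGroup.mk_prod _ P).trans (Eq.trans ?_ (KGroup.mk_prod _ P').symm)
    rw [neg_add_eq_iff_eq_add] at h3
    rw [h3]; abel
  -- Equality in the Grothendieck group is isomorphism after adding some `C`, which need not be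
  -- null; adding the opposite of `C` as well makes it part of a null summand.
  obtain ⟨⟨⟨C⟩, hC⟩, h5⟩ := (AddLocalization.addMonoidOf (⊤ : AddSubmonoid _)).eq_iff_exists.1 h4
  obtain ⟨e⟩ := Quotient.exact h5
  have e1 : Iso (AlgMod.prod C.1 (AlgMod.prod M P.1)) (AlgMod.prod C.1 (AlgMod.prod N P'.1)) :=
    Iso.of_linearEquiv e
  refine ⟨P.1.prod (GrMod.dsum C.1 (opp C.1)), P'.1.prod (GrMod.dsum C.1 (opp C.1)),
    dsum_isFGP P.2 (dsum_isFGP C.2 (opp_isFGP C.2)),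
    dsum_isFGP P'.2 (dsum_isFGP C.2 (opp_isFGP C.2)), h1.dsum (isNull_dsum_opp _),
    h2.dsum (isNull_dsum_opp _), ?_⟩
  have key : ∀ (X Y C D : GrMod Q), Iso (X.dsum (Y.dsum (C.dsum D)))
      ((C.dsum (X.dsum Y)).dsum D) := by
    intro X Y C D
    refine ⟨{ toFun := fun x => ((x.2.2.1, (x.1, x.2.1)), x.2.2.2)
              invFun := fun x => (x.1.2.1, (x.1.2.2, (x.1.1, x.2)))
              map_add' := fun _ _ => rfl
              map_smul' := fun _ _ => rfl
              left_inv := fun _ => rfl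
              right_inv := fun _ => rfl }, fun _ _ => rfl, fun _ => rfl⟩
  have e2 : ∀ (X Y D : GrMod Q), Iso X Y → Iso (X.dsum D) (Y.dsum D) := by
    rintro X Y D ⟨e, he⟩
    exact ⟨e.prodCongr (LinearEquiv.refl R D.carrier), fun v x => Prod.ext (he.vec v x.1) rfl,
      fun x => Prod.ext (he.eps x.1) rfl⟩
  exact (key _ _ _ _).trans ((e2 _ _ _ e1).trans (key _ _ _ _).symm)

end Hom

/-! ### Odd operators, null modules and vanishing classes. -/

section Null

variable {R V : Type u} [CommRing R] [Invertible (2 : R)] [AddCommGroup V] [Module R V]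
  [Module.Finite R V] [Module.Projective R V] {Q : QuadraticForm R V} {M N : GrMod Q}

/-- The odd involution serves as the second generator of C^{0,2}. Nondegeneracy is needed for the
module to be finitely generated projective over the larger Clifford algebra, which is tested over
`R`. -/
lemma IsNull.cls_eq_zero (hQ : Function.Bijective Q.polarBilin) (h : M.IsNull) : M.cls = 0 := by
  by_cases hM : M.IsFGP
  · obtain ⟨F, hF, hF2⟩ := h
    let ops : V × (Fin 2 → R) →ₗ[R] Module.End R M.carrier :=
      { toFun := fun w => M.vec w.1 + w.2 0 • M.eps + w.2 1 • F
        map_add' := fun w w' => by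
          simp only [Prod.fst_add, Prod.snd_add, Pi.add_apply, map_add, add_smul]; abel
        map_smul' := fun r w => by simp [mul_smul] }
    have hops : ∀ w, ops w * ops w = algebraMap R _ ((Q.prod (stdForm R 2)) w) := by
      intro w
      simp only [ops, LinearMap.coe_mk, AddHom.coe_mk, add_mul, mul_add, smul_mul_assoc,
        mul_smul_comm, vec_mul_vec, eps_mul_eps, hF2, hF.vec, hF.eps, vec_mul_eps]
      simp only [stdForm, QuadraticMap.prod_apply, QuadraticMap.pi_apply, Fin.sum_univ_two,
        QuadraticMap.sq_apply, Algebra.algebraMap_eq_smul_one]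
      module
    let M2 : AlgMod R (ClTensor Q 2) := AlgMod.ofRep M.carrier (CliffordAlgebra.lift _ ⟨ops, hops⟩)
    have hM2 : M2.IsFGP := by
      rw [AlgMod.isFGP_iff (polarBilin_prod_stdForm_bijective hQ 2)]
      exact (GrMod.isFGP_iff hQ M).1 hM
    have hrestr : ∀ (a : ClTensor Q 1) (m : M.carrier),
        a • m = CliffordAlgebra.lift (Q.prod (stdForm R 2)) ⟨ops, hops⟩ (clIncl Q a) m := by
      intro a m
      have : M.op = (CliffordAlgebra.lift (Q.prod (stdForm R 2)) ⟨ops, hops⟩).comp (clIncl Q) := by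
        refine CliffordAlgebra.hom_ext (LinearMap.ext fun w => ?_)
        change M.op (CliffordAlgebra.ι _ w) =
          CliffordAlgebra.lift (Q.prod (stdForm R 2)) ⟨ops, hops⟩ (clIncl Q (CliffordAlgebra.ι _ w))
        rw [clIncl_vec, CliffordAlgebra.lift_ι_apply]
        have hw : w = LinearMap.inl R V (Fin 1 → R) w.1 + w.2 0 • ((0 : V), fun _ => (1 : R)) := by
          refine Prod.ext (by simp) (funext fun i => ?_)
          rw [Subsingleton.elim i 0]; simp
        conv_lhs => rw [hw, map_add, LinearMap.map_smul, map_add, map_smul]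
        simp only [ops, LinearMap.coe_mk, AddHom.coe_mk, Matrix.cons_val_zero, Matrix.cons_val_one,
          zero_smul, add_zero]
        rfl
      exact LinearMap.congr_fun (DFunLike.congr_fun this a) m
    rw [cls, dif_pos hM, QuotientAddGroup.eq_zero_iff]
    exact AddSubgroup.subset_closure ⟨⟨M, hM⟩, ⟨M2, hM2⟩, AddEquiv.refl M.carrier, hrestr, rfl⟩
  · rw [cls, dif_neg hM]

omit [Module.Finite R V] [Module.Projective R V] in
/-- Over an oriented form, an invertible odd operator suffices for a module to have class zero. -/
lemma IsOdd.isNull (hQ : Q.IsOriented) {F G : Module.End R M.carrier} (hF : M.IsOdd F)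
    (hFG : F * G = 1) (hGF : G * F = 1) : M.IsNull := by
  obtain ⟨u, hu, hue, huv⟩ := hQ.exists_involution
  let φ : CliffordAlgebra Q →ₐ[R] Module.End R M.carrier := CliffordAlgebra.lift Q
    ⟨M.vec, fun v => by rw [vec_mul_vec, Algebra.algebraMap_eq_smul_one]⟩
  -- Anticommuting with vectors means commuting with the Clifford algebra up to the grading
  -- automorphism; since `u` is even, both `F` and the grading commute with it.
  have hodd : ∀ {T : Module.End R M.carrier}, (∀ v, T * M.vec v = -(M.vec v * T)) →
      ∀ a, T * φ a = φ (CliffordAlgebra.involute a) * T := by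
    intro T hT a
    induction a using CliffordAlgebra.induction with
    | algebraMap r => rw [AlgHom.commutes, AlgHom.commutes, ← Algebra.commutes, AlgHom.commutes]
    | ι w =>
      rw [CliffordAlgebra.involute_ι, map_neg, CliffordAlgebra.lift_ι_apply, hT, neg_mul]
    | mul a b ha hb => rw [map_mul, map_mul, map_mul, ← mul_assoc, ha, mul_assoc, hb, mul_assoc]
    | add a b ha hb => rw [map_add, map_add, map_add, mul_add, add_mul, ha, hb]
  have hFu : F * φ u = φ u * F := by rw [hodd hF.vec, hue]
  have heu : M.eps * φ u = φ u * M.eps := by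
    rw [hodd (fun v => ?_), hue]
    rw [vec_mul_eps, neg_neg]
  have hvu : ∀ v, φ u * M.vec v = -(M.vec v * φ u) := fun v => by
    have := congrArg φ (huv v)
    rwa [map_mul, map_neg, map_mul, CliffordAlgebra.lift_ι_apply] at this
  -- This involution commutes with vectors and grading and anticommutes with `F`: its eigenspaces
  -- are graded submodules exchanged by `F`.
  set z : Module.End R M.carrier := φ u * M.eps with hz
  have hzz : z * z = 1 := by
    rw [hz, mul_assoc, ← mul_assoc M.eps, heu, mul_assoc, eps_mul_eps, mul_one, ← map_mul, hu,
      map_one]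
  have hFz : F * z = -(z * F) := by
    rw [hz, ← mul_assoc, hFu, mul_assoc, hF.eps, mul_neg, mul_assoc]
  have hzv : ∀ v, z * M.vec v = M.vec v * z := fun v => by
    have h1 : M.eps * M.vec v = -(M.vec v * M.eps) := by rw [vec_mul_eps, neg_neg]
    rw [hz, mul_assoc, h1, mul_neg, ← mul_assoc, hvu, neg_mul, neg_neg, mul_assoc]
  have hze : z * M.eps = M.eps * z := by rw [hz, ← mul_assoc, heu]
  have hG : ∀ {T : Module.End R M.carrier}, F * T = -(T * F) → G * T = -(T * G) := by
    intro T hT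
    calc G * T = G * T * (F * G) := by rw [hFG, mul_one]
      _ = G * (T * F) * G := by simp only [mul_assoc]
      _ = -(T * G) := by
        rw [← neg_neg (T * F), ← hT, mul_neg, neg_mul, ← mul_assoc, hGF, one_mul]
  have hGz := hG hFz
  have hhalf : (⅟2 : R) • (1 + z) + (⅟2 : R) • (1 - z) = (1 : Module.End R M.carrier) := by
    rw [← smul_add, add_add_sub_cancel, ← two_smul R, smul_smul, invOf_mul_self, one_smul]
  set π₀ : Module.End R M.carrier := (⅟2 : R) • (1 + z) with hπ₀
  set π₁ : Module.End R M.carrier := (⅟2 : R) • (1 - z) with hπ₁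
  have hFπ₀ : F * π₀ = π₁ * F := by
    rw [hπ₀, hπ₁, mul_smul_comm, smul_mul_assoc, mul_add, hFz, sub_mul, mul_one, one_mul,
      sub_eq_add_neg]
  have hGπ₁ : G * π₁ = π₀ * G := by
    rw [hπ₀, hπ₁, mul_smul_comm, smul_mul_assoc, mul_sub, hGz, add_mul, mul_one, one_mul,
      sub_neg_eq_add]
  have h01 : π₀ * π₁ = 0 := by
    rw [hπ₀, hπ₁, smul_mul_smul_comm, add_mul, mul_sub, mul_sub, hzz]
    simp
  have h10 : π₁ * π₀ = 0 := by
    rw [hπ₀, hπ₁, smul_mul_smul_comm, sub_mul, mul_add, mul_add, hzz]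
    simp [add_comm]
  have hcomm : ∀ {T : Module.End R M.carrier}, z * T = T * z → π₀ * T = T * π₀ ∧ π₁ * T = T * π₁ :=
    fun hT => ⟨by rw [hπ₀, smul_mul_assoc, mul_smul_comm, add_mul, mul_add, hT, one_mul, mul_one],
      by rw [hπ₁, smul_mul_assoc, mul_smul_comm, sub_mul, mul_sub, hT, one_mul, mul_one]⟩
  have hidem : ∀ {T : Module.End R M.carrier}, π₀ * T + π₁ * T = T := fun {T} => by
    rw [← add_mul, hhalf, one_mul]
  have hidem₀ : π₀ * π₀ = π₀ := by
    have := hidem (T := π₀)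
    rwa [h10, add_zero] at this
  have hidem₁ : π₁ * π₁ = π₁ := by
    have := hidem (T := π₁)
    rwa [h01, zero_add] at this
  -- `F` from the +1 eigenspace to the −1 eigenspace and its inverse back.
  refine ⟨F * π₀ + G * π₁, ⟨fun v => ?_, ?_⟩, ?_⟩
  · have h1 := hcomm (hzv v)
    rw [add_mul, mul_assoc, h1.1, ← mul_assoc, hF.vec, mul_assoc, h1.2, ← mul_assoc G,
      hG (hF.vec v), mul_add]
    simp only [neg_mul, mul_assoc]; abel
  · have h1 := hcomm hze
    rw [add_mul, mul_assoc, h1.1, ← mul_assoc, hF.eps, mul_assoc, h1.2, ← mul_assoc G,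
      hG hF.eps, mul_add]
    simp only [neg_mul, mul_assoc]; abel
  · rw [add_mul, mul_add, mul_add]
    have e1 : F * π₀ * (F * π₀) = 0 := by
      rw [mul_assoc, hFπ₀, ← mul_assoc π₀, h01, zero_mul, mul_zero]
    have e2 : F * π₀ * (G * π₁) = π₁ := by
      rw [mul_assoc, hGπ₁, ← mul_assoc π₀, hidem₀, ← hGπ₁, ← mul_assoc, hFG, one_mul]
    have e3 : G * π₁ * (F * π₀) = π₀ := by
      rw [mul_assoc, hFπ₀, ← mul_assoc π₁, hidem₁, ← hFπ₀, ← mul_assoc, hGF, one_mul]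
    have e4 : G * π₁ * (G * π₁) = 0 := by
      rw [mul_assoc, hGπ₁, ← mul_assoc π₁, h10, zero_mul, mul_zero]
    rw [e1, e2, e3, e4, zero_add, add_zero, add_comm, hhalf]

end Null

end GrMod

namespace GrMod

/-! ### Splittings of idempotents -/

section Splits

variable {R V : Type u} [CommRing R] [AddCommGroup V] [Module R V] {Q : QuadraticForm R V}
  {M N X Y Z : GrMod Q} {p q : Module.End R M.carrier}

/-- `X` is the direct summand of `M` corresponding to the idempotent `p`. -/
def Splits (M : GrMod Q) (p : Module.End R M.carrier) (X : GrMod Q) : Prop :=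
  ∃ (i : X.carrier →ₗ[R] M.carrier) (r : M.carrier →ₗ[R] X.carrier),
    IsHom X M i ∧ IsHom M X r ∧ r ∘ₗ i = LinearMap.id ∧ i ∘ₗ r = p

lemma Splits.iso (hX : Splits M p X) (hY : Splits M p Y) : Iso X Y := by
  obtain ⟨i, r, hi, hr, hri, rfl⟩ := hX
  obtain ⟨i', r', hi', hr', hri', hir'⟩ := hY
  have h1 : (r' ∘ₗ i) ∘ₗ (r ∘ₗ i') = LinearMap.id := by
    rw [LinearMap.comp_assoc, ← LinearMap.comp_assoc i' r i, ← hir', LinearMap.comp_assoc i' r' i',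
      hri', LinearMap.comp_id, hri']
  have h2 : (r ∘ₗ i') ∘ₗ (r' ∘ₗ i) = LinearMap.id := by
    rw [LinearMap.comp_assoc, ← LinearMap.comp_assoc i r' i', hir', LinearMap.comp_assoc i r i,
      hri, LinearMap.comp_id, hri]
  exact ⟨LinearEquiv.ofLinearMap (r' ∘ₗ i) (r ∘ₗ i') h1 h2, hr'.comp hi⟩

lemma splits_quotient (hp : IsHom M M p) (hpp : p * p = p) (N : Submodule (ClTensor Q 1) M.carrier)
    (hN : ∀ m, m ∈ N ↔ p m = 0) : Splits M p (M.quotient N) := by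
  have hle : N ≤ LinearMap.ker hp.toLinearMap := fun m hm => (hN m).1 hm
  refine ⟨(N.liftQ hp.toLinearMap hle).restrictScalars R, N.mkQ.restrictScalars R,
    IsHom.of_linearMap (M := M.quotient N) _, IsHom.of_linearMap (N := M.quotient N) _,
    LinearMap.ext fun x => ?_, LinearMap.ext fun m => rfl⟩
  obtain ⟨m, rfl⟩ := N.mkQ_surjective x
  change N.mkQ (p m) = N.mkQ m
  rw [← sub_eq_zero, ← map_sub, Submodule.mkQ_apply, Submodule.Quotient.mk_eq_zero, hN, map_sub,
    sub_eq_zero]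
  exact LinearMap.congr_fun hpp m

lemma exists_splits (hp : IsHom M M p) (hpp : p * p = p) : ∃ X, Splits M p X :=
  ⟨_, splits_quotient hp hpp (LinearMap.ker hp.toLinearMap) fun _ => Iff.rfl⟩

lemma Splits.isFGP (h : Splits M p X) (hM : M.IsFGP) : X.IsFGP := by
  obtain ⟨i, r, hi, hr, hri, -⟩ := h
  obtain ⟨h1, h2⟩ := hM
  exact ⟨Module.Finite.of_surjective hr.toLinearMap fun x => ⟨i x, LinearMap.congr_fun hri x⟩,
    Module.Projective.of_split hi.toLinearMap hr.toLinearMap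
      (LinearMap.ext fun x => LinearMap.congr_fun hri x)⟩

/-- Orthogonal idempotents split direct sums. -/
lemma Splits.dsum (hX : Splits M p X) (hY : Splits M q Y) (hpq : p * q = 0) (hqp : q * p = 0) :
    Splits M (p + q) (X.dsum Y) := by
  obtain ⟨i, r, hi, hr, hri, rfl⟩ := hX
  obtain ⟨i', r', hi', hr', hri', rfl⟩ := hY
  have h1 : ∀ x, r (i x) = x := LinearMap.congr_fun hri
  have h1' : ∀ x, r' (i' x) = x := LinearMap.congr_fun hri'
  have h2 : ∀ y, r (i' y) = 0 := fun y => by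
    have := congrArg r (LinearMap.congr_fun hpq (i' y))
    simpa [h1, h1'] using this
  have h2' : ∀ y, r' (i y) = 0 := fun y => by
    have := congrArg r' (LinearMap.congr_fun hqp (i y))
    simpa [h1, h1'] using this
  refine ⟨i.coprod i', r.prod r', ⟨fun v x => ?_, fun x => ?_⟩, ⟨fun v m => ?_, fun m => ?_⟩,
    LinearMap.ext fun x => ?_, LinearMap.ext fun x => rfl⟩
  · exact (congrArg₂ _ (hi.vec v x.1) (hi'.vec v x.2)).trans (map_add (M.vec v) _ _).symm
  · exact (congrArg₂ _ (hi.eps x.1) (hi'.eps x.2)).trans (map_add M.eps _ _).symm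
  · exact Prod.ext (hr.vec v m) (hr'.vec v m)
  · exact Prod.ext (hr.eps m) (hr'.eps m)
  · have e1 : r (i x.1 + i' x.2) = x.1 := by rw [map_add, h1, h2, add_zero]
    have e2 : r' (i x.1 + i' x.2) = x.2 := by rw [map_add, h1', h2', zero_add]
    exact Prod.ext e1 e2

/-- Idempotents `b c` and `c b` split the same module. -/
lemma Splits.conj {p' : Module.End R N.carrier} (hX : Splits M p X)
    {b : M.carrier →ₗ[R] N.carrier} {c : N.carrier →ₗ[R] M.carrier} (hb : IsHom M N b)
    (hc : IsHom N M c) (hcb : c ∘ₗ b = p) (hbc : b ∘ₗ c = p') (hp : b ∘ₗ p = b) :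
    Splits N p' X := by
  obtain ⟨i, r, hi, hr, hri, hir⟩ := hX
  refine ⟨b ∘ₗ i, r ∘ₗ c, hb.comp hi, hr.comp hc, ?_, ?_⟩
  · rw [LinearMap.comp_assoc, ← LinearMap.comp_assoc i b c, hcb, ← hir, LinearMap.comp_assoc i r i,
      hri, LinearMap.comp_id, hri]
  · rw [LinearMap.comp_assoc, ← LinearMap.comp_assoc c r i, hir, ← LinearMap.comp_assoc, hp, hbc]

/-- The class of the direct summand of `M` corresponding to an idempotent. -/
def clsOf (M : GrMod Q) (p : Module.End R M.carrier) : GrK Q :=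
  open Classical in if h : ∃ X, Splits M p X then h.choose.cls else 0

lemma Splits.clsOf_eq (h : Splits M p X) : M.clsOf p = X.cls := by
  have hex : ∃ X, Splits M p X := ⟨X, h⟩
  rw [clsOf, dif_pos hex]
  exact (hex.choose_spec.iso h).cls_eq

lemma clsOf_add (hM : M.IsFGP) (hp : IsHom M M p) (hq : IsHom M M q) (hpp : p * p = p)
    (hqq : q * q = q) (hpq : p * q = 0) (hqp : q * p = 0) :
    M.clsOf (p + q) = M.clsOf p + M.clsOf q := by
  obtain ⟨X, hX⟩ := exists_splits hp hpp
  obtain ⟨Y, hY⟩ := exists_splits hq hqq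
  rw [(hX.dsum hY hpq hqp).clsOf_eq, hX.clsOf_eq, hY.clsOf_eq,
    cls_dsum (hX.isFGP hM) (hY.isFGP hM)]

lemma clsOf_zero (M : GrMod Q) : M.clsOf 0 = 0 := by
  have h : Splits M 0 AlgMod.zero := ⟨0, 0, IsHom.zero _ _, IsHom.zero _ _, rfl, rfl⟩
  rw [h.clsOf_eq]
  by_cases h : (AlgMod.zero : GrMod Q).IsFGP
  · rw [cls, dif_pos h]
    exact congrArg QuotientAddGroup.mk (map_zero Algebra.GrothendieckAddGroup.of)
  · rw [cls, dif_neg h]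

lemma clsOf_sum {ι : Type*} (hM : M.IsFGP) (s : Finset ι) {p : ι → Module.End R M.carrier}
    (hp : ∀ i, IsHom M M (p i)) (hpp : ∀ i, p i * p i = p i)
    (hpq : ∀ i j, i ≠ j → p i * p j = 0) :
    M.clsOf (∑ i ∈ s, p i) = ∑ i ∈ s, M.clsOf (p i) := by
  classical
  induction s using Finset.induction_on with
  | empty => exact clsOf_zero M
  | insert a s ha ih =>
    have hne : ∀ i ∈ s, a ≠ i := fun i hi h => ha (h ▸ hi)
    rw [Finset.sum_insert ha, Finset.sum_insert ha, clsOf_add hM (hp a)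
      (IsHom.sum s fun i _ => hp i) (hpp a), ih]
    · rw [Finset.sum_mul_sum]
      refine Finset.sum_congr rfl fun i hi => ?_
      rw [Finset.sum_eq_single_of_mem i hi fun j _ hj => hpq i j hj.symm, hpp]
    · rw [Finset.mul_sum]
      exact Finset.sum_eq_zero fun i hi => hpq a i (hne i hi)
    · rw [Finset.sum_mul]
      exact Finset.sum_eq_zero fun i hi => hpq i a (hne i hi).symm

lemma clsOf_conj (hpp : p * p = p) {p' : Module.End R N.carrier} (hph : IsHom M M p)
    {b : M.carrier →ₗ[R] N.carrier} {c : N.carrier →ₗ[R] M.carrier} (hb : IsHom M N b)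
    (hc : IsHom N M c) (hcb : c ∘ₗ b = p) (hbc : b ∘ₗ c = p') (hp : b ∘ₗ p = b) :
    M.clsOf p = N.clsOf p' := by
  obtain ⟨X, hX⟩ := exists_splits hph hpp
  rw [hX.clsOf_eq, (hX.conj hb hc hcb hbc hp).clsOf_eq]

lemma clsOf_iso (hpp : p * p = p) (hph : IsHom M M p) {p' : Module.End R N.carrier}
    (e : M.carrier ≃ₗ[R] N.carrier) (he : IsHom M N e.toLinearMap)
    (hep : ∀ m, e (p m) = p' (e m)) : M.clsOf p = N.clsOf p' := by
  have hp : ∀ m, p (p m) = p m := LinearMap.congr_fun hpp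
  refine clsOf_conj hpp hph (b := e.toLinearMap ∘ₗ p) (c := p ∘ₗ e.symm.toLinearMap)
    (he.comp hph) (hph.comp he.symm) (LinearMap.ext fun m => ?_) (LinearMap.ext fun m => ?_)
    (LinearMap.ext fun m => ?_)
  · simp [hp]
  · simp [hp, hep]
  · simp [hp]

/-- The summand of an idempotent on which an odd operator is invertible has class zero. -/
lemma Splits.isNull [Invertible (2 : R)] (hQ : Q.IsOriented) (h : Splits M p X)
    {F G : Module.End R M.carrier} (hF : M.IsOdd F) (hFp : F * p = p * F) (hGp : G * p = p * G)
    (hFG : F * G * p = p) (hGF : G * F * p = p) : X.IsNull := by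
  obtain ⟨i, r, hi, hr, hri, rfl⟩ := h
  have h1 : ∀ x, r (i x) = x := LinearMap.congr_fun hri
  have hFi : ∀ x, i (r (F (i x))) = F (i x) := fun x => by
    have := LinearMap.congr_fun hFp (i x)
    simpa [h1] using this.symm
  have hGi : ∀ x, i (r (G (i x))) = G (i x) := fun x => by
    have := LinearMap.congr_fun hGp (i x)
    simpa [h1] using this.symm
  have hFGi : ∀ x, F (G (i x)) = i x := fun x => by
    have := LinearMap.congr_fun hFG (i x)
    simpa [h1] using this
  have hGFi : ∀ x, G (F (i x)) = i x := fun x => by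
    have := LinearMap.congr_fun hGF (i x)
    simpa [h1] using this
  refine IsOdd.isNull hQ (F := r ∘ₗ F ∘ₗ i) (G := r ∘ₗ G ∘ₗ i)
    ⟨fun v => LinearMap.ext fun x => ?_, LinearMap.ext fun x => ?_⟩ (LinearMap.ext fun x => ?_)
    (LinearMap.ext fun x => ?_)
  · simp [hi.vec, hF.vec_apply, hr.vec]
  · simp [hi.eps, hF.eps_apply, hr.eps]
  · simp [hGi, hFGi, h1]
  · simp [hFi, hGFi, h1]

end Splits

/-! ### Tensor products -/

section Tensor

variable {R V : Type u} [CommRing R] [AddCommGroup V] [Module R V]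

lemma vec_ofOps {Q : QuadraticForm R V} {X : Type u} [AddCommGroup X] [Module R X]
    {c : V →ₗ[R] Module.End R X} {e : Module.End R X} (hc : ∀ v, c v * c v = Q v • 1)
    (he : e * e = 1) (hce : ∀ v, c v * e = -(e * c v)) (v : V) :
    (ofOps Q X c e hc he hce).vec v = c v := by
  have h : c.coprod ((LinearMap.toSpanSingleton R _ e) ∘ₗ LinearMap.proj 0)
      ((v, 0) : V × (Fin 1 → R)) = c v := by simp
  rw [← h]
  exact CliffordAlgebra.lift_ι_apply (Q := Q.prod (stdForm R 1)) (A := Module.End R X) _ _ _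

lemma eps_ofOps {Q : QuadraticForm R V} {X : Type u} [AddCommGroup X] [Module R X]
    {c : V →ₗ[R] Module.End R X} {e : Module.End R X} (hc : ∀ v, c v * c v = Q v • 1)
    (he : e * e = 1) (hce : ∀ v, c v * e = -(e * c v)) :
    (ofOps Q X c e hc he hce).eps = e := by
  have h : c.coprod ((LinearMap.toSpanSingleton R _ e) ∘ₗ LinearMap.proj 0)
      ((0, fun _ => 1) : V × (Fin 1 → R)) = e := by simp
  conv_rhs => rw [← h]
  exact CliffordAlgebra.lift_ι_apply (Q := Q.prod (stdForm R 1)) (A := Module.End R X) _ _ _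

variable {Q₁ Q₂ Q₃ : QuadraticForm R V} (h : Q₁ + Q₂ = Q₃) {M M' : GrMod Q₁} {N N' : GrMod Q₂}

lemma tensor_vec (M : GrMod Q₁) (N : GrMod Q₂) (v : V) :
    (tensor h M N).vec v = (TensorProduct.map (M.vec v) 1 + TensorProduct.map M.eps (N.vec v) :
      Module.End R (M.carrier ⊗[R] N.carrier)) := vec_ofOps _ _ _ v

lemma tensor_eps (M : GrMod Q₁) (N : GrMod Q₂) :
    (tensor h M N).eps = (TensorProduct.map M.eps N.eps :
      Module.End R (M.carrier ⊗[R] N.carrier)) := eps_ofOps _ _ _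

lemma tensor_vec_tmul (v : V) (m : M.carrier) (n : N.carrier) :
    (tensor h M N).vec v (m ⊗ₜ[R] n) = (M.vec v m ⊗ₜ[R] n + M.eps m ⊗ₜ[R] N.vec v n :
      M.carrier ⊗[R] N.carrier) := LinearMap.congr_fun (tensor_vec h M N v) (m ⊗ₜ[R] n)

lemma tensor_eps_tmul (m : M.carrier) (n : N.carrier) :
    (tensor h M N).eps (m ⊗ₜ[R] n) = (M.eps m ⊗ₜ[R] N.eps n : M.carrier ⊗[R] N.carrier) :=
  LinearMap.congr_fun (tensor_eps h M N) (m ⊗ₜ[R] n)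

/-- Homomorphisms out of a graded tensor product are tested on pure tensors. -/
lemma isHom_of_tmul {P : GrMod Q₃} {f : M.carrier ⊗[R] N.carrier →ₗ[R] P.carrier}
    (hv : ∀ v m n, f (M.vec v m ⊗ₜ[R] n + M.eps m ⊗ₜ[R] N.vec v n) = P.vec v (f (m ⊗ₜ[R] n)))
    (he : ∀ m n, f (M.eps m ⊗ₜ[R] N.eps n) = P.eps (f (m ⊗ₜ[R] n))) :
    IsHom (tensor h M N) P f := by
  have h1 : ∀ v, f ∘ₗ (TensorProduct.map (M.vec v) 1 + TensorProduct.map M.eps (N.vec v)) =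
      P.vec v ∘ₗ f := fun v => TensorProduct.ext' fun m n => hv v m n
  have h2 : f ∘ₗ (TensorProduct.map M.eps N.eps) = P.eps ∘ₗ f :=
    TensorProduct.ext' fun m n => he m n
  exact ⟨fun v x => (congrArg f (LinearMap.congr_fun (tensor_vec h M N v) x)).trans
    (LinearMap.congr_fun (h1 v) x),
    fun x => (congrArg f (LinearMap.congr_fun (tensor_eps h M N) x)).trans
    (LinearMap.congr_fun h2 x)⟩

lemma IsHom.tensor {f : M.carrier →ₗ[R] M'.carrier} {g : N.carrier →ₗ[R] N'.carrier}
    (hf : IsHom M M' f) (hg : IsHom N N' g) :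
    IsHom (tensor h M N) (GrMod.tensor h M' N') (TensorProduct.map f g) := by
  refine isHom_of_tmul h (fun v m n => ?_) fun m n => ?_
  · have e : TensorProduct.map f g (M.vec v m ⊗ₜ[R] n + M.eps m ⊗ₜ[R] N.vec v n) =
        M'.vec v (f m) ⊗ₜ[R] g n + M'.eps (f m) ⊗ₜ[R] N'.vec v (g n) := by
      rw [map_add, TensorProduct.map_tmul, TensorProduct.map_tmul, hf.vec, hf.eps, hg.vec]
    exact e.trans (tensor_vec_tmul h v (f m) (g n)).symm
  · have e : TensorProduct.map f g (M.eps m ⊗ₜ[R] N.eps n) =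
        M'.eps (f m) ⊗ₜ[R] N'.eps (g n) := by
      rw [TensorProduct.map_tmul, hf.eps, hg.eps]
    exact e.trans (tensor_eps_tmul h (f m) (g n)).symm

lemma Splits.tensor {p : Module.End R M.carrier} {q : Module.End R N.carrier} {X : GrMod Q₁}
    {Y : GrMod Q₂} (hX : Splits M p X) (hY : Splits N q Y) :
    Splits (tensor h M N) (TensorProduct.map p q) (GrMod.tensor h X Y) := by
  obtain ⟨i, r, hi, hr, hri, rfl⟩ := hX
  obtain ⟨i', r', hi', hr', hri', rfl⟩ := hY
  refine ⟨TensorProduct.map i i', TensorProduct.map r r', hi.tensor h hi', hr.tensor h hr', ?_,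
    (TensorProduct.map_comp i i' r r').symm⟩
  exact (TensorProduct.map_comp r r' i i').symm.trans (by rw [hri, hri', TensorProduct.map_id]; rfl)

lemma Iso.tensor (hM : Iso M M') (hN : Iso N N') : Iso (tensor h M N) (GrMod.tensor h M' N') := by
  obtain ⟨e, he⟩ := hM
  obtain ⟨f, hf⟩ := hN
  exact ⟨TensorProduct.congr e f, he.tensor h hf⟩

lemma IsNull.tensor_left (hM : M.IsNull) (N : GrMod Q₂) : (tensor h M N).IsNull := by
  obtain ⟨F, hF, hF2⟩ := hM
  refine ⟨TensorProduct.map F 1, ⟨fun v => ?_, ?_⟩, ?_⟩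
  · rw [tensor_vec]
    refine TensorProduct.ext' fun m n => ?_
    change TensorProduct.map F 1 (M.vec v m ⊗ₜ[R] n + M.eps m ⊗ₜ[R] N.vec v n) =
      -(M.vec v (F m) ⊗ₜ[R] n + M.eps (F m) ⊗ₜ[R] N.vec v n)
    simp [hF.vec_apply, hF.eps_apply, TensorProduct.neg_tmul, add_comm]
  · rw [tensor_eps]
    refine TensorProduct.ext' fun m n => ?_
    change (F (M.eps m) ⊗ₜ[R] N.eps n) = -(M.eps (F m) ⊗ₜ[R] N.eps n)
    rw [hF.eps_apply, TensorProduct.neg_tmul]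
  · refine (TensorProduct.map_mul F F 1 1).symm.trans ?_
    rw [hF2, one_mul]; exact TensorProduct.map_one

/-- The operator is ε ⊗ F and not 1 ⊗ F, so that it also anticommutes with v ⊗ 1. -/
lemma IsNull.tensor_right (M : GrMod Q₁) (hN : N.IsNull) : (tensor h M N).IsNull := by
  obtain ⟨F, hF, hF2⟩ := hN
  have hεv : ∀ v m, M.eps (M.vec v m) = -M.vec v (M.eps m) := fun v m => by
    rw [eq_neg_iff_add_eq_zero, ← eq_neg_iff_add_eq_zero.1 (LinearMap.congr_fun (vec_mul_eps M v) m)]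
    rw [add_comm]; rfl
  refine ⟨TensorProduct.map M.eps F, ⟨fun v => ?_, ?_⟩, ?_⟩
  · rw [tensor_vec]
    refine TensorProduct.ext' fun m n => ?_
    change TensorProduct.map M.eps F (M.vec v m ⊗ₜ[R] n + M.eps m ⊗ₜ[R] N.vec v n) =
      -(M.vec v (M.eps m) ⊗ₜ[R] F n + M.eps (M.eps m) ⊗ₜ[R] N.vec v (F n))
    simp [hF.vec_apply, hεv, TensorProduct.neg_tmul, TensorProduct.tmul_neg, add_comm]
  · rw [tensor_eps]
    refine TensorProduct.ext' fun m n => ?_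
    change (M.eps (M.eps m) ⊗ₜ[R] F (N.eps n)) = -(M.eps (M.eps m) ⊗ₜ[R] N.eps (F n))
    rw [hF.eps_apply, TensorProduct.tmul_neg]
  · refine (TensorProduct.map_mul M.eps M.eps F F).symm.trans ?_
    rw [hF2, eps_mul_eps]; exact TensorProduct.map_one

variable [Invertible (2 : R)] [Module.Finite R V] [Module.Projective R V]

include h in
lemma tensor_isFGP (h₁ : Function.Bijective Q₁.polarBilin) (h₂ : Function.Bijective Q₂.polarBilin)
    (h₃ : Function.Bijective Q₃.polarBilin) (hM : M.IsFGP) (hN : N.IsFGP) :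
    (tensor h M N).IsFGP := by
  rw [isFGP_iff h₁] at hM
  rw [isFGP_iff h₂] at hN
  rw [isFGP_iff h₃]
  obtain ⟨h4, h5⟩ := hM
  obtain ⟨h6, h7⟩ := hN
  exact ⟨inferInstanceAs (Module.Finite R (M.carrier ⊗[R] N.carrier)),
    inferInstanceAs (Module.Projective R (M.carrier ⊗[R] N.carrier))⟩

/-- The class of a graded tensor product is additive and depends only on the classes. -/
lemma cls_tensor_dsum_left (h₁ : Function.Bijective Q₁.polarBilin)
    (h₂ : Function.Bijective Q₂.polarBilin) (h₃ : Function.Bijective Q₃.polarBilin)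
    (hM : M.IsFGP) (hM' : M'.IsFGP) (hN : N.IsFGP) :
    (tensor h (M.dsum M') N).cls = (tensor h M N).cls + (tensor h M' N).cls := by
  rw [← cls_dsum (tensor_isFGP h h₁ h₂ h₃ hM hN) (tensor_isFGP h h₁ h₂ h₃ hM' hN)]
  refine Iso.cls_eq ⟨TensorProduct.prodLeft R R M.carrier M'.carrier N.carrier, ?_⟩
  refine isHom_of_tmul h (M := M.dsum M') (fun v m n => ?_) fun m n => ?_
  · refine (map_add (TensorProduct.prodLeft R R M.carrier M'.carrier N.carrier) _ _).trans ?_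
    exact Prod.ext (tensor_vec_tmul h v m.1 n).symm (tensor_vec_tmul h v m.2 n).symm
  · exact Prod.ext (tensor_eps_tmul h m.1 n).symm (tensor_eps_tmul h m.2 n).symm

lemma cls_tensor_dsum_right (h₁ : Function.Bijective Q₁.polarBilin)
    (h₂ : Function.Bijective Q₂.polarBilin) (h₃ : Function.Bijective Q₃.polarBilin)
    (hM : M.IsFGP) (hN : N.IsFGP) (hN' : N'.IsFGP) :
    (tensor h M (N.dsum N')).cls = (tensor h M N).cls + (tensor h M N').cls := by
  rw [← cls_dsum (tensor_isFGP h h₁ h₂ h₃ hM hN) (tensor_isFGP h h₁ h₂ h₃ hM hN')]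
  refine Iso.cls_eq ⟨TensorProduct.prodRight R R M.carrier N.carrier N'.carrier, ?_⟩
  refine isHom_of_tmul h (N := N.dsum N') (fun v m n => ?_) fun m n => ?_
  · refine (map_add (TensorProduct.prodRight R R M.carrier N.carrier N'.carrier) _ _).trans ?_
    exact Prod.ext (tensor_vec_tmul h v m n.1).symm (tensor_vec_tmul h v m n.2).symm
  · exact Prod.ext (tensor_eps_tmul h m n.1).symm (tensor_eps_tmul h m n.2).symm

/-- The class of a graded tensor product depends only on the classes of the factors. -/
theorem cup_cls (h₁ : Function.Bijective Q₁.polarBilin)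
    (h₂ : Function.Bijective Q₂.polarBilin) (h₃ : Function.Bijective Q₃.polarBilin)
    (hM : M.IsFGP) (hN : N.IsFGP) : GrK.cup h M.cls N.cls = (tensor h M N).cls := by
  -- One factor is changed at a time: the null summands that make the two choices isomorphic
  -- contribute null tensor products, of class zero.
  have hl : ∀ {A A' : GrMod Q₁} {B : GrMod Q₂}, A.IsFGP → A'.IsFGP → B.IsFGP → A.cls = A'.cls →
      (tensor h A B).cls = (tensor h A' B).cls := by
    intro A A' B hA hA' hB hcls
    obtain ⟨P, P', hP, hP', hPn, hPn', hiso⟩ := exists_iso_of_cls_eq hA hA' hcls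
    have := (hiso.tensor h (Iso.refl B)).cls_eq
    rwa [cls_tensor_dsum_left h h₁ h₂ h₃ hA hP hB, cls_tensor_dsum_left h h₁ h₂ h₃ hA' hP' hB,
      (hPn.tensor_left h B).cls_eq_zero h₃, (hPn'.tensor_left h B).cls_eq_zero h₃, add_zero,
      add_zero] at this
  have hr : ∀ {A : GrMod Q₁} {B B' : GrMod Q₂}, A.IsFGP → B.IsFGP → B'.IsFGP → B.cls = B'.cls →
      (tensor h A B).cls = (tensor h A B').cls := by
    intro A B B' hA hB hB' hcls
    obtain ⟨P, P', hP, hP', hPn, hPn', hiso⟩ := exists_iso_of_cls_eq hB hB' hcls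
    have := ((Iso.refl A).tensor h hiso).cls_eq
    rwa [cls_tensor_dsum_right h h₁ h₂ h₃ hA hB hP, cls_tensor_dsum_right h h₁ h₂ h₃ hA hB' hP',
      (hPn.tensor_right h A).cls_eq_zero h₃, (hPn'.tensor_right h A).cls_eq_zero h₃, add_zero,
      add_zero] at this
  exact (hl M.cls.rep_isFGP hM N.cls.rep_isFGP M.cls.cls_rep).trans
    (hr hM N.cls.rep_isFGP hN N.cls.cls_rep)

/-- The cup product is biadditive. -/
lemma cup_add_left (h₁ : Function.Bijective Q₁.polarBilin)
    (h₂ : Function.Bijective Q₂.polarBilin) (h₃ : Function.Bijective Q₃.polarBilin)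
    (x x' : GrK Q₁) (y : GrK Q₂) :
    GrK.cup h (x + x') y = GrK.cup h x y + GrK.cup h x' y := by
  obtain ⟨M, hM, rfl⟩ := x.exists_rep
  obtain ⟨M', hM', rfl⟩ := x'.exists_rep
  obtain ⟨N, hN, rfl⟩ := y.exists_rep
  rw [← cls_dsum hM hM', cup_cls h h₁ h₂ h₃ (dsum_isFGP hM hM') hN, cup_cls h h₁ h₂ h₃ hM hN,
    cup_cls h h₁ h₂ h₃ hM' hN, cls_tensor_dsum_left h h₁ h₂ h₃ hM hM' hN]

lemma cup_add_right (h₁ : Function.Bijective Q₁.polarBilin)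
    (h₂ : Function.Bijective Q₂.polarBilin) (h₃ : Function.Bijective Q₃.polarBilin)
    (x : GrK Q₁) (y y' : GrK Q₂) :
    GrK.cup h x (y + y') = GrK.cup h x y + GrK.cup h x y' := by
  obtain ⟨M, hM, rfl⟩ := x.exists_rep
  obtain ⟨N, hN, rfl⟩ := y.exists_rep
  obtain ⟨N', hN', rfl⟩ := y'.exists_rep
  rw [← cls_dsum hN hN', cup_cls h h₁ h₂ h₃ hM (dsum_isFGP hN hN'), cup_cls h h₁ h₂ h₃ hM hN,
    cup_cls h h₁ h₂ h₃ hM hN', cls_tensor_dsum_right h h₁ h₂ h₃ hM hN hN']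

/-- The cup product as a biadditive map. -/
def cupHom (h₁ : Function.Bijective Q₁.polarBilin)
    (h₂ : Function.Bijective Q₂.polarBilin) (h₃ : Function.Bijective Q₃.polarBilin) :
    GrK Q₁ →+ GrK Q₂ →+ GrK Q₃ :=
  AddMonoidHom.mk' (fun x => AddMonoidHom.mk' (GrK.cup h x) (cup_add_right h h₁ h₂ h₃ x))
    fun x x' => AddMonoidHom.ext fun y => cup_add_left h h₁ h₂ h₃ x x' y

lemma cup_clsOf (h₁ : Function.Bijective Q₁.polarBilin)
    (h₂ : Function.Bijective Q₂.polarBilin) (h₃ : Function.Bijective Q₃.polarBilin)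
    (hM : M.IsFGP) (hN : N.IsFGP) {p : Module.End R M.carrier} {q : Module.End R N.carrier}
    (hp : IsHom M M p) (hpp : p * p = p) (hq : IsHom N N q) (hqq : q * q = q) :
    GrK.cup h (M.clsOf p) (N.clsOf q) = (tensor h M N).clsOf (TensorProduct.map p q) := by
  obtain ⟨X, hX⟩ := exists_splits hp hpp
  obtain ⟨Y, hY⟩ := exists_splits hq hqq
  rw [hX.clsOf_eq, hY.clsOf_eq, cup_cls h h₁ h₂ h₃ (hX.isFGP hM) (hY.isFGP hN)]
  exact (hX.tensor h hY).clsOf_eq.symm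

end Tensor

end GrMod

/-! ### Koszul signs -/

section Sign

/-- The sign `(-1)^d` of an element of `ℤ/2`. -/
def paritySign (d : ZMod 2) : ℤ := if d = 0 then 1 else -1

@[simp] lemma paritySign_zero : paritySign 0 = 1 := rfl

lemma paritySign_add (a b : ZMod 2) : paritySign (a + b) = paritySign a * paritySign b := by
  revert a b; decide

lemma paritySign_mul_self (a : ZMod 2) : paritySign a * paritySign a = 1 := by
  revert a; decide

lemma paritySign_one_add (a : ZMod 2) : paritySign (1 + a) = -paritySign a := by
  revert a; decide

lemma paritySign_sum {ι : Type*} (s : Finset ι) (d : ι → ZMod 2) :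
    paritySign (∑ i ∈ s, d i) = ∏ i ∈ s, paritySign (d i) := by
  classical
  induction s using Finset.induction_on with
  | empty => simp
  | insert a s ha ih => rw [Finset.sum_insert ha, Finset.prod_insert ha, paritySign_add, ih]

variable {k : ℕ}

/-- The indicator of `i < j` with values in `ℤ/2`. -/
def ltInd (i j : Fin k) : ZMod 2 := if i < j then 1 else 0

lemma ltInd_self (i : Fin k) : ltInd i i = 0 := if_neg (lt_irrefl i)

lemma ltInd_swap {i j : Fin k} (h : i ≠ j) : ltInd j i = 1 + ltInd i j := by
  unfold ltInd
  rcases h.lt_or_gt with h | h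
  · rw [if_pos h, if_neg h.not_gt]; rfl
  · rw [if_pos h, if_neg h.not_gt]; rfl

/-- The exponent of the Koszul sign. -/
def koszulExp (σ : Equiv.Perm (Fin k)) (d : Fin k → ZMod 2) : ZMod 2 :=
  ∑ i, ∑ j, ltInd i j * ltInd (σ j) (σ i) * d i * d j

lemma koszulSign_eq (σ : Equiv.Perm (Fin k)) (d : Fin k → ZMod 2) :
    GrMod.koszulSign σ d = paritySign (koszulExp σ d) := by
  have h01 : ∀ a : ZMod 2, a ≠ 1 → a = 0 := by decide
  rw [koszulExp, paritySign_sum, GrMod.koszulSign]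
  refine Finset.prod_congr rfl fun i _ => ?_
  rw [paritySign_sum]
  refine Finset.prod_congr rfl fun j _ => ?_
  unfold ltInd
  by_cases h1 : i < j
  · by_cases h2 : σ j < σ i
    · by_cases h3 : d i = 1
      · by_cases h4 : d j = 1
        · rw [if_pos ⟨h1, h2, h3, h4⟩, if_pos h1, if_pos h2, h3, h4]; rfl
        · rw [if_neg fun h => h4 h.2.2.2, h01 _ h4, mul_zero]; rfl
      · rw [if_neg fun h => h3 h.2.2.1, h01 _ h3, mul_zero, zero_mul]; rfl
    · rw [if_neg fun h => h2 h.2.1, if_neg h2, mul_zero, zero_mul, zero_mul]; rfl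
  · rw [if_neg fun h => h1 h.1, if_neg h1, zero_mul, zero_mul, zero_mul]; rfl

/-- Off-diagonal terms occur in equal pairs, which cancel modulo 2. -/
lemma sum_sum_eq_zero_of_symm {h : Fin k → Fin k → ZMod 2} (hs : ∀ i j, h i j = h j i)
    (h0 : ∀ i, h i i = 0) : ∑ i, ∑ j, h i j = 0 := by
  rw [← Finset.sum_product', Finset.univ_product_univ]
  refine Finset.sum_involution (fun p _ => p.swap) (fun p _ => ?_) (fun p _ hp hsw => hp ?_)
    (fun p _ => Finset.mem_univ _) (fun p _ => Prod.swap_swap p)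
  · rw [Prod.fst_swap, Prod.snd_swap, hs p.2 p.1]
    exact CharTwo.add_self_eq_zero _
  · have : p.1 = p.2 := (congrArg Prod.snd hsw)
    rw [this, h0]

/-- The cocycle identity that makes permutations act on graded tensor powers. The discrepancy is a
double sum whose terms turn out symmetric in `i` and `j`; for distinct indices this is a finite
check on three order indicators and two degrees. -/
lemma koszulExp_mul (σ τ : Equiv.Perm (Fin k)) (d : Fin k → ZMod 2) :
    koszulExp (σ * τ) d = koszulExp σ (fun i => d (τ.symm i)) + koszulExp τ d := by
  have h1 : koszulExp σ (fun i => d (τ.symm i)) =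
      ∑ i, ∑ j, ltInd (τ i) (τ j) * ltInd (σ (τ j)) (σ (τ i)) * d i * d j := by
    rw [koszulExp, ← Equiv.sum_comp τ]
    refine Finset.sum_congr rfl fun i _ => ?_
    rw [← Equiv.sum_comp τ]
    simp
  rw [h1, ← sub_eq_zero, CharTwo.sub_eq_add, koszulExp, koszulExp]
  simp only [← Finset.sum_add_distrib]
  refine sum_sum_eq_zero_of_symm (fun i j => ?_) fun i => by simp [ltInd_self]
  by_cases hij : i = j
  · rw [hij]
  rw [ltInd_swap hij, ltInd_swap (τ.injective.ne hij), ltInd_swap (σ.injective.ne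
    (τ.injective.ne hij)), Equiv.Perm.mul_apply, Equiv.Perm.mul_apply,
    ltInd_swap (σ.injective.ne (τ.injective.ne hij))]
  generalize ltInd i j = A
  generalize ltInd (τ i) (τ j) = T
  generalize ltInd (σ (τ i)) (σ (τ j)) = S
  generalize d i = x
  generalize d j = y
  revert A T S x y
  decide

lemma koszulExp_one (d : Fin k → ZMod 2) : koszulExp 1 d = 0 := by
  refine Finset.sum_eq_zero fun i _ => Finset.sum_eq_zero fun j _ => ?_
  unfold ltInd
  rcases lt_trichotomy i j with h | h | h
  · simp [h.not_gt]
  · simp [h]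
  · simp [h.not_gt]

/-- An odd operator at position `j` shifts the degree there by one and takes a sign from the odd
factors before it. The Koszul sign accounts exactly for the change of that sign when position `j`
becomes `σ j`. -/
lemma koszulExp_add_single (σ : Equiv.Perm (Fin k)) (d : Fin k → ZMod 2) (j : Fin k) :
    koszulExp σ (d + Pi.single j 1) + ∑ l, ltInd l j * d l =
      koszulExp σ d + ∑ l, ltInd l (σ j) * d (σ.symm l) := by
  have h1 : koszulExp σ (d + Pi.single j 1) = koszulExp σ d +
      ∑ i, (ltInd i j * ltInd (σ j) (σ i) * d i + ltInd j i * ltInd (σ i) (σ j) * d i) := by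
    have e1 : ∑ i, ∑ l, ltInd i l * ltInd (σ l) (σ i) * d i * (Pi.single j 1 : Fin k → ZMod 2) l =
        ∑ i, ltInd i j * ltInd (σ j) (σ i) * d i := by
      refine Finset.sum_congr rfl fun i _ => ?_
      rw [Finset.sum_eq_single j (fun l _ hl => by rw [Pi.single_eq_of_ne hl, mul_zero])
        (by simp), Pi.single_eq_same, mul_one]
    have e2 : ∑ i, ∑ l, ltInd i l * ltInd (σ l) (σ i) * (Pi.single j 1 : Fin k → ZMod 2) i * d l =
        ∑ i, ltInd j i * ltInd (σ i) (σ j) * d i := by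
      rw [Finset.sum_eq_single j (fun l _ hl => by simp [Pi.single_eq_of_ne hl])
        (by simp)]
      simp
    have e3 : ∑ i, ∑ l, ltInd i l * ltInd (σ l) (σ i) * (Pi.single j 1 : Fin k → ZMod 2) i *
        (Pi.single j 1 : Fin k → ZMod 2) l = 0 := by
      refine Finset.sum_eq_zero fun i _ => Finset.sum_eq_zero fun l _ => ?_
      by_cases hi : i = j
      · by_cases hl : l = j
        · rw [hi, hl, ltInd_self, zero_mul, zero_mul, zero_mul]
        · rw [Pi.single_eq_of_ne hl, mul_zero]
      · rw [Pi.single_eq_of_ne hi, mul_zero, zero_mul]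
    rw [Finset.sum_add_distrib, ← e1, ← e2, ← add_zero (_ + (_ + _)), ← e3, koszulExp, koszulExp]
    simp only [← Finset.sum_add_distrib]
    refine Finset.sum_congr rfl fun i _ => Finset.sum_congr rfl fun l _ => ?_
    simp only [Pi.add_apply]
    ring
  have h2 : ∑ l, ltInd l (σ j) * d (σ.symm l) = ∑ l, ltInd (σ l) (σ j) * d l := by
    rw [← Equiv.sum_comp σ]
    simp
  rw [h1, h2, add_assoc, ← Finset.sum_add_distrib]
  congr 1
  refine Finset.sum_congr rfl fun i _ => ?_
  by_cases hij : i = j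
  · simp [hij, ltInd_self]
  rw [ltInd_swap hij, ltInd_swap (σ.injective.ne hij)]
  generalize ltInd i j = A
  generalize ltInd (σ i) (σ j) = T
  generalize d i = x
  revert A T x
  decide

/-- The quadratic exponent fails to be additive in the degrees by the variation of the sign that
interleaves two families, which is why the shuffle of tensor powers is compatible with permutations.
-/
lemma koszulExp_add (σ : Equiv.Perm (Fin k)) (d e : Fin k → ZMod 2) :
    koszulExp σ (d + e) + ∑ i, ∑ j, ltInd i j * e (σ.symm i) * d (σ.symm j) =
      koszulExp σ d + koszulExp σ e + ∑ i, ∑ j, ltInd i j * e i * d j := by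
  have h1 : ∑ i, ∑ j, ltInd i j * e (σ.symm i) * d (σ.symm j) =
      ∑ i, ∑ j, ltInd (σ i) (σ j) * e i * d j := by
    rw [← Equiv.sum_comp σ]
    refine Finset.sum_congr rfl fun i _ => ?_
    rw [← Equiv.sum_comp σ]
    simp
  have h2 : koszulExp σ (d + e) = koszulExp σ d + koszulExp σ e +
      ∑ i, ∑ j, (ltInd i j * ltInd (σ j) (σ i) + ltInd j i * ltInd (σ i) (σ j)) * e i * d j := by
    have e1 : ∑ i, ∑ j, (ltInd i j * ltInd (σ j) (σ i) + ltInd j i * ltInd (σ i) (σ j)) * e i * d j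
        = ∑ i, ∑ j, ltInd i j * ltInd (σ j) (σ i) * e i * d j +
          ∑ i, ∑ j, ltInd i j * ltInd (σ j) (σ i) * d i * e j := by
      rw [Finset.sum_comm (f := fun i j => ltInd i j * ltInd (σ j) (σ i) * d i * e j)]
      simp only [← Finset.sum_add_distrib]
      exact Finset.sum_congr rfl fun i _ => Finset.sum_congr rfl fun j _ => by ring
    rw [e1, koszulExp, koszulExp, koszulExp]
    simp only [← Finset.sum_add_distrib, Pi.add_apply]
    exact Finset.sum_congr rfl fun i _ => Finset.sum_congr rfl fun j _ => by ring
  rw [h1, h2, add_assoc]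
  congr 1
  simp only [← Finset.sum_add_distrib]
  refine Finset.sum_congr rfl fun i _ => Finset.sum_congr rfl fun j _ => ?_
  by_cases hij : i = j
  · simp [hij, ltInd_self]
  rw [ltInd_swap hij, ltInd_swap (σ.injective.ne hij)]
  generalize ltInd i j = A
  generalize ltInd (σ i) (σ j) = T
  generalize d j = x
  generalize e i = y
  revert A T x y
  decide

end Sign

/-! ### The action of permutations on tensor powers -/

lemma PiTensorProduct.hom_ext_of_span {R : Type*} [CommRing R] {ι : Type*} [Finite ι]
    {X Y : Type*} [AddCommGroup X] [Module R X] [AddCommGroup Y] [Module R Y] {S : Set X}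
    (hS : Submodule.span R S = ⊤) {f g : (⨂[R] _ : ι, X) →ₗ[R] Y}
    (h : ∀ m : ι → X, (∀ i, m i ∈ S) →
      f (PiTensorProduct.tprod R m) = g (PiTensorProduct.tprod R m)) : f = g :=
  PiTensorProduct.ext_of_span_eq_top (γ := fun _ => S) (g := fun _ s => (s : X))
    (fun _ => by simpa using hS) fun j => h _ fun i => (j i).2

namespace GrMod

section Power

variable {R V : Type u} [CommRing R] [AddCommGroup V] [Module R V] {Q : QuadraticForm R V}
  {M N : GrMod Q} {k : ℕ}

/-- Homogeneous elements of degree `d`. -/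
def IsHomog (M : GrMod Q) (d : ZMod 2) (m : M.carrier) : Prop := M.eps m = paritySign d • m

lemma isHomog_neg {d : ZMod 2} {m : M.carrier} (hm : M.IsHomog d m) {f : Module.End R M.carrier}
    (hf : ∀ m, f (M.eps m) = -M.eps (f m)) : M.IsHomog (1 + d) (f m) := by
  have := hf m
  rw [hm, map_zsmul] at this
  rw [IsHomog, paritySign_one_add, neg_smul, this, neg_neg]

lemma isHomog_of_comm {d : ZMod 2} {m : M.carrier} (hm : M.IsHomog d m)
    {f : M.carrier →ₗ[R] N.carrier} (hf : ∀ m, f (M.eps m) = N.eps (f m)) :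
    N.IsHomog d (f m) := by
  rw [IsHomog, ← hf, hm, map_zsmul]

lemma vec_apply_eps (M : GrMod Q) (v : V) (m : M.carrier) :
    M.vec v (M.eps m) = -M.eps (M.vec v m) := LinearMap.congr_fun (vec_mul_eps M v) m

lemma eps_eps (M : GrMod Q) (m : M.carrier) : M.eps (M.eps m) = m :=
  LinearMap.congr_fun (eps_mul_eps M) m

lemma isHom_ofOps {X Y : Type u} [AddCommGroup X] [Module R X] [AddCommGroup Y] [Module R Y]
    {c : V →ₗ[R] Module.End R X} {e : Module.End R X} {hc : ∀ v, c v * c v = Q v • 1}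
    {he : e * e = 1} {hce : ∀ v, c v * e = -(e * c v)}
    {c' : V →ₗ[R] Module.End R Y} {e' : Module.End R Y} {hc' : ∀ v, c' v * c' v = Q v • 1}
    {he' : e' * e' = 1} {hce' : ∀ v, c' v * e' = -(e' * c' v)} {f : X →ₗ[R] Y}
    (hf : ∀ v, f ∘ₗ c v = c' v ∘ₗ f) (hfe : f ∘ₗ e = e' ∘ₗ f) :
    IsHom (ofOps Q X c e hc he hce) (ofOps Q Y c' e' hc' he' hce') f :=
  ⟨fun v x => (congrArg f (LinearMap.congr_fun (vec_ofOps hc he hce v) x)).trans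
      ((LinearMap.congr_fun (hf v) x).trans
        (LinearMap.congr_fun (vec_ofOps hc' he' hce' v) (f x)).symm),
    fun x => (congrArg f (LinearMap.congr_fun (eps_ofOps hc he hce) x)).trans
      ((LinearMap.congr_fun hfe x).trans
        (LinearMap.congr_fun (eps_ofOps hc' he' hce') (f x)).symm)⟩

lemma isOdd_ofOps {X : Type u} [AddCommGroup X] [Module R X]
    {c : V →ₗ[R] Module.End R X} {e : Module.End R X} {hc : ∀ v, c v * c v = Q v • 1}
    {he : e * e = 1} {hce : ∀ v, c v * e = -(e * c v)} {F : Module.End R X}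
    (hF : ∀ v, F * c v = -(c v * F)) (hFe : F * e = -(e * F)) :
    IsOdd (ofOps Q X c e hc he hce) F :=
  ⟨fun v => by rw [vec_ofOps]; exact hF v, by rw [eps_ofOps]; exact hFe⟩

/-- The operator `ε ⊗ ⋯ ⊗ ε ⊗ f ⊗ 1 ⊗ ⋯ ⊗ 1`. -/
def oddAt (M : GrMod Q) (k : ℕ) (j : Fin k) (f : Module.End R M.carrier) :
    Module.End R (⨂[R] _ : Fin k, M.carrier) :=
  PiTensorProduct.map (Function.update (fun l => if l < j then M.eps else 1) j f)

lemma tpow_vec (M : GrMod Q) (k : ℕ) (v : V) :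
    (M.tpow k).vec v = (∑ j, M.oddAt k j (M.vec v) :
      Module.End R (⨂[R] _ : Fin k, M.carrier)) := by
  refine (vec_ofOps _ _ _ v).trans ?_
  rw [LinearMap.sum_apply]; rfl

lemma tpow_eps (M : GrMod Q) (k : ℕ) :
    (M.tpow k).eps = (PiTensorProduct.map fun _ => M.eps :
      Module.End R (⨂[R] _ : Fin k, M.carrier)) := eps_ofOps _ _ _

lemma prod_ite_lt_smul (j : Fin k) (d : Fin k → ZMod 2) :
    ∏ l, (if l < j then paritySign (d l) else 1) = paritySign (∑ l, ltInd l j * d l) := by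
  rw [paritySign_sum]
  refine Finset.prod_congr rfl fun l _ => ?_
  unfold ltInd
  split_ifs <;> simp

lemma oddAt_tprod (j : Fin k) (f : Module.End R M.carrier) {d : Fin k → ZMod 2}
    {m : Fin k → M.carrier} (hm : ∀ i, M.IsHomog (d i) (m i)) :
    M.oddAt k j f (PiTensorProduct.tprod R m) = paritySign (∑ l, ltInd l j * d l) •
      PiTensorProduct.tprod R (Function.update m j (f (m j))) := by
  have h1 : (fun l => (Function.update (fun l => if l < j then M.eps else 1) j f) l (m l)) =
      fun l => ((if l < j then paritySign (d l) else 1 : ℤ) : R) •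
        Function.update m j (f (m j)) l := by
    funext l
    by_cases hl : l = j
    · subst hl; simp
    · by_cases h : l < j
      · rw [Function.update_of_ne hl, if_pos h, if_pos h, Function.update_of_ne hl,
          Int.cast_smul_eq_zsmul]
        exact hm l
      · simp [hl, h]
  rw [oddAt, PiTensorProduct.map_tprod, h1, MultilinearMap.map_smul_univ, ← prod_ite_lt_smul,
    ← Int.cast_prod, Int.cast_smul_eq_zsmul]

variable [Invertible (2 : R)]

lemma proj_apply_of_isHomog {d d' : ZMod 2} {m : M.carrier} (hm : M.IsHomog d m) :
    M.proj d' m = if d' = d then m else 0 := by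
  have h2 : (⅟2 : R) • (m + m) = m := by
    rw [← two_smul R, smul_smul, invOf_mul_self, one_smul]
  have h01 : ∀ a : ZMod 2, a = 0 ∨ a = 1 := by decide
  rw [IsHomog] at hm
  rw [proj]
  rcases h01 d with rfl | rfl <;> rcases h01 d' with rfl | rfl <;>
    simp [hm, paritySign, h2]

lemma isHomog_proj (d : ZMod 2) (m : M.carrier) : M.IsHomog d (M.proj d m) := by
  have h01 : ∀ a : ZMod 2, a = 0 ∨ a = 1 := by decide
  rw [IsHomog, proj]
  rcases h01 d with rfl | rfl
  · simp [eps_eps, paritySign, add_comm]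
  · simp [eps_eps, paritySign, ← smul_neg]

lemma proj_add_proj (m : M.carrier) : M.proj 0 m + M.proj 1 m = m := by
  simp only [proj, if_true, one_ne_zero, if_false, LinearMap.smul_apply]
  rw [← smul_add, LinearMap.add_apply, LinearMap.sub_apply, add_add_sub_cancel,
    Module.End.one_apply, ← two_smul R, smul_smul, invOf_mul_self, one_smul]

lemma span_isHomog (M : GrMod Q) :
    Submodule.span R {m : M.carrier | ∃ d, M.IsHomog d m} = ⊤ := by
  rw [eq_top_iff]
  rintro m -
  rw [← proj_add_proj m]
  exact add_mem (Submodule.subset_span ⟨0, isHomog_proj 0 m⟩)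
    (Submodule.subset_span ⟨1, isHomog_proj 1 m⟩)

lemma tpow_hom_ext {Y : Type*} [AddCommGroup Y] [Module R Y]
    {f g : (⨂[R] _ : Fin k, M.carrier) →ₗ[R] Y}
    (h : ∀ (d : Fin k → ZMod 2) (m : Fin k → M.carrier), (∀ i, M.IsHomog (d i) (m i)) →
      f (PiTensorProduct.tprod R m) = g (PiTensorProduct.tprod R m)) : f = g :=
  PiTensorProduct.hom_ext_of_span (span_isHomog M) fun m hm => by
    choose d hd using hm
    exact h d m hd

/-- On homogeneous tensors a single term of the sum over degree patterns survives. -/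
lemma permAct_tprod (σ : Equiv.Perm (Fin k)) {d : Fin k → ZMod 2} {m : Fin k → M.carrier}
    (hm : ∀ i, M.IsHomog (d i) (m i)) :
    M.permAct k σ (PiTensorProduct.tprod R m) = paritySign (koszulExp σ d) •
      PiTensorProduct.tprod R fun i => m (σ.symm i) := by
  have key : ∀ d' : Fin k → ZMod 2, (koszulSign σ d' •
      ((PiTensorProduct.reindex R (fun _ : Fin k => M.carrier) σ).toLinearMap ∘ₗ
        PiTensorProduct.map fun i => M.proj (d' i))) (PiTensorProduct.tprod R m) =
      koszulSign σ d' • PiTensorProduct.reindex R (fun _ : Fin k => M.carrier) σ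
        (PiTensorProduct.tprod R fun i => M.proj (d' i) (m i)) := fun d' => by
    rw [← PiTensorProduct.map_tprod (fun i => M.proj (d' i))]; rfl
  rw [permAct, LinearMap.sum_apply, Finset.sum_congr rfl fun d' _ => key d',
    Finset.sum_eq_single d]
  · rw [koszulSign_eq]
    have : (fun i => M.proj (d i) (m i)) = m := funext fun i => by
      rw [proj_apply_of_isHomog (hm i), if_pos rfl]
    rw [this, PiTensorProduct.reindex_tprod]
  · intro d' _ hd'
    obtain ⟨i, hi⟩ := Function.ne_iff.1 hd'
    have : PiTensorProduct.tprod R (fun i => M.proj (d' i) (m i)) = 0 :=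
      MultilinearMap.map_coord_zero _ i (by rw [proj_apply_of_isHomog (hm i), if_neg hi])
    rw [this, map_zero]; exact zsmul_zero _
  · simp

lemma permAct_mul (σ τ : Equiv.Perm (Fin k)) :
    M.permAct k (σ * τ) = M.permAct k σ * M.permAct k τ := by
  refine tpow_hom_ext fun d m hm => ?_
  rw [Module.End.mul_apply, permAct_tprod _ hm, permAct_tprod _ hm, map_zsmul,
    permAct_tprod σ (d := fun i => d (τ.symm i)) fun i => hm _, koszulExp_mul, paritySign_add,
    smul_smul, mul_comm]
  rfl

lemma permAct_one : M.permAct k 1 = 1 := by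
  refine tpow_hom_ext fun d m hm => ?_
  rw [permAct_tprod _ hm, koszulExp_one, paritySign_zero, one_smul]
  rfl

/-- With Koszul signs an odd operator moves from position `j` to `σ j` without further sign. Sums
over all positions, such as the action of a vector, therefore commute with permutations. -/
lemma permAct_mul_oddAt (σ : Equiv.Perm (Fin k)) (j : Fin k) {f : Module.End R M.carrier}
    (hf : ∀ m, f (M.eps m) = -M.eps (f m)) :
    M.permAct k σ * M.oddAt k j f = M.oddAt k (σ j) f * M.permAct k σ := by
  refine tpow_hom_ext fun d m hm => ?_
  have hm' : ∀ i, M.IsHomog ((d + Pi.single j 1 : Fin k → ZMod 2) i)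
      (Function.update m j (f (m j)) i) := by
    intro i
    by_cases hi : i = j
    · subst hi
      rw [Function.update_self, Pi.add_apply, Pi.single_eq_same, add_comm]
      exact isHomog_neg (hm i) hf
    · rw [Function.update_of_ne hi, Pi.add_apply, Pi.single_eq_of_ne hi, add_zero]
      exact hm i
  rw [Module.End.mul_apply, Module.End.mul_apply, oddAt_tprod j f hm, permAct_tprod σ hm,
    map_zsmul, map_zsmul, permAct_tprod σ hm',
    oddAt_tprod (σ j) f (d := fun i => d (σ.symm i)) fun i => hm _, smul_smul, smul_smul,
    ← paritySign_add, ← paritySign_add, ← koszulExp_add_single, add_comm]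
  congr 2
  funext i
  by_cases hi : i = σ j
  · subst hi; simp
  · rw [Function.update_of_ne hi, Function.update_of_ne fun h => hi (by rw [← h]; simp)]

lemma permAct_mul_map (σ : Equiv.Perm (Fin k)) {f : Fin k → Module.End R M.carrier}
    (hf : ∀ i m, f i (M.eps m) = M.eps (f i m)) :
    M.permAct k σ * PiTensorProduct.map f =
      PiTensorProduct.map (fun i => f (σ.symm i)) * M.permAct k σ := by
  refine tpow_hom_ext fun d m hm => ?_
  rw [Module.End.mul_apply, Module.End.mul_apply, PiTensorProduct.map_tprod, permAct_tprod σ hm,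
    permAct_tprod σ fun i => isHomog_of_comm (hm i) (hf i), map_zsmul, PiTensorProduct.map_tprod]

lemma isHom_permAct (σ : Equiv.Perm (Fin k)) :
    IsHom (M.tpow k) (M.tpow k) (M.permAct k σ) := by
  have h1 : ∀ v, M.permAct k σ * ∑ j, M.oddAt k j (M.vec v) =
      (∑ j, M.oddAt k j (M.vec v)) * M.permAct k σ := by
    intro v
    rw [Finset.mul_sum, Finset.sum_mul,
      ← Equiv.sum_comp σ fun j => M.oddAt k j (M.vec v) * M.permAct k σ]
    exact Finset.sum_congr rfl fun j _ => permAct_mul_oddAt σ j (vec_apply_eps M v)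
  have h2 := permAct_mul_map (M := M) σ (f := fun _ => M.eps) fun _ _ => rfl
  refine isHom_ofOps (fun v => ?_) h2
  rw [LinearMap.sum_apply]
  exact h1 v

end Power

end GrMod

/-! ### Well-definedness of the exterior powers -/

lemma sum_mul_self_of_anticomm {A ι : Type*} [Ring A] {a : ι → A}
    (h : ∀ i j, i ≠ j → a i * a j = -(a j * a i)) (s : Finset ι) :
    (∑ i ∈ s, a i) * ∑ i ∈ s, a i = ∑ i ∈ s, a i * a i := by
  classical
  induction s using Finset.induction_on with
  | empty => simp
  | insert x s hx ih =>
    have hxs : a x * ∑ i ∈ s, a i = -((∑ i ∈ s, a i) * a x) := by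
      rw [Finset.mul_sum, Finset.sum_mul, ← Finset.sum_neg_distrib]
      exact Finset.sum_congr rfl fun j hj => h x j fun e => hx (e ▸ hj)
    rw [Finset.sum_insert hx, Finset.sum_insert hx, add_mul, mul_add, mul_add, hxs, ih]
    abel

section PiTensor

lemma linearMap_comp_sum {R X Y Z ι : Type*} [CommRing R] [AddCommGroup X] [AddCommGroup Y]
    [AddCommGroup Z] [Module R X] [Module R Y] [Module R Z] (g : Y →ₗ[R] Z) (s : Finset ι)
    (f : ι → X →ₗ[R] Y) : g ∘ₗ ∑ i ∈ s, f i = ∑ i ∈ s, g ∘ₗ f i :=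
  LinearMap.ext fun x => by simp

lemma linearMap_sum_comp {R X Y Z ι : Type*} [CommRing R] [AddCommGroup X] [AddCommGroup Y]
    [AddCommGroup Z] [Module R X] [Module R Y] [Module R Z] (g : X →ₗ[R] Y) (s : Finset ι)
    (f : ι → Y →ₗ[R] Z) : (∑ i ∈ s, f i) ∘ₗ g = ∑ i ∈ s, f i ∘ₗ g :=
  LinearMap.ext fun x => by simp

variable {R : Type*} [CommRing R] {ι : Type*} {X : Type*} [AddCommGroup X] [Module R X]

lemma PiTensorProduct.projective [Finite ι] [Module.Finite R X] [Module.Projective R X] :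
    Module.Projective R (⨂[R] _ : ι, X) := by
  obtain ⟨n, r, i, -, -, h⟩ := Module.Finite.exists_comp_eq_id_of_projective R X
  have : Module.Free R (⨂[R] _ : ι, (Fin n → R)) :=
    Module.Free.of_basis (Basis.piTensorProduct fun _ => Pi.basisFun R (Fin n))
  refine Module.Projective.of_split (PiTensorProduct.map fun _ => i)
    (PiTensorProduct.map fun _ => r) ?_
  rw [← PiTensorProduct.map_comp, h]
  exact PiTensorProduct.map_id

lemma PiTensorProduct.map_eq_zero {f : ι → Module.End R X} (j : ι) (h : f j = 0) :
    (PiTensorProduct.map f : Module.End R (⨂[R] _ : ι, X)) = 0 := by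
  classical
  exact (PiTensorProduct.mapMultilinear R (fun _ : ι => X) fun _ => X).map_coord_zero j h

variable [DecidableEq ι]

/-- For an endomorphism `p`, the operator which is `p` on the factors in `S` and `1 - p` on the
others. -/
def mixedPower (p : Module.End R X) (S : Finset ι) : Module.End R (⨂[R] _ : ι, X) :=
  PiTensorProduct.map (S.piecewise (fun _ => p) fun _ => 1 - p)

lemma mixedPower_empty (p : Module.End R X) :
    mixedPower p (∅ : Finset ι) = PiTensorProduct.map fun _ => 1 - p := by
  rw [mixedPower, Finset.piecewise_empty]

lemma sum_mixedPower [Fintype ι] (p : Module.End R X) : ∑ S : Finset ι, mixedPower p S = 1 := by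
  have h := (PiTensorProduct.mapMultilinear R (fun _ : ι => X) fun _ => X).map_add_univ
    (fun _ => p) fun _ => 1 - p
  have h1 : ((fun _ => p) + fun _ => 1 - p : ι → Module.End R X) = fun _ => 1 :=
    funext fun _ => by simp
  rw [h1] at h
  exact h.symm.trans PiTensorProduct.map_one

lemma map_update_mul_mixedPower {p : Module.End R X} (hp : p * p = p) (j : ι) (S : Finset ι) :
    PiTensorProduct.map (Function.update (fun _ => 1) j p) * mixedPower p S =
      if j ∈ S then mixedPower p S else 0 := by
  rw [mixedPower, ← PiTensorProduct.map_mul]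
  split_ifs with h
  · congr 1
    funext l
    by_cases hl : l = j
    · subst hl; simp [h, hp]
    · simp [hl]
  · exact PiTensorProduct.map_eq_zero j (by simp [h, mul_sub, hp])

/-- The sum over all positions of `p` counts the factors lying in the image of `p`. -/
lemma sum_update_mul_mixedPower [Fintype ι] {p : Module.End R X} (hp : p * p = p) (S : Finset ι) :
    (∑ j, PiTensorProduct.map (Function.update (fun _ => 1) j p)) * mixedPower p S =
      (S.card : R) • mixedPower p S := by
  rw [Finset.sum_mul, Finset.sum_congr rfl fun j _ => map_update_mul_mixedPower hp j S,
    ← Finset.sum_filter, Finset.sum_const, Finset.filter_mem_eq_inter, Finset.univ_inter,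
    Nat.cast_smul_eq_nsmul]

end PiTensor

namespace GrMod

section Power

variable {R V : Type u} [CommRing R] [AddCommGroup V] [Module R V] {Q : QuadraticForm R V}
  {M N : GrMod Q} {k : ℕ}

lemma oddAt_mul_oddAt {f g : Module.End R M.carrier} (hf : f * M.eps = -(M.eps * f))
    (hg : g * M.eps = -(M.eps * g)) {i j : Fin k} (hij : i = j → f * g = -(g * f)) :
    M.oddAt k i f * M.oddAt k j g = -(M.oddAt k j g * M.oddAt k i f) := by
  rw [oddAt, oddAt, ← PiTensorProduct.map_mul, ← PiTensorProduct.map_mul]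
  rcases lt_trichotomy i j with h | h | h
  · refine map_eq_neg_map _ _ i (by simp [h, h.ne, hf]) fun l hl => ?_
    by_cases hlj : l = j
    · subst hlj; simp [hl, not_lt.2 h.le]
    · by_cases h1 : l < i <;> by_cases h2 : l < j <;> simp [hl, hlj, h1, h2]
  · subst h
    refine map_eq_neg_map _ _ i (by simp [hij rfl]) fun l hl => ?_
    by_cases h1 : l < i <;> simp [hl, h1]
  · refine map_eq_neg_map _ _ j (by simp [h, h.ne, hg]) fun l hl => ?_
    by_cases hlj : l = i
    · subst hlj; simp [hl, not_lt.2 h.le]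
    · by_cases h1 : l < i <;> by_cases h2 : l < j <;> simp [hl, hlj, h1, h2]

lemma oddAt_mul_map_eps {f : Module.End R M.carrier} (hf : f * M.eps = -(M.eps * f)) (j : Fin k) :
    M.oddAt k j f * PiTensorProduct.map (fun _ => M.eps) =
      -(PiTensorProduct.map (fun _ => M.eps) * M.oddAt k j f) := by
  rw [oddAt, ← PiTensorProduct.map_mul, ← PiTensorProduct.map_mul]
  refine map_eq_neg_map _ _ j (by simp [hf]) fun l hl => ?_
  by_cases h1 : l < j <;> simp [hl, h1]

lemma oddAt_mul_self (f : Module.End R M.carrier) (j : Fin k) :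
    M.oddAt k j f * M.oddAt k j f =
      PiTensorProduct.map (Function.update (fun _ => 1) j (f * f)) := by
  rw [oddAt, ← PiTensorProduct.map_mul]
  congr 1
  funext l
  by_cases hl : l = j
  · subst hl; simp
  · by_cases h1 : l < j <;> simp [hl, h1, eps_mul_eps]

lemma oddAt_mul_map {f : Module.End R M.carrier} {g : Fin k → Module.End R M.carrier}
    (hg : ∀ i, g i * M.eps = M.eps * g i) (hfg : ∀ i, g i * f = f * g i) (j : Fin k) :
    M.oddAt k j f * PiTensorProduct.map g = PiTensorProduct.map g * M.oddAt k j f := by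
  rw [oddAt, ← PiTensorProduct.map_mul, ← PiTensorProduct.map_mul]
  congr 1
  funext l
  by_cases hl : l = j
  · subst hl; simp [hfg]
  · by_cases h1 : l < j <;> simp [hl, h1, hg]

lemma IsOdd.tpow {F : Module.End R M.carrier} (hF : M.IsOdd F) (k : ℕ) :
    (M.tpow k).IsOdd (∑ j, M.oddAt k j F : Module.End R (⨂[R] _ : Fin k, M.carrier)) := by
  refine isOdd_ofOps (fun v => ?_) ?_
  · rw [LinearMap.sum_apply, Finset.sum_mul_sum, Finset.sum_mul_sum, Finset.sum_comm,
      ← Finset.sum_neg_distrib]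
    refine Finset.sum_congr rfl fun i _ => ?_
    rw [← Finset.sum_neg_distrib]
    exact Finset.sum_congr rfl fun j _ =>
      oddAt_mul_oddAt hF.eps (vec_mul_eps M v) fun _ => hF.vec v
  · rw [Finset.sum_mul, Finset.mul_sum, ← Finset.sum_neg_distrib]
    exact Finset.sum_congr rfl fun j _ => oddAt_mul_map_eps hF.eps j

lemma IsHom.tpow {f : M.carrier →ₗ[R] N.carrier} (hf : IsHom M N f) (k : ℕ) :
    IsHom (M.tpow k) (N.tpow k) (PiTensorProduct.map fun _ => f) := by
  refine isHom_ofOps (fun v => ?_) ?_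
  · have h : ∀ j : Fin k, PiTensorProduct.map (fun _ => f) ∘ₗ M.vecAt k j v =
        N.vecAt k j v ∘ₗ PiTensorProduct.map (fun _ => f) := ?_
    · rw [LinearMap.sum_apply, LinearMap.sum_apply, linearMap_comp_sum, linearMap_sum_comp]
      exact Finset.sum_congr rfl fun j _ => h j
    intro j
    rw [vecAt_apply, vecAt_apply, ← PiTensorProduct.map_comp, ← PiTensorProduct.map_comp]
    congr 1
    funext l
    by_cases hl : l = j
    · subst hl; ext x; simp [hf.vec]
    · by_cases h1 : l < j
      · ext x; simp [hl, h1, hf.eps]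
      · ext x; simp [hl, h1]
  · rw [epsPow, epsPow, ← PiTensorProduct.map_comp, ← PiTensorProduct.map_comp]
    congr 1
    funext l
    ext x; simp [hf.eps]

variable [Invertible (2 : R)]

lemma tpow_isFGP [Module.Finite R V] [Module.Projective R V] (hQ : Function.Bijective Q.polarBilin)
    (hkQ : Function.Bijective (k • Q).polarBilin) (hM : M.IsFGP) : (M.tpow k).IsFGP := by
  obtain ⟨h1, h2⟩ := (isFGP_iff hQ M).1 hM
  exact (isFGP_iff hkQ _).2 ⟨inferInstanceAs (Module.Finite R (⨂[R] _ : Fin k, M.carrier)),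
    PiTensorProduct.projective (R := R) (ι := Fin k) (X := M.carrier)⟩

lemma permAct_map (σ : Equiv.Perm (Fin k)) {f : M.carrier →ₗ[R] N.carrier}
    (hf : ∀ m, f (M.eps m) = N.eps (f m)) :
    N.permAct k σ ∘ₗ PiTensorProduct.map (fun _ => f) =
      PiTensorProduct.map (fun _ => f) ∘ₗ M.permAct k σ := by
  refine tpow_hom_ext fun d m hm => ?_
  rw [LinearMap.comp_apply, LinearMap.comp_apply, PiTensorProduct.map_tprod, permAct_tprod σ hm,
    permAct_tprod σ fun i => isHomog_of_comm (hm i) hf, map_zsmul, PiTensorProduct.map_tprod]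

variable {B : Type*} [CommRing B]

/-- The representation of the group algebra of the symmetric group on a tensor power. -/
def permRep (M : GrMod Q) (f : B →+* R) (k : ℕ) :
    PermAlg B k →+* Module.End R (⨂[R] _ : Fin k, M.carrier) :=
  ((MonoidAlgebra.lift R (Module.End R (⨂[R] _ : Fin k, M.carrier)) (Equiv.Perm (Fin k))
    { toFun := M.permAct k, map_one' := permAct_one, map_mul' := permAct_mul } : _ →ₐ[R] _) :
      MonoidAlgebra R (Equiv.Perm (Fin k)) →+* _).comp (MonoidAlgebra.mapRingHom _ f)

variable (f : B →+* R)

lemma permRep_of (σ : Equiv.Perm (Fin k)) : M.permRep f k (.of σ) = M.permAct k σ := by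
  simp [permRep, PermAlg.of]

lemma permRep_smul (b : B) (x : PermAlg B k) :
    M.permRep f k (b • x) = f b • M.permRep f k x := by
  have h : M.permRep f k (b • 1) = f b • 1 := by
    simp [permRep, MonoidAlgebra.one_def, permAct_one]
  rw [← one_mul x, ← smul_mul_assoc, map_mul, h, one_mul, smul_mul_assoc, one_mul]

lemma permRep_eq_sum (x : PermAlg B k) :
    M.permRep f k x = ∑ σ, f (x.coeff σ) • M.permAct k σ := by
  conv_lhs => rw [PermAlg.eq_sum_of x]
  rw [map_sum]
  exact Finset.sum_congr rfl fun σ _ => by rw [permRep_smul, permRep_of]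

lemma isHom_permRep (x : PermAlg B k) : IsHom (M.tpow k) (M.tpow k) (M.permRep f k x) := by
  have h : IsHom (M.tpow k) (M.tpow k) (∑ σ, f (x.coeff σ) • M.permAct k σ) :=
    IsHom.sum _ fun σ _ => (isHom_permAct σ).smul _
  exact permRep_eq_sum (M := M) f x ▸ h

lemma permRep_map (x : PermAlg B k) {g : M.carrier →ₗ[R] N.carrier}
    (hg : ∀ m, g (M.eps m) = N.eps (g m)) :
    N.permRep f k x ∘ₗ PiTensorProduct.map (fun _ => g) =
      PiTensorProduct.map (fun _ => g) ∘ₗ M.permRep f k x := by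
  rw [permRep_eq_sum, permRep_eq_sum, linearMap_sum_comp, linearMap_comp_sum]
  refine Finset.sum_congr rfl fun σ _ => ?_
  rw [LinearMap.smul_comp, LinearMap.comp_smul, permAct_map σ hg]

lemma permRep_mul_comm (x : PermAlg B k) {G : Module.End R (⨂[R] _ : Fin k, M.carrier)}
    (hG : ∀ σ, M.permAct k σ * G = G * M.permAct k σ) :
    M.permRep f k x * G = G * M.permRep f k x := by
  rw [permRep_eq_sum, Finset.sum_mul, Finset.mul_sum]
  exact Finset.sum_congr rfl fun σ _ => by rw [smul_mul_assoc, mul_smul_comm, hG]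

lemma permRep_idem {x : PermAlg B k} (hx : x * x = x) :
    M.permRep f k x * M.permRep f k x = M.permRep f k x := by rw [← map_mul, hx]

/-- The graded exterior power is the summand of the tensor power cut out by the sign idempotent. -/
lemma splits_extPow (hB : IsUnit (k.factorial : B)) (M : GrMod Q) :
    Splits (M.tpow k) (M.permRep f k (PermAlg.signIdem B k)) (M.extPow k) := by
  have hP := isHom_permRep (M := M) f (PermAlg.signIdem B k)
  refine splits_quotient hP (permRep_idem f (PermAlg.signIdem_mul_self hB)) _ fun m => ⟨?_, ?_⟩
  · have hle : Submodule.span (ClTensor (k • Q) 1)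
        {x : (M.tpow k).carrier | ∃ (m : ⨂[R] _ : Fin k, M.carrier) (σ : Equiv.Perm (Fin k)),
          x = m - (Equiv.Perm.sign σ : ℤ) • M.permAct k σ m} ≤ LinearMap.ker hP.toLinearMap := by
      rw [Submodule.span_le]
      rintro _ ⟨m, σ, rfl⟩
      have h := congrArg (M.permRep f k) (PermAlg.signIdem_mul_of (B := B) σ)
      rw [map_mul, permRep_of, map_zsmul] at h
      have h' : M.permRep f k (PermAlg.signIdem B k) (M.permAct k σ m) =
        (Equiv.Perm.sign σ : ℤ) • M.permRep f k (PermAlg.signIdem B k) m := LinearMap.congr_fun h m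
      change M.permRep f k (PermAlg.signIdem B k)
        (m - (Equiv.Perm.sign σ : ℤ) • M.permAct k σ m) = 0
      rw [map_sub, map_zsmul, h', smul_smul, ← Units.val_mul, Int.units_mul_self, Units.val_one,
        one_smul, sub_self]
    exact fun hm => hle hm
  · intro hm
    -- An element with zero antisymmetrisation is the average over σ of the relations m − sign(σ)
    -- σm.
    have h1 : ∀ m : ⨂[R] _ : Fin k, M.carrier, M.permRep f k (PermAlg.signIdem B k) m = 0 →
        m = f (Ring.inverse (k.factorial : B)) • ∑ σ : Equiv.Perm (Fin k),
          (m - (Equiv.Perm.sign σ : ℤ) • M.permAct k σ m) := by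
      intro m h3
      have h2 : M.permRep f k (PermAlg.signIdem B k) m = f (Ring.inverse (k.factorial : B)) •
          ∑ σ, (Equiv.Perm.sign σ : ℤ) • M.permAct k σ m := by
        rw [PermAlg.signIdem, permRep_smul, map_sum, LinearMap.smul_apply, LinearMap.sum_apply]
        congr 1
        refine Finset.sum_congr rfl fun σ _ => ?_
        rw [map_zsmul, permRep_of]; rfl
      rw [Finset.sum_sub_distrib, smul_sub, ← h2]
      rw [h3, sub_zero, Finset.sum_const, Finset.card_univ, Fintype.card_perm, Fintype.card_fin,
        ← Nat.cast_smul_eq_nsmul R, smul_smul, ← map_natCast f, ← map_mul,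
        Ring.inverse_mul_cancel _ hB, map_one, one_smul]
    let S := Submodule.span (ClTensor (k • Q) 1)
      {x : (M.tpow k).carrier | ∃ (m : ⨂[R] _ : Fin k, M.carrier) (σ : Equiv.Perm (Fin k)),
          x = m - (Equiv.Perm.sign σ : ℤ) • M.permAct k σ m}
    let g : (⨂[R] _ : Fin k, M.carrier) → Equiv.Perm (Fin k) → ⨂[R] _ : Fin k, M.carrier :=
      fun m σ => m - (Equiv.Perm.sign σ : ℤ) • M.permAct k σ m
    have h4 := S.sum_mem (t := Finset.univ) (f := g m) fun σ _ => Submodule.subset_span ⟨m, σ, rfl⟩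
    have h5 := S.smul_of_tower_mem (f (Ring.inverse (k.factorial : B))) h4
    exact Eq.mp (congrArg (· ∈ S) (h1 m hm).symm) h5

end Power

end GrMod

/-! ### Null summands do not affect tensor powers. -/

namespace GrMod

section Power

variable {R V : Type u} [CommRing R] [AddCommGroup V] [Module R V] {Q : QuadraticForm R V}
  {M N P : GrMod Q} {k : ℕ} [Invertible (2 : R)]

lemma permAct_mul_mixedPower {p : Module.End R M.carrier} (hp : ∀ m, p (M.eps m) = M.eps (p m))
    (σ : Equiv.Perm (Fin k)) (S : Finset (Fin k)) :
    M.permAct k σ * mixedPower p S = mixedPower p (σ.finsetCongr S) * M.permAct k σ := by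
  rw [mixedPower, permAct_mul_map σ, mixedPower]
  · congr 2
    funext i
    by_cases h : σ.symm i ∈ S
    · rw [Finset.piecewise_eq_of_mem _ _ _ h, Finset.piecewise_eq_of_mem]
      simpa [Equiv.finsetCongr_apply, Finset.mem_map_equiv] using h
    · rw [Finset.piecewise_eq_of_notMem _ _ _ h, Finset.piecewise_eq_of_notMem]
      simpa [Equiv.finsetCongr_apply, Finset.mem_map_equiv] using h
  · intro i m
    by_cases h : i ∈ S <;> simp [h, hp]

variable {B : Type*} [CommRing B] {f : B →+* R}

/-- On a graded module with an odd operator whose square is an idempotent `p`, the part of the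
tensor power on which at least one factor lies in the image of `p` has class zero. -/
lemma isNull_of_splits_mixedPower (hQ : (k • Q).IsOriented) (hk : IsUnit (k.factorial : R))
    {F p : Module.End R M.carrier} (hF : M.IsOdd F) (hFF : F * F = p) (hpp : p * p = p)
    {s : PermAlg B k} {X : GrMod (k • Q)} (h : Splits (M.tpow k) (M.permRep f k s * (1 - mixedPower p ∅)) X) : X.IsNull := by
  have hpe : ∀ m, p (M.eps m) = M.eps (p m) := fun m => by
    rw [← hFF, Module.End.mul_apply, hF.eps_apply, map_neg, hF.eps_apply, neg_neg]; rfl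
  have hpe' : p * M.eps = M.eps * p := LinearMap.ext hpe
  have hFp : p * F = F * p := by rw [← hFF, mul_assoc]
  let E : Finset (Fin k) → Module.End R (⨂[R] _ : Fin k, M.carrier) := mixedPower p
  -- The odd operator that will be inverted: `F` summed over all positions. The cross terms of its
  -- square cancel, which leaves the operator `D` counting the factors in the image of `p`.
  let G : Module.End R (⨂[R] _ : Fin k, M.carrier) := ∑ j, M.oddAt k j F
  let D : Module.End R (⨂[R] _ : Fin k, M.carrier) :=
    ∑ j, PiTensorProduct.map (Function.update (fun _ => 1) j p)
  -- The inverse of the counting operator off `S = ∅`, where the counts lie between 1 and `k`. The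
  -- coefficient at `S = ∅` does not matter for `D * C`, as `D` vanishes on that part. Since `G * G
  -- = D`, the product `G * C` inverts `G`.
  let C : Module.End R (⨂[R] _ : Fin k, M.carrier) := ∑ S, Ring.inverse (S.card : R) • E S
  have hGG : G * G = D := by
    refine (sum_mul_self_of_anticomm (fun i j hij => oddAt_mul_oddAt hF.eps hF.eps
      fun h => absurd h hij) _).trans (Finset.sum_congr rfl fun j _ => ?_)
    rw [oddAt_mul_self, hFF]
  have hDC : D * C = 1 - E ∅ := by
    have h1 : ∀ S, D * (Ring.inverse (S.card : R) • E S) = if S = ∅ then 0 else E S := by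
      intro S
      rw [mul_smul_comm, sum_update_mul_mixedPower hpp, smul_smul]
      split_ifs with hS
      · rw [hS, Finset.card_empty, Nat.cast_zero, mul_zero, zero_smul]
      · rw [Ring.inverse_mul_cancel, one_smul]
        exact PermAlg.isUnit_of_le hk (Finset.card_pos.2 (Finset.nonempty_iff_ne_empty.2 hS))
          ((Finset.card_le_univ S).trans_eq (Fintype.card_fin k))
    rw [Finset.mul_sum, Finset.sum_congr rfl fun S _ => h1 S, eq_sub_iff_add_eq,
      ← sum_mixedPower p, ← Finset.add_sum_erase Finset.univ (mixedPower p) (Finset.mem_univ ∅),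
      add_comm]
    congr 1
    rw [← Finset.add_sum_erase _ _ (Finset.mem_univ ∅), if_pos rfl, zero_add]
    exact Finset.sum_congr rfl fun S hS => if_neg (Finset.ne_of_mem_erase hS)
  have hGE : ∀ S, G * E S = E S * G := fun S => by
    rw [Finset.sum_mul, Finset.mul_sum]
    refine Finset.sum_congr rfl fun j _ => oddAt_mul_map (fun i => ?_) (fun i => ?_) j
    · by_cases h : i ∈ S <;> simp [h, sub_mul, mul_sub, hpe']
    · by_cases h : i ∈ S <;> simp [h, sub_mul, mul_sub, hFp]
  have hGC : G * C = C * G := by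
    rw [Finset.mul_sum _ _ G, Finset.sum_mul _ _ G]
    exact Finset.sum_congr rfl fun S _ => by rw [mul_smul_comm, smul_mul_assoc, hGE]
  have hEE : E ∅ * E ∅ = E ∅ := by
    change mixedPower p ∅ * mixedPower p ∅ = mixedPower p ∅
    rw [mixedPower_empty, ← PiTensorProduct.map_mul]
    congr 1
    funext i
    simp [mul_sub, sub_mul, hpp]
  have hEC : E ∅ * C = C * E ∅ := by
    rw [Finset.sum_mul, Finset.mul_sum]
    refine Finset.sum_congr rfl fun S _ => ?_
    rw [mul_smul_comm, smul_mul_assoc]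
    congr 1
    change mixedPower p ∅ * mixedPower p S = mixedPower p S * mixedPower p ∅
    rw [mixedPower, mixedPower, ← PiTensorProduct.map_mul, ← PiTensorProduct.map_mul]
    congr 1
    funext i
    by_cases h : i ∈ S <;> simp [h, mul_sub, sub_mul]
  have hρE : M.permRep f k s * E ∅ = E ∅ * M.permRep f k s :=
    permRep_mul_comm f s fun σ => by
      have := permAct_mul_mixedPower hpe σ ∅
      rwa [show σ.finsetCongr ∅ = ∅ by simp] at this
  have hρC : M.permRep f k s * C = C * M.permRep f k s :=
    permRep_mul_comm f s fun σ => by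
      rw [Finset.sum_mul, Finset.mul_sum]
      refine Fintype.sum_equiv σ.finsetCongr _ _ fun S => ?_
      rw [mul_smul_comm, smul_mul_assoc, permAct_mul_mixedPower hpe,
        Equiv.finsetCongr_apply, Finset.card_map]
  have hρG : M.permRep f k s * G = G * M.permRep f k s :=
    permRep_mul_comm f s fun σ => by
      rw [Finset.sum_mul, Finset.mul_sum]
      exact Fintype.sum_equiv σ _ _ fun j => permAct_mul_oddAt σ j hF.eps_apply
  have h1 : G * (1 - E ∅) = (1 - E ∅) * G := by rw [mul_sub, sub_mul, hGE, mul_one, one_mul]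
  have h2 : C * (1 - E ∅) = (1 - E ∅) * C := by rw [mul_sub, sub_mul, hEC, mul_one, one_mul]
  have h3 : M.permRep f k s * (1 - E ∅) = (1 - E ∅) * M.permRep f k s := by
    rw [mul_sub, sub_mul, hρE, mul_one, one_mul]
  have h4 : (1 - E ∅) * (1 - E ∅) = 1 - E ∅ := by
    rw [sub_mul, one_mul, mul_sub, mul_one, hEE, sub_self, sub_zero]
  have hG : G * (M.permRep f k s * (1 - E ∅)) = M.permRep f k s * (1 - E ∅) * G := by
    rw [← mul_assoc, ← hρG, mul_assoc, h1, mul_assoc]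
  have hC : C * (M.permRep f k s * (1 - E ∅)) = M.permRep f k s * (1 - E ∅) * C := by
    rw [← mul_assoc, ← hρC, mul_assoc, h2, mul_assoc]
  have hDC' : G * (G * C) * (M.permRep f k s * (1 - E ∅)) = M.permRep f k s * (1 - E ∅) := by
    rw [show G * (G * C) = 1 - E ∅ by rw [← mul_assoc, hGG, hDC], h3, ← mul_assoc, h4]
  refine h.isNull hQ (G := G * C) (hF.tpow k) hG ?_ hDC' ?_
  · change G * C * (M.permRep f k s * (1 - E ∅)) = M.permRep f k s * (1 - E ∅) * (G * C)
    rw [mul_assoc, hC, ← mul_assoc, hG, mul_assoc]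
  · change G * C * G * (M.permRep f k s * (1 - E ∅)) = _
    rw [mul_assoc G C G, ← hGC]
    exact hDC'

variable [Module.Finite R V] [Module.Projective R V]

/-- The summands of tensor powers cut out by idempotents of the group algebra of the symmetric
group do not change, in the graded Grothendieck group, on adding a module of class zero. -/
lemma clsOf_permRep_dsum (hQ : Function.Bijective Q.polarBilin) (hkQ : (k • Q).IsOriented)
    (hk : IsUnit (k.factorial : R)) (hM : M.IsFGP) (hP : P.IsFGP) (hP' : P.IsNull)
    {s : PermAlg B k} (hs : s * s = s) :
    ((M.dsum P).tpow k).clsOf ((M.dsum P).permRep f k s) = (M.tpow k).clsOf (M.permRep f k s) := by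
  obtain ⟨F, hF, hFF⟩ := hP'
  -- The odd involution of `P` extended by zero to `M`; its square is the projection onto `P`.
  let F' : Module.End R (M.dsum P).carrier :=
    LinearMap.inr R M.carrier P.carrier ∘ₗ F ∘ₗ LinearMap.snd R M.carrier P.carrier
  let p : Module.End R (M.dsum P).carrier :=
    LinearMap.inr R M.carrier P.carrier ∘ₗ LinearMap.snd R M.carrier P.carrier
  let q : Module.End R (M.dsum P).carrier :=
    LinearMap.inl R M.carrier P.carrier ∘ₗ LinearMap.fst R M.carrier P.carrier
  have hF' : (M.dsum P).IsOdd F' := by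
    constructor
    · exact fun v => LinearMap.ext fun x =>
        (congrArg (fun y => LinearMap.inr R M.carrier P.carrier (F y))
          ((isHom_snd M P).vec v x)).trans ((congrArg (LinearMap.inr R M.carrier P.carrier)
          (hF.vec_apply v _)).trans ((map_neg (LinearMap.inr R M.carrier P.carrier) _).trans
          (congrArg Neg.neg ((isHom_inr M P).vec v _))))
    · exact LinearMap.ext fun x =>
        (congrArg (fun y => LinearMap.inr R M.carrier P.carrier (F y))
          ((isHom_snd M P).eps x)).trans ((congrArg (LinearMap.inr R M.carrier P.carrier)
          (hF.eps_apply _)).trans ((map_neg (LinearMap.inr R M.carrier P.carrier) _).trans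
          (congrArg Neg.neg ((isHom_inr M P).eps _))))
  have hFFx : ∀ x, F (F x) = x := LinearMap.congr_fun hFF
  have hFF' : F' * F' = p := LinearMap.ext fun x =>
    congrArg (LinearMap.inr R M.carrier P.carrier) (hFFx x.2)
  have hpp : p * p = p := rfl
  have hq : 1 - p = q := LinearMap.ext fun x => Prod.ext (sub_zero x.1) (sub_self x.2)
  have hqe : ∀ x, q ((M.dsum P).eps x) = (M.dsum P).eps (q x) :=
    ((isHom_inl M P).comp (isHom_fst M P)).eps
  have hE : mixedPower p (∅ : Finset (Fin k)) = PiTensorProduct.map fun _ => q := by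
    rw [mixedPower_empty, hq]
  have hEE : mixedPower p (∅ : Finset (Fin k)) * mixedPower p ∅ = mixedPower p ∅ := by
    rw [hE, ← PiTensorProduct.map_mul, ← hq]
    congr 1
    funext i
    simp [mul_sub, sub_mul, hpp]
  have hEh : IsHom ((M.dsum P).tpow k) ((M.dsum P).tpow k) (mixedPower p (∅ : Finset (Fin k))) := by
    rw [hE]; exact ((isHom_inl M P).comp (isHom_fst M P)).tpow k
  have hρE : (M.dsum P).permRep f k s * mixedPower p ∅ =
      mixedPower p ∅ * (M.dsum P).permRep f k s := by
    rw [hE]; exact permRep_map f s hqe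
  let ρ := (M.dsum P).permRep f k s
  let E : Module.End R (⨂[R] _ : Fin k, (M.dsum P).carrier) := mixedPower p ∅
  have hρρ : ρ * ρ = ρ := permRep_idem f hs
  have hρh : IsHom ((M.dsum P).tpow k) ((M.dsum P).tpow k) ρ := isHom_permRep f s
  have h4 : (1 - E) * (1 - E) = 1 - E := by
    rw [sub_mul, one_mul, mul_sub, mul_one, hEE, sub_self, sub_zero]
  have h5 : E * (1 - E) = 0 := by rw [mul_sub, hEE, mul_one, sub_self]
  have h6 : (1 - E) * E = 0 := by rw [sub_mul, hEE, one_mul, sub_self]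
  have hρ' : ρ * (1 - E) = (1 - E) * ρ := by rw [mul_sub, sub_mul, hρE, mul_one, one_mul]
  have hi1 : ρ * E * (ρ * E) = ρ * E := by
    rw [mul_assoc, ← mul_assoc E, ← hρE, mul_assoc, hEE, ← mul_assoc, hρρ]
  have hi2 : ρ * (1 - E) * (ρ * (1 - E)) = ρ * (1 - E) := by
    rw [mul_assoc, ← mul_assoc (1 - E), ← hρ', mul_assoc, h4, ← mul_assoc, hρρ]
  have hi3 : ρ * E * (ρ * (1 - E)) = 0 := by
    rw [mul_assoc, ← mul_assoc E, ← hρE, mul_assoc, h5, mul_zero, mul_zero]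
  have hi4 : ρ * (1 - E) * (ρ * E) = 0 := by
    rw [mul_assoc, ← mul_assoc (1 - E), ← hρ', mul_assoc, h6, mul_zero, mul_zero]
  have hFG := tpow_isFGP (k := k) hQ hkQ.nondegenerate (dsum_isFGP hM hP)
  let E' : Module.End R (⨂[R] _ : Fin k, (M.dsum P).carrier) := ρ * (1 - E)
  have hh1 : IsHom ((M.dsum P).tpow k) ((M.dsum P).tpow k) E' :=
    hρh.mul ((IsHom.one _).sub hEh)
  obtain ⟨Y, hY⟩ := exists_splits hh1 hi2
  have hnull : Y.cls = 0 := (isNull_of_splits_mixedPower hkQ hk hF' hFF' hpp hY).cls_eq_zero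
    hkQ.nondegenerate
  -- The first term keeps all factors in `M`; the second, with at least one factor in `P`, splits
  -- off a null module.
  have hsum : ρ = ρ * E + E' := by change ρ = ρ * E + ρ * (1 - E); rw [← mul_add, add_sub_cancel, mul_one]
  have hsplit := clsOf_add hFG (hρh.mul hEh) hh1 hi1 hi2 hi3 hi4
  refine ((congrArg _ hsum).trans (hsplit.trans ?_))
  rw [hY.clsOf_eq, hnull, add_zero]
  have hfst : (PiTensorProduct.map fun _ : Fin k => LinearMap.fst R M.carrier P.carrier) ∘ₗ
      PiTensorProduct.map (fun _ => LinearMap.inl R M.carrier P.carrier) = LinearMap.id := by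
    rw [← PiTensorProduct.map_comp]
    exact PiTensorProduct.map_id
  have hnat := permRep_map (M := M) (N := M.dsum P) (k := k) f s
    (g := LinearMap.inl R M.carrier P.carrier) (isHom_inl M P).eps
  -- The tensor powers of the inclusion of `M` and of the projection to `M` identify the remaining
  -- summand with the one inside the tensor power of `M`.
  refine (clsOf_conj (permRep_idem f hs) (isHom_permRep f s)
    (b := PiTensorProduct.map (fun _ => LinearMap.inl R M.carrier P.carrier) ∘ₗ M.permRep f k s)
    (c := PiTensorProduct.map fun _ => LinearMap.fst R M.carrier P.carrier)
    (((isHom_inl M P).tpow k).comp (isHom_permRep f s)) ((isHom_fst M P).tpow k) ?_ ?_ ?_).symm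
  · refine (LinearMap.comp_assoc _ _ _).symm.trans ?_
    exact (congrArg (· ∘ₗ M.permRep f k s) hfst).trans (LinearMap.id_comp _)
  · refine (congrArg (· ∘ₗ _) hnat.symm).trans ((LinearMap.comp_assoc _ _ _).trans ?_)
    refine congrArg (ρ ∘ₗ ·) ?_
    exact (PiTensorProduct.map_comp _ _).symm.trans hE.symm
  · exact (LinearMap.comp_assoc _ _ _).trans (congrArg (_ ∘ₗ ·) (permRep_idem f hs))

/-- Modules of equal class become isomorphic after adding null modules, and neither operation
changes the class of the summand. -/
lemma clsOf_permRep_eq (hQ : Function.Bijective Q.polarBilin) (hkQ : (k • Q).IsOriented)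
    (hk : IsUnit (k.factorial : R)) (hM : M.IsFGP) (hN : N.IsFGP) (h : M.cls = N.cls)
    {s : PermAlg B k} (hs : s * s = s) :
    (M.tpow k).clsOf (M.permRep f k s) = (N.tpow k).clsOf (N.permRep f k s) := by
  obtain ⟨P, P', hP, hP', hPn, hPn', e, he⟩ := exists_iso_of_cls_eq hM hN h
  rw [← clsOf_permRep_dsum hQ hkQ hk hM hP hPn hs, ← clsOf_permRep_dsum hQ hkQ hk hN hP' hPn' hs]
  have h1 : PiTensorProduct.map (fun _ : Fin k => e.toLinearMap) ∘ₗ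
      PiTensorProduct.map (fun _ => e.symm.toLinearMap) = LinearMap.id := by
    rw [← PiTensorProduct.map_comp]
    exact (congrArg _ (funext fun _ => e.comp_symm)).trans PiTensorProduct.map_id
  have h2 : PiTensorProduct.map (fun _ : Fin k => e.symm.toLinearMap) ∘ₗ
      PiTensorProduct.map (fun _ => e.toLinearMap) = LinearMap.id := by
    rw [← PiTensorProduct.map_comp]
    exact (congrArg _ (funext fun _ => e.symm_comp)).trans PiTensorProduct.map_id
  exact clsOf_iso (permRep_idem f hs) (isHom_permRep f s) (LinearEquiv.ofLinearMap _ _ h1 h2)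
    (he.tpow k) fun m => (LinearMap.congr_fun (permRep_map f s he.eps) m).symm

/-- The exterior powers are well defined on the graded Grothendieck group. -/
theorem lam_cls (hQ : Function.Bijective Q.polarBilin) (hkQ : (k • Q).IsOriented)
    (hk : IsUnit (k.factorial : R)) (hM : M.IsFGP) :
    (M.extPow k).IsFGP ∧ GrK.lam k M.cls = (M.extPow k).cls := by
  refine ⟨(splits_extPow (RingHom.id R) hk M).isFGP (tpow_isFGP hQ hkQ.nondegenerate hM), ?_⟩
  rw [GrK.lam, ← (splits_extPow (RingHom.id R) hk M).clsOf_eq,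
    ← (splits_extPow (RingHom.id R) hk _).clsOf_eq]
  exact clsOf_permRep_eq hQ hkQ hk (GrK.rep_isFGP _) hM (GrK.cls_rep _)
    (PermAlg.signIdem_mul_self hk)

end Power

end GrMod

/-! ### Products of tensor powers -/

section Block

open PermAlg

variable {a b n : ℕ} (h : a + b = n)

/-- The concatenation of two families. -/
def blockFun {A : Type*} (x : Fin a → A) (y : Fin b → A) : Fin n → A :=
  Sum.elim x y ∘ (blockEquiv h).symm

@[simp] lemma blockFun_inl {A : Type*} (x : Fin a → A) (y : Fin b → A) (i : Fin a) :
    blockFun h x y (blockEquiv h (Sum.inl i)) = x i := by simp [blockFun]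

@[simp] lemma blockFun_inr {A : Type*} (x : Fin a → A) (y : Fin b → A) (i : Fin b) :
    blockFun h x y (blockEquiv h (Sum.inr i)) = y i := by simp [blockFun]

lemma forall_block {p : Fin n → Prop} (hl : ∀ i, p (blockEquiv h (Sum.inl i)))
    (hr : ∀ i, p (blockEquiv h (Sum.inr i))) (i : Fin n) : p i := by
  obtain ⟨y, rfl⟩ := (blockEquiv h).surjective i
  rcases y with y | y
  exacts [hl y, hr y]

lemma sum_block {A : Type*} [AddCommMonoid A] (f : Fin n → A) :
    ∑ i, f i = ∑ i, f (blockEquiv h (Sum.inl i)) + ∑ i, f (blockEquiv h (Sum.inr i)) := by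
  rw [← Equiv.sum_comp (blockEquiv h) f, Fintype.sum_sum_type]

lemma blockEquiv_inl_lt_inl {i j : Fin a} :
    blockEquiv h (Sum.inl i) < blockEquiv h (Sum.inl j) ↔ i < j := by
  rw [Fin.lt_def, blockEquiv_inl_val, blockEquiv_inl_val, Fin.lt_def]

lemma blockEquiv_inr_lt_inr {i j : Fin b} :
    blockEquiv h (Sum.inr i) < blockEquiv h (Sum.inr j) ↔ i < j := by
  rw [Fin.lt_def, blockEquiv_inr_val, blockEquiv_inr_val, Fin.lt_def]
  omega

lemma blockEquiv_inl_lt_inr (i : Fin a) (j : Fin b) :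
    blockEquiv h (Sum.inl i) < blockEquiv h (Sum.inr j) := by
  rw [Fin.lt_def, blockEquiv_inl_val, blockEquiv_inr_val]
  omega

/-- A block permutation inverts no pair of positions from different blocks, so the mixed terms
vanish. -/
lemma koszulExp_blockPerm (σ : Equiv.Perm (Fin a)) (τ : Equiv.Perm (Fin b)) (d : Fin a → ZMod 2)
    (e : Fin b → ZMod 2) :
    koszulExp (blockPerm h (σ, τ)) (blockFun h d e) = koszulExp σ d + koszulExp τ e := by
  have h1 : ∀ i j, ltInd (blockEquiv h (Sum.inl i)) (blockEquiv h (Sum.inl j)) = ltInd i j :=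
    fun i j => by simp [ltInd, blockEquiv_inl_lt_inl]
  have h2 : ∀ i j, ltInd (blockEquiv h (Sum.inr i)) (blockEquiv h (Sum.inr j)) = ltInd i j :=
    fun i j => by simp [ltInd, blockEquiv_inr_lt_inr]
  have h3 : ∀ i j, ltInd (blockEquiv h (Sum.inr i)) (blockEquiv h (Sum.inl j)) = 0 :=
    fun i j => if_neg (blockEquiv_inl_lt_inr h j i).asymm
  simp only [koszulExp, sum_block h, blockPerm_apply_inl, blockPerm_apply_inr, h1, h2, h3,
    blockFun_inl, blockFun_inr, zero_mul, mul_zero, Finset.sum_const_zero, add_zero, zero_add]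

variable {R X : Type*} [CommRing R] [AddCommGroup X] [Module R X]

variable (R X) in
/-- The product of tensor powers. -/
def blockTensor : (⨂[R] _ : Fin a, X) ⊗[R] (⨂[R] _ : Fin b, X) ≃ₗ[R] ⨂[R] _ : Fin n, X :=
  (PiTensorProduct.tmulEquiv R X).trans (PiTensorProduct.reindex R (fun _ => X) (blockEquiv h))

lemma blockTensor_tprod (x : Fin a → X) (y : Fin b → X) :
    blockTensor h R X (PiTensorProduct.tprod R x ⊗ₜ PiTensorProduct.tprod R y) =
      PiTensorProduct.tprod R (blockFun h x y) := by
  rw [blockTensor, LinearEquiv.trans_apply, PiTensorProduct.tmulEquiv_apply,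
    PiTensorProduct.reindex_tprod]
  rfl

lemma blockTensor_map (F : Fin a → Module.End R X) (G : Fin b → Module.End R X) :
    (blockTensor h R X).toLinearMap ∘ₗ
        TensorProduct.map (PiTensorProduct.map F) (PiTensorProduct.map G) =
      PiTensorProduct.map (blockFun h F G) ∘ₗ (blockTensor h R X).toLinearMap := by
  refine TensorProduct.ext (PiTensorProduct.ext (MultilinearMap.ext fun x =>
    PiTensorProduct.ext (MultilinearMap.ext fun y => ?_)))
  simp only [LinearMap.compMultilinearMap_apply, LinearMap.compr₂ₛₗ_apply, TensorProduct.mk_apply,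
    LinearMap.comp_apply, LinearEquiv.coe_coe, TensorProduct.map_tmul, PiTensorProduct.map_tprod,
    blockTensor_tprod]
  congr 1
  funext i
  revert i
  exact forall_block h (by simp) (by simp)

end Block

namespace GrMod

section Power

open PermAlg

variable {R V : Type u} [CommRing R] [AddCommGroup V] [Module R V] {Q : QuadraticForm R V}
  {M : GrMod Q} {a b n : ℕ}

lemma blockFun_update_inl (h : a + b = n) {A : Type*} (x : Fin a → A) (y : Fin b → A) (j : Fin a)
    (z : A) : blockFun h (Function.update x j z) y =
      Function.update (blockFun h x y) (blockEquiv h (Sum.inl j)) z := by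
  funext i
  revert i
  refine forall_block h (fun i => ?_) fun i => ?_
  · by_cases hij : i = j
    · subst hij; simp
    · rw [blockFun_inl, Function.update_of_ne hij, Function.update_of_ne (by simpa using hij),
        blockFun_inl]
  · rw [blockFun_inr, Function.update_of_ne (by simp), blockFun_inr]

lemma blockFun_update_inr (h : a + b = n) {A : Type*} (x : Fin a → A) (y : Fin b → A) (j : Fin b)
    (z : A) : blockFun h x (Function.update y j z) =
      Function.update (blockFun h x y) (blockEquiv h (Sum.inr j)) z := by
  funext i
  revert i
  refine forall_block h (fun i => ?_) fun i => ?_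
  · rw [blockFun_inl, Function.update_of_ne (by simp), blockFun_inl]
  · by_cases hij : i = j
    · subst hij; simp
    · rw [blockFun_inr, Function.update_of_ne hij, Function.update_of_ne (by simpa using hij),
        blockFun_inr]

lemma blockTensor_oddAt_left (h : a + b = n) (j : Fin a) (f : Module.End R M.carrier) :
    (blockTensor h R M.carrier).toLinearMap ∘ₗ TensorProduct.map (M.oddAt a j f) 1 =
      M.oddAt n (blockEquiv h (Sum.inl j)) f ∘ₗ (blockTensor h R M.carrier).toLinearMap := by
  rw [← PiTensorProduct.map_one, oddAt, blockTensor_map, blockFun_update_inl, oddAt]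
  congr 3
  funext i
  revert i
  refine forall_block h (fun i => ?_) fun i => ?_
  · rw [blockFun_inl]; simp only [blockEquiv_inl_lt_inl]
  · rw [blockFun_inr, if_neg (blockEquiv_inl_lt_inr h j i).asymm]

/-- The grading involution on the whole first block is the sign that the graded tensor product gives
to an operator on its second factor. -/
lemma blockTensor_oddAt_right (h : a + b = n) (j : Fin b) (f : Module.End R M.carrier) :
    (blockTensor h R M.carrier).toLinearMap ∘ₗ
        TensorProduct.map (PiTensorProduct.map fun _ => M.eps) (M.oddAt b j f) =
      M.oddAt n (blockEquiv h (Sum.inr j)) f ∘ₗ (blockTensor h R M.carrier).toLinearMap := by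
  rw [oddAt, blockTensor_map, blockFun_update_inr, oddAt]
  congr 3
  funext i
  revert i
  refine forall_block h (fun i => ?_) fun i => ?_
  · rw [blockFun_inl, if_pos (blockEquiv_inl_lt_inr h i j)]
  · rw [blockFun_inr]; simp only [blockEquiv_inr_lt_inr]

lemma isHom_blockTensor (h : a + b = n) (h' : a • Q + b • Q = n • Q) (M : GrMod Q) :
    IsHom (tensor h' (M.tpow a) (M.tpow b)) (M.tpow n) (blockTensor h R M.carrier).toLinearMap := by
  have hv : ∀ v, (blockTensor h R M.carrier).toLinearMap ∘ₗ
      (TensorProduct.map (∑ j, M.oddAt a j (M.vec v)) 1 +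
        TensorProduct.map (PiTensorProduct.map fun _ => M.eps) (∑ j, M.oddAt b j (M.vec v))) =
      (∑ j, M.oddAt n j (M.vec v)) ∘ₗ (blockTensor h R M.carrier).toLinearMap := by
    intro v
    rw [sum_block h, LinearMap.comp_add, LinearMap.add_comp, linearMap_sum_comp,
      linearMap_sum_comp, ← Finset.sum_congr rfl fun j _ => blockTensor_oddAt_left h j (M.vec v),
      ← Finset.sum_congr rfl fun j _ => blockTensor_oddAt_right h j (M.vec v),
      ← linearMap_comp_sum, ← linearMap_comp_sum]
    congr 2
    · refine TensorProduct.ext' fun x y => ?_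
      simp [TensorProduct.sum_tmul]
    · refine TensorProduct.ext' fun x y => ?_
      simp [TensorProduct.tmul_sum]
  have he : (blockTensor h R M.carrier).toLinearMap ∘ₗ
      TensorProduct.map (PiTensorProduct.map fun _ => M.eps) (PiTensorProduct.map fun _ => M.eps) =
      (PiTensorProduct.map fun _ => M.eps) ∘ₗ (blockTensor h R M.carrier).toLinearMap := by
    rw [blockTensor_map]
    congr 2
    funext i
    revert i
    exact forall_block h (by simp) (by simp)
  refine isHom_ofOps (fun v => ?_) ?_
  · refine Eq.trans ?_ ((hv v).trans ?_)
    · refine congrArg ((blockTensor h R M.carrier).toLinearMap ∘ₗ ·) ?_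
      change TensorProduct.map ((M.tpow a).vec v) 1 +
        TensorProduct.map (M.tpow a).eps ((M.tpow b).vec v) = _
      exact congr (congrArg _ (congrArg (TensorProduct.map · 1) (tpow_vec M a v)))
        (congr (congrArg TensorProduct.map (tpow_eps M a)) (tpow_vec M b v))
    · rw [LinearMap.sum_apply]; rfl
  · exact (congrArg ((blockTensor h R M.carrier).toLinearMap ∘ₗ ·)
      (congr (congrArg TensorProduct.map (tpow_eps M a)) (tpow_eps M b))).trans he

variable [Invertible (2 : R)]

lemma blockTensor_permAct (h : a + b = n) (σ : Equiv.Perm (Fin a)) (τ : Equiv.Perm (Fin b)) :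
    (blockTensor h R M.carrier).toLinearMap ∘ₗ
        TensorProduct.map (M.permAct a σ) (M.permAct b τ) =
      M.permAct n (blockPerm h (σ, τ)) ∘ₗ (blockTensor h R M.carrier).toLinearMap := by
  refine TensorProduct.ext (tpow_hom_ext fun d x hx => tpow_hom_ext fun e y hy => ?_)
  have hxy : ∀ i, M.IsHomog (blockFun h d e i) (blockFun h x y i) :=
    forall_block h (fun i => by simpa using hx i) fun i => by simpa using hy i
  simp only [LinearMap.compr₂ₛₗ_apply, TensorProduct.mk_apply, LinearMap.comp_apply,
    LinearEquiv.coe_coe, TensorProduct.map_tmul]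
  rw [permAct_tprod σ hx, permAct_tprod τ hy, blockTensor_tprod, permAct_tprod _ hxy,
    koszulExp_blockPerm, paritySign_add, ← Int.cast_smul_eq_zsmul R, ← Int.cast_smul_eq_zsmul R,
    TensorProduct.smul_tmul_smul, map_smul, blockTensor_tprod, ← Int.cast_mul,
    Int.cast_smul_eq_zsmul]
  congr 2
  funext i
  simp only [blockFun, Function.comp_apply, ← Equiv.Perm.inv_def, ← map_inv, Prod.inv_mk,
    blockPerm_symm_blockEquiv]
  rcases (blockEquiv h).symm i with i | i <;> rfl

variable {B : Type*} [CommRing B] (f : B →+* R)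

lemma blockTensor_permRep (h : a + b = n) (x : PermAlg B a) (y : PermAlg B b) :
    (blockTensor h R M.carrier).toLinearMap ∘ₗ
        TensorProduct.map (M.permRep f a x) (M.permRep f b y) =
      M.permRep f n (blockMul h x y) ∘ₗ (blockTensor h R M.carrier).toLinearMap := by
  have hl : blockMul h x y = ∑ σ, ∑ τ, (x.coeff σ * y.coeff τ) • of (blockPerm h (σ, τ)) := by
    conv_lhs => rw [eq_sum_of x, eq_sum_of y]
    simp only [blockMul, map_sum, map_smul, leftHom_of, rightHom_of, Finset.sum_mul_sum,
      smul_mul_smul_comm, ← of_mul, ← map_mul, Prod.mk_mul_mk, one_mul, mul_one]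
  rw [hl, permRep_eq_sum, permRep_eq_sum, map_sum, linearMap_sum_comp]
  have e1 : TensorProduct.map (∑ σ, f (x.coeff σ) • M.permAct a σ)
      (∑ τ, f (y.coeff τ) • M.permAct b τ) = ∑ σ, ∑ τ, (f (x.coeff σ) * f (y.coeff τ)) •
        TensorProduct.map (M.permAct a σ) (M.permAct b τ) := by
    refine TensorProduct.ext' fun m m' => ?_
    simp only [TensorProduct.map_tmul, LinearMap.sum_apply, LinearMap.smul_apply,
      TensorProduct.sum_tmul]
    refine Finset.sum_congr rfl fun σ _ => ?_
    simp only [TensorProduct.tmul_sum, TensorProduct.smul_tmul_smul]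
  rw [e1, linearMap_comp_sum]
  refine Finset.sum_congr rfl fun σ _ => ?_
  rw [linearMap_comp_sum, map_sum, linearMap_sum_comp]
  refine Finset.sum_congr rfl fun τ _ => ?_
  rw [LinearMap.comp_smul, blockTensor_permAct, permRep_smul, permRep_of, map_mul,
    LinearMap.smul_comp]

variable [Module.Finite R V] [Module.Projective R V]

/-- Concatenation of tensor powers is equivariant for the block subgroup, so it matches the tensor
product of two summands with the summand of the product idempotent. This carries the products of the
Newton recursion into the group algebra. -/
lemma clsOf_permRep_blockMul (h : a + b = n) (h' : a • Q + b • Q = n • Q)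
    (hQ : Function.Bijective Q.polarBilin) (ha : Function.Bijective (a • Q).polarBilin)
    (hb : Function.Bijective (b • Q).polarBilin) (hn : Function.Bijective (n • Q).polarBilin)
    (hM : M.IsFGP) {x : PermAlg B a} {y : PermAlg B b} (hx : x * x = x) (hy : y * y = y) :
    (M.tpow n).clsOf (M.permRep f n (blockMul h x y)) =
      GrK.cup h' ((M.tpow a).clsOf (M.permRep f a x)) ((M.tpow b).clsOf (M.permRep f b y)) := by
  rw [cup_clsOf h' ha hb hn (tpow_isFGP hQ ha hM) (tpow_isFGP hQ hb hM) (isHom_permRep f x)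
    (permRep_idem f hx) (isHom_permRep f y) (permRep_idem f hy)]
  have hi : TensorProduct.map (M.permRep f a x) (M.permRep f b y) *
      TensorProduct.map (M.permRep f a x) (M.permRep f b y) =
      TensorProduct.map (M.permRep f a x) (M.permRep f b y) := by
    rw [← TensorProduct.map_mul, permRep_idem f hx, permRep_idem f hy]
  exact (clsOf_iso (M := tensor h' (M.tpow a) (M.tpow b)) (N := M.tpow n) hi ((isHom_permRep f x).tensor h' (isHom_permRep f y))
    (blockTensor h R M.carrier) (isHom_blockTensor h h' M)
    fun m => LinearMap.congr_fun (blockTensor_permRep f h x y) m).symm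

/-- The Adams operation in terms of summands of the tensor power. -/
theorem adams_cls (hB : IsUnit (n.factorial : B)) (hQ : Function.Bijective Q.polarBilin)
    (hO : ∀ j, 0 < j → j ≤ n → (j • Q).IsOriented) (hM : M.IsFGP) :
    GrK.adams M.cls n = ((newtonList B n).map fun p =>
      p.1 • (M.tpow n).clsOf (M.permRep f n p.2)).sum := by
  induction n using Nat.strong_induction_on with | _ n ih
  rcases n with _ | k
  · simp [GrK.adams, newtonList]
  have hfac : ∀ j ≤ k + 1, IsUnit (j.factorial : B) := fun j hj =>
    isUnit_of_dvd_factorial hB (Nat.factorial_dvd_factorial hj)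
  have hfac' : ∀ j ≤ k + 1, IsUnit (j.factorial : R) := fun j hj => by
    have := (hfac j hj).map f
    rwa [map_natCast] at this
  have hlam : ∀ j, 0 < j → j ≤ k + 1 → GrK.lam j M.cls =
      (M.tpow j).clsOf (M.permRep f j (signIdem B j)) := fun j h0 hj => by
    rw [(lam_cls hQ (hO j h0 hj) (hfac' j hj) hM).2, (splits_extPow f (hfac j hj) M).clsOf_eq]
  rw [GrK.adams, sum_newtonList_succ]
  congr 1
  · refine Fintype.sum_congr _ _ fun i => ?_
    have hi : (i : ℕ) < k := i.2
    have hij : ((i : ℕ) + 1) + (k - i) = k + 1 := by omega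
    have h1 := (hO (i + 1) (by omega) (by omega)).nondegenerate
    have h2 := (hO (k - i) (by omega) (by omega)).nondegenerate
    have h3 := (hO (k + 1) (by omega) le_rfl).nondegenerate
    have h' : ((i : ℕ) + 1) • Q + (k - i) • Q = (k + 1) • Q := by rw [← add_smul, hij]
    rw [hlam _ (by omega) (by omega), ih (k - i) (by omega) (hfac _ (by omega))
      fun j h0 hj => hO j h0 (by omega)]
    -- As a biadditive map the cup-product can be distributed over the combination supplied by the
    -- induction.
    change (-1 : ℤ) ^ (i : ℕ) • cupHom h' h1 h2 h3 _ _ = _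
    rw [map_list_sum, List.smul_sum, List.map_map, List.map_map]
    congr 1
    refine List.map_congr_left fun p hp => ?_
    simp only [Function.comp_apply, map_zsmul]
    rw [mul_smul]
    congr 2
    exact (clsOf_permRep_blockMul f hij h' hQ h1 h2 h3 hM
      (signIdem_mul_self (hfac _ (by omega)))
      (idem_of_mem_newtonList (hfac _ (by omega)) p hp)).symm
  · rw [hlam _ (by omega) le_rfl]

end Power

end GrMod

/-! ### Tensor powers of tensor products -/

section TensorPower

variable (R X Y : Type*) [CommRing R] [AddCommGroup X] [Module R X] [AddCommGroup Y] [Module R Y]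
  (k : ℕ)

/-- The map `X^{⊗k} ⊗ Y^{⊗k} → (X ⊗ Y)^{⊗k}`. -/
def powTensorToTensorPow :
    (⨂[R] _ : Fin k, X) ⊗[R] (⨂[R] _ : Fin k, Y) →ₗ[R] ⨂[R] _ : Fin k, X ⊗[R] Y :=
  TensorProduct.lift (PiTensorProduct.map₂ fun _ => TensorProduct.mk R X Y)

variable {R X Y k} in
lemma powTensorToTensorPow_tprod (x : Fin k → X) (y : Fin k → Y) :
    powTensorToTensorPow R X Y k (PiTensorProduct.tprod R x ⊗ₜ PiTensorProduct.tprod R y) =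
      PiTensorProduct.tprod R fun i => x i ⊗ₜ y i := by
  rw [powTensorToTensorPow, TensorProduct.lift.tmul, PiTensorProduct.map₂_tprod_tprod]
  rfl

/-- The component of degree `k` of the tensor algebra. -/
def tensorAlgebraProj : TensorAlgebra R X →ₗ[R] ⨂[R] _ : Fin k, X :=
  DirectSum.component R ℕ (fun n => ⨂[R]^n X) k ∘ₗ TensorAlgebra.toDirectSum.toLinearMap

variable {R X k} in
lemma tensorAlgebraProj_prod (x : Fin k → X) :
    tensorAlgebraProj R X k (List.ofFn fun i => TensorAlgebra.ι R (x i)).prod =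
      PiTensorProduct.tprod R x := by
  rw [← TensorAlgebra.tprod_apply]
  change DirectSum.component R ℕ (fun n => ⨂[R]^n X) k (TensorAlgebra.toDirectSum _) = _
  rw [TensorAlgebra.toDirectSum_tensorPower_tprod]
  exact DFinsupp.single_eq_same

/-- The map `(X ⊗ Y)^{⊗k} → X^{⊗k} ⊗ Y^{⊗k}`. -/
def tensorPowToPowTensor :
    (⨂[R] _ : Fin k, X ⊗[R] Y) →ₗ[R] (⨂[R] _ : Fin k, X) ⊗[R] (⨂[R] _ : Fin k, Y) :=
  -- Multiply the factors in the algebra T(X) ⊗ T(Y), where the X-parts and the Y-parts collect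
  -- separately, and project both sides to degree `k`.
  TensorProduct.map (tensorAlgebraProj R X k) (tensorAlgebraProj R Y k) ∘ₗ
    PiTensorProduct.lift ((MultilinearMap.mkPiAlgebraFin R k
      (TensorAlgebra R X ⊗[R] TensorAlgebra R Y)).compLinearMap
        fun _ => TensorProduct.map (TensorAlgebra.ι R) (TensorAlgebra.ι R))

lemma List.prod_ofFn_tmul {A A' : Type*} [Ring A] [Ring A'] [Algebra R A] [Algebra R A'] {k : ℕ}
    (x : Fin k → A) (y : Fin k → A') :
    (List.ofFn fun i => x i ⊗ₜ[R] y i).prod = (List.ofFn x).prod ⊗ₜ (List.ofFn y).prod := by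
  induction k with
  | zero => simp [Algebra.TensorProduct.one_def]
  | succ k ih =>
    simp only [List.ofFn_succ, List.prod_cons]
    rw [ih, Algebra.TensorProduct.tmul_mul_tmul]

variable {R X Y k} in
lemma tensorPowToPowTensor_tprod (x : Fin k → X) (y : Fin k → Y) :
    tensorPowToPowTensor R X Y k (PiTensorProduct.tprod R fun i => x i ⊗ₜ y i) =
      PiTensorProduct.tprod R x ⊗ₜ PiTensorProduct.tprod R y := by
  rw [tensorPowToPowTensor, LinearMap.comp_apply, PiTensorProduct.lift.tprod,
    MultilinearMap.compLinearMap_apply, MultilinearMap.mkPiAlgebraFin_apply]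
  simp only [TensorProduct.map_tmul]
  rw [List.prod_ofFn_tmul, TensorProduct.map_tmul, tensorAlgebraProj_prod, tensorAlgebraProj_prod]

/-- Tensor powers commute with tensor products. -/
def powTensorEquiv :
    (⨂[R] _ : Fin k, X) ⊗[R] (⨂[R] _ : Fin k, Y) ≃ₗ[R] ⨂[R] _ : Fin k, X ⊗[R] Y :=
  LinearEquiv.ofLinearMap (powTensorToTensorPow R X Y k) (tensorPowToPowTensor R X Y k)
    (PiTensorProduct.hom_ext_of_span (TensorProduct.span_tmul_eq_top R X Y) fun z hz => by
      choose x y hxy using hz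
      obtain rfl : (fun i => x i ⊗ₜ y i) = z := funext hxy
      rw [LinearMap.comp_apply, tensorPowToPowTensor_tprod, powTensorToTensorPow_tprod]
      rfl)
    (TensorProduct.ext (PiTensorProduct.ext (MultilinearMap.ext fun x =>
      PiTensorProduct.ext (MultilinearMap.ext fun y => by
        simp only [LinearMap.compMultilinearMap_apply, LinearMap.compr₂ₛₗ_apply,
          TensorProduct.mk_apply, LinearMap.comp_apply]
        rw [powTensorToTensorPow_tprod, tensorPowToPowTensor_tprod]
        rfl))))

variable {R X Y k} in
lemma powTensorEquiv_tprod (x : Fin k → X) (y : Fin k → Y) :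
    powTensorEquiv R X Y k (PiTensorProduct.tprod R x ⊗ₜ PiTensorProduct.tprod R y) =
      PiTensorProduct.tprod R fun i => x i ⊗ₜ y i :=
  powTensorToTensorPow_tprod x y

end TensorPower

/-! ### Signs of the shuffle of two tensor powers. -/

section Sign

variable {k : ℕ}

/-- The exponent of the sign of the shuffle `x₁ ⋯ xₖ y₁ ⋯ yₖ ↦ x₁ y₁ ⋯ xₖ yₖ`. -/
def shuffleExp (d e : Fin k → ZMod 2) : ZMod 2 := ∑ i, ∑ j, ltInd i j * e i * d j

lemma shuffleExp_add_single_left (d e : Fin k → ZMod 2) (j : Fin k) :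
    ∑ l, ltInd l j * d l + shuffleExp (d + Pi.single j 1) e =
      shuffleExp d e + ∑ l, ltInd l j * (d + e) l := by
  have h : shuffleExp (d + Pi.single j 1) e = shuffleExp d e + ∑ l, ltInd l j * e l := by
    simp only [shuffleExp, Pi.add_apply, mul_add, Finset.sum_add_distrib]
    congr 1
    refine Finset.sum_congr rfl fun i _ => ?_
    rw [Finset.sum_eq_single j (fun l _ hl => by simp [hl]) (by simp)]
    simp
  rw [h]
  simp only [Pi.add_apply, mul_add, Finset.sum_add_distrib]
  ring

/-- Before the shuffle, an odd operator on the j-th factor of the second family passes the whole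
first family and the earlier factors of the second. After it, it passes the pairs before `j` and the
j-th factor of the first family. The change in the shuffle sign is the difference. -/
lemma shuffleExp_add_single_right (d e : Fin k → ZMod 2) (j : Fin k) :
    ∑ l, d l + ∑ l, ltInd l j * e l + shuffleExp d (e + Pi.single j 1) =
      shuffleExp d e + ∑ l, ltInd l j * (d + e) l + d j := by
  have h : shuffleExp d (e + Pi.single j 1) = shuffleExp d e + ∑ l, ltInd j l * d l := by
    simp only [shuffleExp, Pi.add_apply, mul_add, add_mul, Finset.sum_add_distrib]
    congr 1
    rw [Finset.sum_eq_single j (fun l _ hl => by simp [hl]) (by simp)]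
    simp
  have h2 : ∑ l, d l = ∑ l, ltInd j l * d l + ∑ l, ltInd l j * d l + d j := by
    have : ∀ l, d l = ltInd j l * d l + ltInd l j * d l + if l = j then d l else 0 := by
      intro l
      by_cases hl : l = j
      · subst hl; simp [ltInd_self]
      · rw [if_neg hl, ltInd_swap hl, add_zero, ← add_mul, add_assoc, CharTwo.add_self_eq_zero,
          add_zero, one_mul]
    conv_lhs => rw [Finset.sum_congr rfl fun l _ => this l]
    simp only [Finset.sum_add_distrib]
    simp
  rw [h, h2]
  simp only [Pi.add_apply, mul_add, Finset.sum_add_distrib]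
  have h3 := CharTwo.add_self_eq_zero (∑ l, ltInd j l * d l)
  linear_combination h3

lemma koszulExp_add_shuffleExp (σ : Equiv.Perm (Fin k)) (d e : Fin k → ZMod 2) :
    koszulExp σ d + koszulExp σ e + shuffleExp (fun i => d (σ.symm i)) (fun i => e (σ.symm i)) =
      shuffleExp d e + koszulExp σ (d + e) := by
  have h := koszulExp_add σ d e
  have h1 := CharTwo.add_self_eq_zero (shuffleExp d e)
  have h2 := CharTwo.add_self_eq_zero
    (shuffleExp (fun i => d (σ.symm i)) (fun i => e (σ.symm i)))
  simp only [shuffleExp] at h1 h2 ⊢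
  linear_combination h2 - h1 - h

end Sign

/-! ### Graded tensor powers of a graded tensor product. -/

namespace GrMod

section Tensor

variable {R V : Type u} [CommRing R] [AddCommGroup V] [Module R V]
  {Q₁ Q₂ Q₃ : QuadraticForm R V} {M : GrMod Q₁} {N : GrMod Q₂} {k : ℕ}

lemma isHomog_tmul (h : Q₁ + Q₂ = Q₃) {d e : ZMod 2} {m : M.carrier} {n : N.carrier}
    (hm : M.IsHomog d m) (hn : N.IsHomog e n) :
    (tensor h M N).IsHomog (d + e) (m ⊗ₜ[R] n : M.carrier ⊗[R] N.carrier) := by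
  have e1 : M.eps m ⊗ₜ[R] N.eps n = paritySign (d + e) • (m ⊗ₜ[R] n) := by
    rw [hm, hn, paritySign_add, ← Int.cast_smul_eq_zsmul R, ← Int.cast_smul_eq_zsmul R,
      TensorProduct.smul_tmul_smul, ← Int.cast_mul, Int.cast_smul_eq_zsmul]
  exact (tensor_eps_tmul h m n).trans e1

lemma isHomog_update {d : Fin k → ZMod 2} {x : Fin k → M.carrier}
    (hx : ∀ i, M.IsHomog (d i) (x i)) (j : Fin k) {f : Module.End R M.carrier}
    (hf : ∀ m, f (M.eps m) = -M.eps (f m)) (i : Fin k) :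
    M.IsHomog ((d + Pi.single j 1 : Fin k → ZMod 2) i) (Function.update x j (f (x j)) i) := by
  by_cases hi : i = j
  · subst hi
    rw [Function.update_self, Pi.add_apply, Pi.single_eq_same, add_comm]
    exact isHomog_neg (hx i) hf
  · rw [Function.update_of_ne hi, Pi.add_apply, Pi.single_eq_of_ne hi, add_zero]
    exact hx i

lemma map_eps_tprod {d : Fin k → ZMod 2} {x : Fin k → M.carrier}
    (hx : ∀ i, M.IsHomog (d i) (x i)) :
    PiTensorProduct.map (fun _ => M.eps) (PiTensorProduct.tprod R x) =
      (paritySign (∑ i, d i) : R) • PiTensorProduct.tprod R x := by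
  have h1 : (fun i => M.eps (x i)) = fun i => ((paritySign (d i) : ℤ) : R) • x i :=
    funext fun i => by rw [Int.cast_smul_eq_zsmul]; exact hx i
  rw [PiTensorProduct.map_tprod, h1, MultilinearMap.map_smul_univ, paritySign_sum, Int.cast_prod]

lemma tprod_tmul_update {x : Fin k → M.carrier} {y : Fin k → N.carrier} (j : Fin k)
    (m : M.carrier) (n : N.carrier) :
    (fun i => Function.update x j m i ⊗ₜ[R] Function.update y j n i) =
      Function.update (fun i => x i ⊗ₜ[R] y i) j (m ⊗ₜ n) := by
  funext i
  by_cases hi : i = j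
  · subst hi; simp
  · simp [hi]

variable [Invertible (2 : R)]

lemma tpow_tmul_hom_ext {Z : Type*} [AddCommGroup Z] [Module R Z]
    {f g : (⨂[R] _ : Fin k, M.carrier) ⊗[R] (⨂[R] _ : Fin k, N.carrier) →ₗ[R] Z}
    (h : ∀ (d e : Fin k → ZMod 2) (x : Fin k → M.carrier) (y : Fin k → N.carrier),
      (∀ i, M.IsHomog (d i) (x i)) → (∀ i, N.IsHomog (e i) (y i)) →
      f (PiTensorProduct.tprod R x ⊗ₜ PiTensorProduct.tprod R y) =
        g (PiTensorProduct.tprod R x ⊗ₜ PiTensorProduct.tprod R y)) : f = g :=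
  TensorProduct.ext (tpow_hom_ext fun d x hx => tpow_hom_ext fun e y hy => h d e x y hx hy)

/-- The operator which multiplies a product of homogeneous elements by the sign of the shuffle. -/
def shuffleSign (M : GrMod Q₁) (N : GrMod Q₂) (k : ℕ) :
    Module.End R ((⨂[R] _ : Fin k, M.carrier) ⊗[R] (⨂[R] _ : Fin k, N.carrier)) :=
  ∑ d : Fin k → ZMod 2, ∑ e : Fin k → ZMod 2, (paritySign (shuffleExp d e) : R) •
    TensorProduct.map (PiTensorProduct.map fun i => M.proj (d i))
      (PiTensorProduct.map fun i => N.proj (e i))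

lemma map_proj_tprod {d d' : Fin k → ZMod 2} {x : Fin k → M.carrier}
    (hx : ∀ i, M.IsHomog (d i) (x i)) :
    PiTensorProduct.map (fun i => M.proj (d' i)) (PiTensorProduct.tprod R x) =
      if d' = d then PiTensorProduct.tprod R x else 0 := by
  rw [PiTensorProduct.map_tprod]
  split_ifs with h
  · subst h
    congr 1
    funext i
    rw [proj_apply_of_isHomog (hx i), if_pos rfl]
  · obtain ⟨i, hi⟩ := Function.ne_iff.1 h
    exact MultilinearMap.map_coord_zero _ i (by rw [proj_apply_of_isHomog (hx i), if_neg hi])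

lemma shuffleSign_tprod {d e : Fin k → ZMod 2} {x : Fin k → M.carrier} {y : Fin k → N.carrier}
    (hx : ∀ i, M.IsHomog (d i) (x i)) (hy : ∀ i, N.IsHomog (e i) (y i)) :
    shuffleSign M N k (PiTensorProduct.tprod R x ⊗ₜ PiTensorProduct.tprod R y) =
      (paritySign (shuffleExp d e) : R) •
        (PiTensorProduct.tprod R x ⊗ₜ PiTensorProduct.tprod R y) := by
  simp only [shuffleSign, LinearMap.sum_apply, LinearMap.smul_apply, TensorProduct.map_tmul,
    map_proj_tprod hx, map_proj_tprod hy]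
  rw [Finset.sum_eq_single d, Finset.sum_eq_single e]
  · simp
  · intro e' _ he'; simp [he']
  · simp
  · intro d' _ hd'; simp [hd']
  · simp

lemma shuffleSign_mul_self : shuffleSign M N k * shuffleSign M N k = 1 := by
  refine tpow_tmul_hom_ext fun d e x y hx hy => ?_
  rw [Module.End.mul_apply, shuffleSign_tprod hx hy, map_smul, shuffleSign_tprod hx hy, smul_smul,
    ← Int.cast_mul, paritySign_mul_self, Int.cast_one, one_smul]
  rfl

/-- `shuffleSign` as an equivalence. -/
def shuffleSignEquiv (M : GrMod Q₁) (N : GrMod Q₂) (k : ℕ) :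
    (⨂[R] _ : Fin k, M.carrier) ⊗[R] (⨂[R] _ : Fin k, N.carrier) ≃ₗ[R]
      (⨂[R] _ : Fin k, M.carrier) ⊗[R] (⨂[R] _ : Fin k, N.carrier) :=
  LinearEquiv.ofLinearMap (shuffleSign M N k) (shuffleSign M N k) shuffleSign_mul_self
    shuffleSign_mul_self

/-- Graded tensor powers commute with graded tensor products. -/
def shuffleEquiv (M : GrMod Q₁) (N : GrMod Q₂) (k : ℕ) :
    (⨂[R] _ : Fin k, M.carrier) ⊗[R] (⨂[R] _ : Fin k, N.carrier) ≃ₗ[R]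
      ⨂[R] _ : Fin k, M.carrier ⊗[R] N.carrier :=
  (shuffleSignEquiv M N k).trans (powTensorEquiv R M.carrier N.carrier k)

lemma shuffleEquiv_tprod {d e : Fin k → ZMod 2} {x : Fin k → M.carrier} {y : Fin k → N.carrier}
    (hx : ∀ i, M.IsHomog (d i) (x i)) (hy : ∀ i, N.IsHomog (e i) (y i)) :
    shuffleEquiv M N k (PiTensorProduct.tprod R x ⊗ₜ PiTensorProduct.tprod R y) =
      (paritySign (shuffleExp d e) : R) • PiTensorProduct.tprod R fun i => x i ⊗ₜ y i := by
  change powTensorEquiv R M.carrier N.carrier k (shuffleSign M N k _) = _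
  rw [shuffleSign_tprod hx hy, map_smul, powTensorEquiv_tprod]

/-- After expansion on homogeneous tensors, the terms from the two factors carry exactly the signs
compared in `shuffleExp_add_single_left` and `shuffleExp_add_single_right`. -/
lemma shuffleEquiv_oddAt (h : Q₁ + Q₂ = Q₃) (j : Fin k) (v : V) {d e : Fin k → ZMod 2}
    {x : Fin k → M.carrier} {y : Fin k → N.carrier}
    (hx : ∀ i, M.IsHomog (d i) (x i)) (hy : ∀ i, N.IsHomog (e i) (y i)) :
    shuffleEquiv M N k (M.oddAt k j (M.vec v) (PiTensorProduct.tprod R x) ⊗ₜ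
        PiTensorProduct.tprod R y + PiTensorProduct.map (fun _ => M.eps)
          (PiTensorProduct.tprod R x) ⊗ₜ N.oddAt k j (N.vec v) (PiTensorProduct.tprod R y)) =
      (tensor h M N).oddAt k j ((tensor h M N).vec v)
        (shuffleEquiv M N k (PiTensorProduct.tprod R x ⊗ₜ PiTensorProduct.tprod R y)) := by
  have hxy : ∀ i, (tensor h M N).IsHomog ((d + e) i) (x i ⊗ₜ[R] y i : M.carrier ⊗[R] N.carrier) :=
    fun i => isHomog_tmul h (hx i) (hy i)
  have hr : (tensor h M N).oddAt k j ((tensor h M N).vec v)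
      (shuffleEquiv M N k (PiTensorProduct.tprod R x ⊗ₜ PiTensorProduct.tprod R y)) =
      (paritySign (shuffleExp d e) * paritySign (∑ l, ltInd l j * (d + e) l) : R) •
        (PiTensorProduct.tprod R (Function.update (fun i => x i ⊗ₜ[R] y i) j
          (M.vec v (x j) ⊗ₜ y j + M.eps (x j) ⊗ₜ N.vec v (y j))) :
            ⨂[R] _ : Fin k, M.carrier ⊗[R] N.carrier) := by
    rw [mul_smul, shuffleEquiv_tprod hx hy]
    refine (LinearMap.map_smul _ _ _).trans (congrArg _ ?_)
    refine (oddAt_tprod j _ hxy).trans ?_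
    rw [Int.cast_smul_eq_zsmul]
    refine congrArg _ ?_
    exact congrArg (fun z => (PiTensorProduct.tprod R (Function.update
      (fun i => x i ⊗ₜ[R] y i) j z) : ⨂[R] _ : Fin k, M.carrier ⊗[R] N.carrier))
      (tensor_vec_tmul h v (x j) (y j))
  refine Eq.trans ?_ hr.symm
  rw [oddAt_tprod j _ hx, oddAt_tprod j _ hy, map_eps_tprod hx, ← Int.cast_smul_eq_zsmul R,
    ← Int.cast_smul_eq_zsmul R, map_add, TensorProduct.smul_tmul_smul,
    ← TensorProduct.smul_tmul', map_smul, map_smul,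
    shuffleEquiv_tprod (isHomog_update hx j (vec_apply_eps M v)) hy,
    shuffleEquiv_tprod hx (isHomog_update hy j (vec_apply_eps N v)), smul_smul, smul_smul,
    MultilinearMap.map_update_add, smul_add]
  have h1 : (fun i => Function.update x j (M.vec v (x j)) i ⊗ₜ[R] y i) =
      Function.update (fun i => x i ⊗ₜ[R] y i) j (M.vec v (x j) ⊗ₜ y j) := by
    have := tprod_tmul_update (R := R) (x := x) (y := y) j (M.vec v (x j)) (y j)
    rwa [Function.update_eq_self] at this
  have h2 : (fun i => x i ⊗ₜ[R] Function.update y j (N.vec v (y j)) i) =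
      Function.update (fun i => x i ⊗ₜ[R] y i) j (x j ⊗ₜ N.vec v (y j)) := by
    have := tprod_tmul_update (R := R) (x := x) (y := y) j (x j) (N.vec v (y j))
    rwa [Function.update_eq_self] at this
  have h3 : M.eps (x j) ⊗ₜ[R] N.vec v (y j) =
      ((paritySign (d j) : ℤ) : R) • (x j ⊗ₜ[R] N.vec v (y j)) := by
    rw [hx j, ← Int.cast_smul_eq_zsmul R, TensorProduct.smul_tmul']
  rw [h1, h2, h3, MultilinearMap.map_update_smul, smul_smul]
  simp only [← Int.cast_mul, ← paritySign_add, shuffleExp_add_single_left,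
    shuffleExp_add_single_right]

lemma isHom_shuffleEquiv (h : Q₁ + Q₂ = Q₃) (h' : k • Q₁ + k • Q₂ = k • Q₃) (M : GrMod Q₁)
    (N : GrMod Q₂) : IsHom (tensor h' (M.tpow k) (N.tpow k)) ((tensor h M N).tpow k)
      (shuffleEquiv M N k).toLinearMap := by
  have hv : ∀ v, (shuffleEquiv M N k).toLinearMap ∘ₗ
      (TensorProduct.map (∑ j, M.oddAt k j (M.vec v)) 1 +
        TensorProduct.map (PiTensorProduct.map fun _ => M.eps) (∑ j, N.oddAt k j (N.vec v))) =
      (∑ j, (tensor h M N).oddAt k j ((tensor h M N).vec v) :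
        Module.End R (⨂[R] _ : Fin k, M.carrier ⊗[R] N.carrier)) ∘ₗ
        (shuffleEquiv M N k).toLinearMap := by
    intro v
    refine tpow_tmul_hom_ext fun d e x y hx hy => ?_
    have h1 := fun j => shuffleEquiv_oddAt h j v hx hy
    simp only [map_add] at h1
    simp only [LinearMap.comp_apply, LinearMap.add_apply, TensorProduct.map_tmul,
      LinearMap.sum_apply, TensorProduct.sum_tmul, TensorProduct.tmul_sum, map_add, map_sum,
      Module.End.one_apply, LinearEquiv.coe_coe, ← Finset.sum_add_distrib]
    exact (Finset.sum_congr rfl fun j _ => h1 j).trans (LinearMap.sum_apply _ _ _).symm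
  have he : (shuffleEquiv M N k).toLinearMap ∘ₗ
      TensorProduct.map (PiTensorProduct.map fun _ => M.eps) (PiTensorProduct.map fun _ => N.eps) =
      (PiTensorProduct.map fun _ => TensorProduct.map M.eps N.eps) ∘ₗ
        (shuffleEquiv M N k).toLinearMap := by
    refine tpow_tmul_hom_ext fun d e x y hx hy => ?_
    have hx' : ∀ i, M.IsHomog (d i) (M.eps (x i)) := fun i => by rw [IsHomog, hx i, map_zsmul, hx i]
    have hy' : ∀ i, N.IsHomog (e i) (N.eps (y i)) := fun i => by rw [IsHomog, hy i, map_zsmul, hy i]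
    simp only [LinearMap.comp_apply, TensorProduct.map_tmul, LinearEquiv.coe_coe,
      PiTensorProduct.map_tprod]
    rw [shuffleEquiv_tprod hx' hy', shuffleEquiv_tprod hx hy, map_smul, PiTensorProduct.map_tprod]
    simp only [TensorProduct.map_tmul]
  refine isHom_ofOps (fun v => ?_) ?_
  · refine Eq.trans ?_ ((hv v).trans ?_)
    · refine congrArg ((shuffleEquiv M N k).toLinearMap ∘ₗ ·) ?_
      change TensorProduct.map ((M.tpow k).vec v) 1 +
        TensorProduct.map (M.tpow k).eps ((N.tpow k).vec v) = _
      exact congr (congrArg _ (congrArg (TensorProduct.map · 1) (tpow_vec M k v)))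
        (congr (congrArg TensorProduct.map (tpow_eps M k)) (tpow_vec N k v))
    · rw [LinearMap.sum_apply]; rfl
  · refine (congrArg ((shuffleEquiv M N k).toLinearMap ∘ₗ ·)
      (congr (congrArg TensorProduct.map (tpow_eps M k)) (tpow_eps N k))).trans (he.trans ?_)
    exact congrArg (fun z : Module.End R (M.carrier ⊗[R] N.carrier) =>
      PiTensorProduct.map (fun _ : Fin k => z) ∘ₗ (shuffleEquiv M N k).toLinearMap)
      (tensor_eps h M N).symm

/-- This is the diagonal action: the Koszul signs on the two families and on the pairs differ by the
shuffle signs, as `koszulExp_add_shuffleExp` records. -/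
lemma shuffleEquiv_permAct (h : Q₁ + Q₂ = Q₃) (σ : Equiv.Perm (Fin k)) :
    (shuffleEquiv M N k).toLinearMap ∘ₗ TensorProduct.map (M.permAct k σ) (N.permAct k σ) =
      ((tensor h M N).permAct k σ : Module.End R (⨂[R] _ : Fin k, M.carrier ⊗[R] N.carrier)) ∘ₗ
        (shuffleEquiv M N k).toLinearMap := by
  refine tpow_tmul_hom_ext fun d e x y hx hy => ?_
  have hxy : ∀ i, (tensor h M N).IsHomog ((d + e) i) (x i ⊗ₜ[R] y i : M.carrier ⊗[R] N.carrier) :=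
    fun i => isHomog_tmul h (hx i) (hy i)
  have hr : (tensor h M N).permAct k σ
      (shuffleEquiv M N k (PiTensorProduct.tprod R x ⊗ₜ PiTensorProduct.tprod R y)) =
      (paritySign (shuffleExp d e) * paritySign (koszulExp σ (d + e)) : R) •
        (PiTensorProduct.tprod R (fun i => x (σ.symm i) ⊗ₜ[R] y (σ.symm i)) :
            ⨂[R] _ : Fin k, M.carrier ⊗[R] N.carrier) := by
    rw [mul_smul, shuffleEquiv_tprod hx hy]
    refine (LinearMap.map_smul _ _ _).trans (congrArg _ ?_)
    refine (permAct_tprod σ hxy).trans ?_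
    rw [Int.cast_smul_eq_zsmul]
    rfl
  refine Eq.trans ?_ hr.symm
  simp only [LinearMap.comp_apply, TensorProduct.map_tmul, LinearEquiv.coe_coe]
  rw [permAct_tprod σ hx, permAct_tprod σ hy, ← Int.cast_smul_eq_zsmul R,
    ← Int.cast_smul_eq_zsmul R, TensorProduct.smul_tmul_smul, map_smul,
    shuffleEquiv_tprod (d := fun i => d (σ.symm i)) (e := fun i => e (σ.symm i))
      (fun i => hx _) (fun i => hy _), smul_smul]
  simp only [← Int.cast_mul, ← paritySign_add, koszulExp_add_shuffleExp]

end Tensor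

end GrMod

lemma List.sum_map_eq_sum_get {α K : Type*} [AddCommMonoid K] (L : List α) (F : α → K) :
    (L.map F).sum = ∑ i : Fin L.length, F (L.get i) := by
  rw [← Fin.sum_univ_getElem]
  refine Fintype.sum_equiv (finCongr (List.length_map F)) _ _ fun i => ?_
  simp

namespace GrMod

/-! ### Multiplicativity of the Adams operations -/

section Multiplicative

open PermAlg

variable {R V : Type u} [CommRing R] [AddCommGroup V] [Module R V]
  {Q₁ Q₂ Q₃ : QuadraticForm R V} {k : ℕ} {B : Type*} [CommRing B]

/-- The class of a summand cut out by an idempotent is determined by a decomposition of the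
idempotent. -/
lemma clsOf_decomposition {Q : QuadraticForm R V} {Z : GrMod Q} (hZ : Z.IsFGP) {A : Type*} [Ring A]
    [Algebra B A] (ρ : A →+* Module.End R Z.carrier) (hρ : ∀ x, IsHom Z Z (ρ x))
    (S : SplitFamily B A) {e : A} {κ : Type} [Fintype κ] [DecidableEq κ] {l : κ → S.ι}
    {b c : κ → A} (h : S.IsDecomposition e l b c) :
    Z.clsOf (ρ e) = ∑ t, Z.clsOf (ρ (S.a (l t))) := by
  -- The `b t * c t` are orthogonal idempotents with sum `e`, and each is equivalent through `c t`
  -- and `b t` to a standard idempotent.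
  have hbc : ∀ t, b t * c t * (b t * c t) = b t * c t := fun t => by
    rw [mul_assoc, ← mul_assoc (c t), h.c_mul_b, if_pos rfl, ← mul_assoc, h.b_right]
  rw [← h.sum, map_sum, clsOf_sum hZ _ (fun t => hρ _) (fun t => by rw [← map_mul, hbc])
    fun s t hst => by
      rw [← map_mul, mul_assoc, ← mul_assoc (c s), h.c_mul_b, if_neg hst, zero_mul, mul_zero,
        map_zero]]
  refine Finset.sum_congr rfl fun t _ => ?_
  refine clsOf_conj (b := ρ (c t)) (c := ρ (b t)) (by rw [← map_mul, hbc]) (hρ _) (hρ _) (hρ _)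
    (map_mul ρ _ _).symm ?_ ?_
  · refine (map_mul ρ _ _).symm.trans ?_
    rw [h.c_mul_b, if_pos rfl]
  · refine (map_mul ρ _ _).symm.trans ?_
    rw [← mul_assoc, h.c_mul_b, if_pos rfl, h.left_c]

variable [Invertible (2 : R)]

/-- The action of the tensor square of the group algebra on a product of tensor powers. -/
def permRep₂ (M : GrMod Q₁) (N : GrMod Q₂) (f : B →+* R) (k : ℕ) :
    PermAlg B k ⊗[B] PermAlg B k →+*
      Module.End R ((⨂[R] _ : Fin k, M.carrier) ⊗[R] (⨂[R] _ : Fin k, N.carrier)) :=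
  -- The endomorphism ring is a `B`-algebra only by way of `f`, so this structure is kept local.
  letI := Algebra.compHom
    (Module.End R ((⨂[R] _ : Fin k, M.carrier) ⊗[R] (⨂[R] _ : Fin k, N.carrier))) f
  (Algebra.TensorProduct.lift (S := B)
    { toFun := fun x => TensorProduct.map (M.permRep f k x) 1
      map_one' := by rw [map_one, TensorProduct.map_one]
      map_mul' := fun x y => by rw [map_mul, ← TensorProduct.map_mul, one_mul]
      map_zero' := by rw [map_zero, TensorProduct.map_zero_left]
      map_add' := fun x y => by rw [map_add, TensorProduct.map_add_left]
      commutes' := fun b => by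
        rw [Algebra.algebraMap_eq_smul_one, permRep_smul, map_one, TensorProduct.map_smul_left,
          TensorProduct.map_one, Algebra.algebraMap_eq_smul_one]
        rfl }
    { toFun := fun x => TensorProduct.map 1 (N.permRep f k x)
      map_one' := by rw [map_one, TensorProduct.map_one]
      map_mul' := fun x y => by rw [map_mul, ← TensorProduct.map_mul, one_mul]
      map_zero' := by rw [map_zero, TensorProduct.map_zero_right]
      map_add' := fun x y => by rw [map_add, TensorProduct.map_add_right]
      commutes' := fun b => by
        rw [Algebra.algebraMap_eq_smul_one, permRep_smul, map_one, TensorProduct.map_smul_right,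
          TensorProduct.map_one, Algebra.algebraMap_eq_smul_one]
        rfl }
    fun x y => by
      change TensorProduct.map (M.permRep f k x) 1 * TensorProduct.map 1 (N.permRep f k y) =
        TensorProduct.map 1 (N.permRep f k y) * TensorProduct.map (M.permRep f k x) 1
      rw [← TensorProduct.map_mul, ← TensorProduct.map_mul, one_mul, mul_one, one_mul,
        mul_one] : _ →ₐ[B] _).toRingHom

variable {M : GrMod Q₁} {N : GrMod Q₂} (f : B →+* R)

lemma permRep₂_tmul (x y : PermAlg B k) :
    permRep₂ M N f k (x ⊗ₜ y) = TensorProduct.map (M.permRep f k x) (N.permRep f k y) := by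
  change TensorProduct.map (M.permRep f k x) 1 * TensorProduct.map 1 (N.permRep f k y) = _
  rw [← TensorProduct.map_mul, one_mul, mul_one]

lemma isHom_permRep₂ (h' : k • Q₁ + k • Q₂ = k • Q₃) (t : PermAlg B k ⊗[B] PermAlg B k) :
    IsHom (tensor h' (M.tpow k) (N.tpow k)) (tensor h' (M.tpow k) (N.tpow k))
      (permRep₂ M N f k t) := by
  induction t with
  | zero =>
    have : permRep₂ M N f k 0 = 0 := map_zero _
    exact this ▸ IsHom.zero (tensor h' (M.tpow k) (N.tpow k)) _
  | tmul x y => exact permRep₂_tmul (M := M) (N := N) f x y ▸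
      (isHom_permRep f x).tensor h' (isHom_permRep f y)
  | add t s ht hs =>
    have : permRep₂ M N f k (t + s) = permRep₂ M N f k t + permRep₂ M N f k s := map_add _ _ _
    exact this ▸ ht.add hs

lemma shuffleEquiv_permRep (h : Q₁ + Q₂ = Q₃) (x : PermAlg B k) :
    (shuffleEquiv M N k).toLinearMap ∘ₗ permRep₂ M N f k (diag B k x) =
      ((tensor h M N).permRep f k x : Module.End R (⨂[R] _ : Fin k, M.carrier ⊗[R] N.carrier)) ∘ₗ
        (shuffleEquiv M N k).toLinearMap := by
  have hx : diag B k x = ∑ σ, (x.coeff σ • of σ) ⊗ₜ of σ := by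
    conv_lhs => rw [eq_sum_of x]
    rw [map_sum]
    exact Finset.sum_congr rfl fun σ _ => by rw [map_smul, diag_of, TensorProduct.smul_tmul']
  let P : Equiv.Perm (Fin k) → Module.End R (⨂[R] _ : Fin k, M.carrier ⊗[R] N.carrier) :=
    fun σ => f (x.coeff σ) • (tensor h M N).permAct k σ
  have h1 : (tensor h M N).permRep f k x = ∑ σ, P σ := permRep_eq_sum f x
  refine Eq.trans ?_ (congrArg (· ∘ₗ (shuffleEquiv M N k).toLinearMap) h1).symm
  refine Eq.trans ?_ (linearMap_sum_comp _ Finset.univ P).symm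
  rw [hx, map_sum, linearMap_comp_sum]
  refine Finset.sum_congr rfl fun σ _ => ?_
  rw [permRep₂_tmul, permRep_smul, permRep_of, permRep_of, TensorProduct.map_smul_left,
    LinearMap.comp_smul, shuffleEquiv_permAct h]
  exact (LinearMap.smul_comp _ _ _).symm

lemma clsOf_permRep_tensor (h : Q₁ + Q₂ = Q₃) (h' : k • Q₁ + k • Q₂ = k • Q₃) {x : PermAlg B k}
    (hx : x * x = x) :
    ((tensor h M N).tpow k).clsOf ((tensor h M N).permRep f k x) =
      (tensor h' (M.tpow k) (N.tpow k)).clsOf (permRep₂ M N f k (diag B k x)) := by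
  have hi : permRep₂ M N f k (diag B k x) * permRep₂ M N f k (diag B k x) =
      permRep₂ M N f k (diag B k x) := by rw [← map_mul, ← map_mul, hx]
  exact (clsOf_iso (M := tensor h' (M.tpow k) (N.tpow k)) (N := (tensor h M N).tpow k) hi
    (isHom_permRep₂ f h' _) (shuffleEquiv M N k) (isHom_shuffleEquiv h h' M N)
    fun m => LinearMap.congr_fun (shuffleEquiv_permRep f h x) m).symm

variable [Module.Finite R V] [Module.Projective R V] [IsDomain B] [CharZero B]
  [IsPrincipalIdealRing B]

/-- The Adams operations are multiplicative. -/
theorem adams_cup (f : B →+* R) (hk : 0 < k) (hB : IsUnit (k.factorial : B)) (h : Q₁ + Q₂ = Q₃)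
    (h' : k • Q₁ + k • Q₂ = k • Q₃)
    (h₁ : Function.Bijective Q₁.polarBilin) (h₂ : Function.Bijective Q₂.polarBilin)
    (h₃ : Function.Bijective Q₃.polarBilin)
    (hO₁ : ∀ j, 0 < j → j ≤ k → (j • Q₁).IsOriented)
    (hO₂ : ∀ j, 0 < j → j ≤ k → (j • Q₂).IsOriented)
    (hO₃ : ∀ j, 0 < j → j ≤ k → (j • Q₃).IsOriented) (x : GrK Q₁) (y : GrK Q₂) :
    GrK.adams (GrK.cup h x y) k = GrK.cup h' (GrK.adams x k) (GrK.adams y k) := by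
  obtain ⟨M, hM, rfl⟩ := x.exists_rep
  obtain ⟨N, hN, rfl⟩ := y.exists_rep
  have hk₁ := (hO₁ k hk le_rfl).nondegenerate
  have hk₂ := (hO₂ k hk le_rfl).nondegenerate
  have hk₃ := (hO₃ k hk le_rfl).nondegenerate
  rw [cup_cls h h₁ h₂ h₃ hM hN, adams_cls f hB h₃ hO₃ (tensor_isFGP h h₁ h₂ h₃ hM hN),
    adams_cls f hB h₁ hO₁ hM, adams_cls f hB h₂ hO₂ hN]
  let L := newtonList B k
  let c : Fin L.length → ℤ := fun i => (L.get i).1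
  let e : Fin L.length → PermAlg B k := fun i => (L.get i).2
  have he : ∀ i, e i * e i = e i := fun i => idem_of_mem_newtonList hB _ (List.get_mem _ _)
  -- Newton's identity: on class functions the combination behaves like a single k-cycle.
  have hchar : ∀ χ : Equiv.Perm (Fin k) → B, (∀ σ τ, χ (σ * τ) = χ (τ * σ)) →
      ∑ i, c i • extend χ (e i) = χ (finRotate k) := fun χ hχ => by
    rw [← sum_newtonList_extend hk hB hχ]
    exact (List.sum_map_eq_sum_get L fun p => p.1 • extend χ p.2).symm
  let Z := tensor h' (M.tpow k) (N.tpow k)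
  have hZ : Z.IsFGP := tensor_isFGP h' hk₁ hk₂ hk₃ (tpow_isFGP h₁ hk₁ hM) (tpow_isFGP h₂ hk₂ hN)
  have hl : ((newtonList B k).map fun p => p.1 • ((tensor h M N).tpow k).clsOf
      ((tensor h M N).permRep f k p.2)).sum =
      ∑ i, c i • Z.clsOf (permRep₂ M N f k (diag B k (e i))) :=
    (List.sum_map_eq_sum_get _ _).trans (Finset.sum_congr rfl fun i _ => by
      exact congrArg (c i • ·) (clsOf_permRep_tensor f h h' (he i)))
  have hr : GrK.cup h'
      ((newtonList B k).map fun p => p.1 • (M.tpow k).clsOf (M.permRep f k p.2)).sum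
      ((newtonList B k).map fun p => p.1 • (N.tpow k).clsOf (N.permRep f k p.2)).sum =
      ∑ p : Fin L.length × Fin L.length,
        (c p.1 * c p.2) • Z.clsOf (permRep₂ M N f k (e p.1 ⊗ₜ e p.2)) := by
    refine (congrArg₂ (GrK.cup h') (List.sum_map_eq_sum_get _ _) (List.sum_map_eq_sum_get _ _)).trans ?_
    change cupHom h' hk₁ hk₂ hk₃ _ _ = _
    rw [map_sum, Fintype.sum_prod_type_right]
    refine Finset.sum_congr rfl fun j _ => ?_
    rw [map_sum, AddMonoidHom.finsetSum_apply]
    refine Finset.sum_congr rfl fun i _ => ?_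
    rw [map_zsmul, map_zsmul, AddMonoidHom.zsmul_apply, smul_smul, mul_comm]
    congr 1
    refine (cup_clsOf h' hk₁ hk₂ hk₃ (tpow_isFGP h₁ hk₁ hM) (tpow_isFGP h₂ hk₂ hN)
      (isHom_permRep f (e i)) (permRep_idem f (he i)) (isHom_permRep f (e j))
      (permRep_idem f (he j))).trans ?_
    exact congrArg Z.clsOf (permRep₂_tmul f (e i) (e j)).symm
  rw [hl, hr]
  obtain ⟨S⟩ := nonempty_splitFamily hB
  let T := S.tensor S
  -- A single relation between idempotents of the tensor square: the diagonal images enter with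
  -- coefficients `c i`, the pure tensors with `-(c i * c j)`. Its traces vanish by `sum_diag_eq`,
  -- so the corresponding relation between classes holds.
  have hzero := T.sum_smul_eq_zero
    (J := Fin L.length ⊕ Fin L.length × Fin L.length)
    (Sum.elim c fun p => -(c p.1 * c p.2))
    (e := Sum.elim (fun i => diag B k (e i)) fun p => e p.1 ⊗ₜ e p.2)
    (by
      rintro (i | p)
      · simp only [Sum.elim_inl]; rw [← map_mul, he]
      · simp only [Sum.elim_inr]; rw [Algebra.TensorProduct.tmul_mul_tmul, he, he])
    (fun i => by
      rw [Fintype.sum_sum_type]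
      simp only [Sum.elim_inl, Sum.elim_inr, neg_smul, Finset.sum_neg_distrib]
      rw [← sub_eq_add_neg, sub_eq_zero]
      exact sum_diag_eq hchar (S.χ i.1) (S.χ i.2) (S.χ_comm i.1) (S.χ_comm i.2))
    (Sum.elim (fun i => Z.clsOf (permRep₂ M N f k (diag B k (e i))))
      fun p => Z.clsOf (permRep₂ M N f k (e p.1 ⊗ₜ e p.2)))
    (fun i => Z.clsOf (permRep₂ M N f k (T.a i)))
    (by
      rintro (i | p) κ _ _ l b c hd
      · exact clsOf_decomposition hZ (permRep₂ M N f k) (isHom_permRep₂ f h') T hd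
      · exact clsOf_decomposition hZ (permRep₂ M N f k) (isHom_permRep₂ f h') T hd)
  rw [Fintype.sum_sum_type] at hzero
  simp only [Sum.elim_inl, Sum.elim_inr, neg_smul, Finset.sum_neg_distrib] at hzero
  rwa [← sub_eq_add_neg, sub_eq_zero] at hzero

end Multiplicative

end GrMod

end

/-! ### The main theorem, with the group algebra taken over ℤ[1/k!]. -/

theorem theorem2p5 {R V : Type u} [CommRing R] [Invertible (2 : R)] [AddCommGroup V] [Module R V]
    [Module.Finite R V] [Module.Projective R V] (q : QuadraticForm R V)
    (hq : Function.Bijective q.polarBilin) (m : ℕ)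
    (hrank : ∀ p : PrimeSpectrum R, Module.rankAtStalk V p = 2 * m) (o : QuadOrientation q m)
    (k : ℕ) (hk : 0 < k) (hfact : IsUnit ((Nat.factorial k : ℕ) : R)) :
    -- the cup-product is well defined: it does not depend on the modules chosen
    (∀ (i j : ℕ), 0 < i → 0 < j → IsUnit (i : R) → IsUnit (j : R) → IsUnit ((i + j : ℕ) : R) →
      ∀ (Q₁ Q₂ Q₃ : QuadraticForm R V) (h : Q₁ + Q₂ = Q₃), Q₁ = i • q → Q₂ = j • q →
      ∀ (M : GrMod Q₁) (N : GrMod Q₂), M.IsFGP → N.IsFGP →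
        (GrMod.tensor h M N).IsFGP ∧
        GrK.cup h (GrMod.cls M) (GrMod.cls N) = GrMod.cls (GrMod.tensor h M N)) ∧
    -- the exterior powers are well defined
    (∀ (i j : ℕ), 0 < i → i ≤ k → 0 < j → IsUnit (j : R) →
      ∀ (Q : QuadraticForm R V), Q = j • q → ∀ M : GrMod Q, M.IsFGP →
        (GrMod.extPow M i).IsFGP ∧ GrK.lam i (GrMod.cls M) = GrMod.cls (GrMod.extPow M i)) ∧
    -- multiplicativity, an identity in `K(C(V, 2 k q))`
    (∀ x y : GrK q,
      GrK.adams (GrK.cup (two_nsmul q).symm x y) k =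
        GrK.cup (show k • q + k • q = k • (2 • q) by rw [two_nsmul, smul_add])
          (GrK.adams x k) (GrK.adams y k)) := by
  have hfac : ∀ j, 0 < j → j ≤ k → IsUnit (j : R) := fun j h0 hj =>
    PermAlg.isUnit_of_le hfact h0 hj
  have h2 : IsUnit ((2 : ℕ) : R) := by
    rw [Nat.cast_ofNat]; exact isUnit_of_invertible (2 : R)
  refine ⟨?_, ?_, ?_⟩
  · rintro i j - - hi hj hij Q₁ Q₂ Q₃ h rfl rfl M N hM hN
    have h1 := polarBilin_nsmul_bijective hq hi
    have h2 := polarBilin_nsmul_bijective hq hj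
    have h3 : Function.Bijective Q₃.polarBilin := by
      rw [← h, ← add_smul]
      exact polarBilin_nsmul_bijective hq hij
    exact ⟨GrMod.tensor_isFGP h h1 h2 h3 hM hN, GrMod.cup_cls h h1 h2 h3 hM hN⟩
  · rintro i j hi hik - hj Q rfl M hM
    refine GrMod.lam_cls (polarBilin_nsmul_bijective hq hj) ?_
      (PermAlg.isUnit_of_dvd_factorial hfact (Nat.factorial_dvd_factorial hik)) hM
    rw [smul_smul]
    refine o.isOriented_nsmul hq hrank ?_
    rw [Nat.cast_mul]
    exact (hfac i hi hik).mul hj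
  · intro x y
    have hk0 : ((k.factorial : ℕ) : ℤ) ≠ 0 := by exact_mod_cast k.factorial_ne_zero
    -- The ring ℤ[1/k!] is a principal ideal domain of characteristic zero, as needed for counting
    -- multiplicities. It inverts the order of the symmetric group and maps to `R`, which itself may
    -- have torsion or zero divisors.
    let B := Localization.Away ((k.factorial : ℕ) : ℤ)
    have hle : Submonoid.powers ((k.factorial : ℕ) : ℤ) ≤ nonZeroDivisors ℤ :=
      powers_le_nonZeroDivisors_of_noZeroDivisors hk0
    have : IsDomain B := IsLocalization.isDomain_localization hle
    have : IsPrincipalIdealRing B :=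
      IsLocalization.isPrincipalIdealRing_of (Submonoid.powers ((k.factorial : ℕ) : ℤ)) B
    have : CharZero B := charZero_of_injective_algebraMap (R := ℤ) (IsLocalization.injective B hle)
    have hB : IsUnit ((k.factorial : ℕ) : B) := by
      have := IsLocalization.Away.algebraMap_isUnit (S := B) ((k.factorial : ℕ) : ℤ)
      rwa [map_natCast] at this
    let f : B →+* R := IsLocalization.Away.lift ((k.factorial : ℕ) : ℤ)
      (g := Int.castRingHom R) (by rwa [map_natCast])
    have hO : ∀ j, 0 < j → j ≤ k → (j • q).IsOriented := fun j h0 hj =>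
      o.isOriented_nsmul hq hrank (hfac j h0 hj)
    refine GrMod.adams_cup f hk hB _ _ hq hq (polarBilin_nsmul_bijective hq h2) hO hO
      (fun j h0 hj => ?_) x y
    rw [smul_smul]
    refine o.isOriented_nsmul hq hrank ?_
    rw [Nat.cast_mul]
    exact (hfac j h0 hj).mul h2
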